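/- **Definitions.** A generalized Cartan matrix is a real matrix $A=(a_{ij})_{i,j\in I}$ with $I$ countable, $q_ia_{ij}=q_ja_{ji}$ for some positive reals $q_i$, $a_{ij}\le 0$ for $i\ne j$, and such that $a_{ii}>0$ implies $a_{ii}=2$ and $a_{ij}\in\mathbb Z$ for all $j$. The complex Lie algebra $\mathfrak g(A)$ is generated by $h_i,e_i,f_i$ $(i\in I)$ with relations $[h_i,e_k]=a_{ik}e_k$, $[h_i,f_k]=-a_{ik}f_k$, $[e_i,f_j]=\delta_{ij}h_i$; $\operatorname{ad}(e_i)^{1-a_{ij}}e_j=\operatorname{ad}(f_i)^{1-a_{ij}}f_j=0$ if $a_{ii}=2$, $i\neq j$; and $[e_i,e_j]=[f_i,f_j]=0$ if $a_{ij}=0$. A Borcherds–Kac–Moody algebra is a Lie algebra $(\mathfrak g(A)/C).D$ with $C$ a central ideal and $D$ a commutative complement that acts diagonally on the $e_i$, $f_i$ (by opposite scalars on $e_i$ and $f_i$). Its Cartan subalgebra $\mathfrak h$ is spanned by the $h_i$ and $D$; its simple roots $\alpha_i\in\mathfrak h^*$ (indexed by $i \in I$, so counted with multiplicity) are the weights of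 the $e_i$; and a symmetric form on $\mathfrak h^*$ is chosen with $(\alpha_i,\mu)=q_i\,\mu(h_i)$ for all $\mu\in\mathfrak h^*$ and some symmetrizing $q_i>0$. Such an algebra $\mathfrak g$ is *Fricke* if $\dim\mathfrak h=2$, exactly one simple root $\alpha$ is real ($a_{ii}>0$), no simple root has norm zero, there is $\rho\in\mathfrak h^*$ with $(\rho,\rho)=0$ and $(\alpha_i,\rho)=-(\alpha_i,\alpha_i)/2$ for all $i$, and for each real bound only finitely many simple roots have norm greater than it. Write $\mathfrak g_{m,n}$ $(m,n\in\mathbb Z)$ for the weight space of weight $-m\rho-n(\rho+\alpha)$; thus $\rho$ has coordinates $(-1,0)$ and the real simple root has degree $(1,-1)$. Let $N\ge 1$. An action of a group $H$ on $\mathfrak g$ by Lie algebra automorphisms preserving every $\mathfrak g_{m,n}$ is *level $N$ $q$-compatible* if, for $(r,s)\neq(0,0)$, the isomorphism class of the $H$-module $\mathfrak g_{r,s}$ depends only on $rs$ and on $r,s$ modulo $N$. Then there are $H$-modules $V^{a,b/N}_{n}$, for $a,b\in\mathbb Z/N\mathbb Z$ and $n\in\frac1N\mathbb Z$, with $\mathfrak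 g_{r,s}\cong V^{r,s/N}_{rs/N}$ for all $(r,s)\ne(0,0)$; fix any such system (nothing is required of those $V^{a,b/N}_n$ that do not occur as a root space). For $h\in H$ put $\zeta_h=\operatorname{Tr}(h|\mathfrak g_{1,-1})$ and, for integers $k,\ell,m$, $$f_{k,\ell,m}(q)=\sum_{n\in\frac1N\mathbb Z}\ \sum_{\substack{r\in\frac1N\mathbb Z/\mathbb Z\\ kr-n\in\mathbb Z}}e^{2\pi i\ell r}\operatorname{Tr}(h^m|V^{k,r}_n)\,q^n ,$$ a formal series in integral powers of $q^{1/N}$. For such a series $f(q)=\sum_t c_tq^{t/N}$ write $f((\zeta_hp)^N)=\sum_tc_t(\zeta_hp)^t$ and $f(e^{2\pi ib/d}q^{a/d})=\sum_tc_te^{2\pi ibt/(dN)}q^{at/(dN)}$. **Theorem.** Let $\mathfrak g$ be a Fricke Lie algebra and let $H$ be a group with a level $N$ $q$-compatible action on $\mathfrak g$. All $\mathfrak g_{r,s}$ are finite-dimensional, and for every $h\in H$ the series $p\big(f_{1,0,1}((\zeta_hp)^N)-f_{1,0,1}(q)\big)$ is a power series in $p$ with constant term $1$ whose coefficients are series in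 rational powers of $q$ with well-ordered support; as formal series in $p$ and rational powers of $q$, $$\log\Big(p\big(f_{1,0,1}((\zeta_hp)^N)-f_{1,0,1}(q)\big)\Big)=-\sum_{m=1}^\infty\frac{p^m}{m}\sum_{\substack{ad=m\\0\le b<d}}f_{d,-b,a}\big(e^{2\pi ib/d}q^{a/d}\big).$$ -/

import Mathlib

universe u v w x

noncomputable section

namespace FrickeLie

open Module

/-! ### Borcherds-Kac-Moody Lie algebras -/

/-- Generalized Cartan matrices. -/
structure IsGeneralizedCartanMatrix {I : Type v} (A : Matrix I I ℝ) : Prop where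
  countable : Countable I
  symmetrizable : ∃ q : I → ℝ, (∀ i, 0 < q i) ∧ ∀ i j, q i * A i j = q j * A j i
  offDiag_nonpos : ∀ i j, i ≠ j → A i j ≤ 0
  diag_of_pos : ∀ i, 0 < A i i → A i i = 2
  integral_of_pos : ∀ i, 0 < A i i → ∀ j, ∃ z : ℤ, A i j = z

/-- The free complex Lie algebra on the symbols `h_i, e_i, f_i`, `i ∈ I`. -/
abbrev FreeGen (I : Type v) : Type v := FreeLieAlgebra ℂ (CartanMatrix.Generators I)

/-- The free generator `h_i`. -/
abbrev genH {I : Type v} (i : I) : FreeGen I := FreeLieAlgebra.of ℂ (CartanMatrix.Generators.H i)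
/-- The free generator `e_i`. -/
abbrev genE {I : Type v} (i : I) : FreeGen I := FreeLieAlgebra.of ℂ (CartanMatrix.Generators.E i)
/-- The free generator `f_i`. -/
abbrev genF {I : Type v} (i : I) : FreeGen I := FreeLieAlgebra.of ℂ (CartanMatrix.Generators.F i)

/-- The elements of the free Lie algebra that are set to zero in the universal
Borcherds-Kac-Moody Lie algebra of `A`. In the Serre relations `a_{ii} = 2` and `a_{ij} = -n`, so
that the exponent is `1 - 2 a_{ij} / a_{ii} = n + 1`. -/
inductive IsRelator {I : Type v} (A : Matrix I I ℝ) : FreeGen I → Prop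
  | he (i k : I) : IsRelator A (⁅genH i, genE k⁆ - (A i k : ℂ) • genE k)
  | hf (i k : I) : IsRelator A (⁅genH i, genF k⁆ + (A i k : ℂ) • genF k)
  | ef_self (i : I) : IsRelator A (⁅genE i, genF i⁆ - genH i)
  | ef_ne (i j : I) (hij : i ≠ j) : IsRelator A ⁅genE i, genF j⁆
  | serre_e (i j : I) (n : ℕ) (hi : 0 < A i i) (hij : i ≠ j) (hn : A i j = -(n : ℝ)) :
      IsRelator A ((LieAlgebra.ad ℂ (FreeGen I) (genE i) ^ (n + 1)) (genE j))
  | serre_f (i j : I) (n : ℕ) (hi : 0 < A i i) (hij : i ≠ j) (hn : A i j = -(n : ℝ)) :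
      IsRelator A ((LieAlgebra.ad ℂ (FreeGen I) (genF i) ^ (n + 1)) (genF j))
  | orth_e (i j : I) (h : A i j = 0) : IsRelator A ⁅genE i, genE j⁆
  | orth_f (i j : I) (h : A i j = 0) : IsRelator A ⁅genF i, genF j⁆

/-- The ideal of relations. -/
def relIdeal {I : Type v} (A : Matrix I I ℝ) : LieIdeal ℂ (FreeGen I) :=
  LieSubmodule.lieSpan ℂ (FreeGen I) {y | IsRelator A y}

/-- The universal Borcherds-Kac-Moody Lie algebra `𝔤(A)` over the complex numbers. -/
abbrev UniversalBKM {I : Type v} (A : Matrix I I ℝ) : Type v := FreeGen I ⧸ relIdeal A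

/-- The image of a word in the generators in `𝔤(A)`. -/
def UniversalBKM.of {I : Type v} (A : Matrix I I ℝ) (y : FreeGen I) : UniversalBKM A :=
  LieSubmodule.Quotient.mk (N := relIdeal A) y

/-- A presentation of the complex Lie algebra `𝔤` as a Borcherds-Kac-Moody Lie algebra
`(𝔤(A) / C).D`: a homomorphism `π` from `𝔤(A)` whose kernel `C` is central, and a commutative
complement `D` of its image that acts by degree derivations, i.e., multiplies each `e_i`, `f_i` by
opposite scalars. The Cartan subalgebra is spanned by the `h_i` and `D`, and its eigenvalue on
`e_i` is the simple root of index `i` (equal simple roots may occur for several indices). -/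
structure BKMStructure (𝔤 : Type u) [LieRing 𝔤] [LieAlgebra ℂ 𝔤] where
  /-- the index set of the simple roots, counted with multiplicity -/
  I : Type v
  A : Matrix I I ℝ
  isGeneralizedCartanMatrix : IsGeneralizedCartanMatrix A
  π : UniversalBKM A →ₗ⁅ℂ⁆ 𝔤
  ker_central : ∀ y, π y = 0 → ∀ z : UniversalBKM A, ⁅y, z⁆ = 0
  D : Submodule ℂ 𝔤
  isCompl : IsCompl (LinearMap.range (π : UniversalBKM A →ₗ[ℂ] 𝔤)) D
  D_comm : ∀ y ∈ D, ∀ z ∈ D, ⁅y, z⁆ = 0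
  cartan : Submodule ℂ 𝔤
  cartan_eq : cartan =
    Submodule.span ℂ (Set.range fun i => π (UniversalBKM.of A (genH i))) ⊔ D
  simpleRoot : I → Dual ℂ cartan
  lie_e : ∀ i (y : cartan), ⁅(y : 𝔤), π (UniversalBKM.of A (genE i))⁆ =
    simpleRoot i y • π (UniversalBKM.of A (genE i))
  lie_f : ∀ i (y : cartan), ⁅(y : 𝔤), π (UniversalBKM.of A (genF i))⁆ =
    -(simpleRoot i y • π (UniversalBKM.of A (genF i)))

namespace BKMStructure

variable {𝔤 : Type u} [LieRing 𝔤] [LieAlgebra ℂ 𝔤] (B : BKMStructure.{u, v} 𝔤)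

/-- The coroot `h_i` as an element of the Cartan subalgebra of `𝔤`. -/
def coroot (i : B.I) : B.cartan :=
  ⟨B.π (UniversalBKM.of B.A (genH i)), by
    rw [B.cartan_eq]
    exact Submodule.mem_sup_left (Submodule.subset_span ⟨i, rfl⟩)⟩

/-- The weight space of weight `μ` of the Cartan subalgebra on `𝔤`. -/
def weightSpace (μ : Dual ℂ B.cartan) : Submodule ℂ 𝔤 where
  carrier := {y | ∀ c : B.cartan, ⁅(c : 𝔤), y⁆ = μ c • y}
  add_mem' := by
    intro y z hy hz c
    rw [lie_add, hy c, hz c, smul_add]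
  zero_mem' := by
    intro c
    simp
  smul_mem' := by
    intro t y hy c
    rw [lie_smul, hy c, smul_comm]

end BKMStructure

/-! ### Fricke Lie algebras -/

/-- A presentation of `𝔤` as a Fricke Lie algebra. The bilinear form on the dual of the Cartan
subalgebra is the one for which the simple root `α_i` corresponds to `q_i h_i`, where the positive
numbers `q_i` symmetrize the Cartan matrix; so `(α_i, α_j) = q_i a_{ij}`. -/
structure FrickeStructure (𝔤 : Type u) [LieRing 𝔤] [LieAlgebra ℂ 𝔤] extends
    BKMStructure.{u, v} 𝔤 where
  /-- rank two -/
  finrank_cartan : finrank ℂ cartan = 2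
  /-- exactly one real simple root -/
  realIndex : I
  real_iff : ∀ i, 0 < A i i ↔ i = realIndex
  /-- no norm zero simple roots -/
  norm_ne_zero : ∀ i, A i i ≠ 0
  form : LinearMap.BilinForm ℂ (Dual ℂ cartan)
  form_symm : ∀ μ ν, form μ ν = form ν μ
  q : I → ℝ
  q_pos : ∀ i, 0 < q i
  form_simpleRoot : ∀ i μ, form (simpleRoot i) μ = (q i : ℂ) * μ (toBKMStructure.coroot i)
  /-- a Weyl vector of norm zero -/
  ρ : Dual ℂ cartan
  form_ρ_ρ : form ρ ρ = 0
  form_simpleRoot_ρ : ∀ i, form (simpleRoot i) ρ = -form (simpleRoot i) (simpleRoot i) / 2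
  /-- only finitely many simple roots of norm greater than any fixed bound -/
  finite_norm_gt : ∀ b : ℝ, {i | b < q i * A i i}.Finite

namespace FrickeStructure

variable {𝔤 : Type u} [LieRing 𝔤] [LieAlgebra ℂ 𝔤] (F : FrickeStructure.{u, v} 𝔤)

/-- The weight of degree `(m, n)`, in the coordinates on the dual of the Cartan subalgebra in which
the Weyl vector `ρ` is `(-1, 0)` and the real simple root `α` is `(1, -1)`; so `(1, 0)` is `-ρ`
and `(0, 1)` is `-ρ - α`. -/
def weight (m n : ℤ) : Dual ℂ F.cartan :=
  (m : ℂ) • (-F.ρ) + (n : ℂ) • (-F.ρ - F.simpleRoot F.realIndex)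

/-- The piece `𝔤_{m,n}` of degree `(m, n)` in the `ℤ × ℤ`-grading. -/
def rootSpace (m n : ℤ) : Submodule ℂ 𝔤 := F.weightSpace (F.weight m n)

end FrickeStructure

/-! ### Homogeneous and q-compatible actions -/

/-- An action of the group `H` on `𝔤` by homogeneous Lie algebra automorphisms. -/
structure HomogeneousAction {𝔤 : Type u} [LieRing 𝔤] [LieAlgebra ℂ 𝔤]
    (F : FrickeStructure.{u, v} 𝔤) (H : Type w) [Group H] where
  toRep : Representation ℂ H 𝔤
  map_lie : ∀ σ y z, toRep σ ⁅y, z⁆ = ⁅toRep σ y, toRep σ z⁆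
  map_rootSpace : ∀ (m n : ℤ) (σ : H), F.rootSpace m n ≤ (F.rootSpace m n).comap (toRep σ)

namespace HomogeneousAction

variable {𝔤 : Type u} [LieRing 𝔤] [LieAlgebra ℂ 𝔤] {F : FrickeStructure.{u, v} 𝔤}
  {H : Type w} [Group H] (act : HomogeneousAction F H)

/-- The `H`-module `𝔤_{m,n}`. -/
def rootRep (m n : ℤ) : Representation ℂ H (F.rootSpace m n) :=
  act.toRep.subrepresentation (F.rootSpace m n) (act.map_rootSpace m n)

/-- The scalar `ζ_h = Tr(h | 𝔤_{1,-1})`. -/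
def zeta (h : H) : ℂ := LinearMap.trace ℂ (F.rootSpace 1 (-1)) (act.rootRep 1 (-1) h)

/-- The action is level `N` q-compatible: away from degree `(0, 0)`, the isomorphism class of the
`H`-module `𝔤_{r,s}` depends only on the product `r * s` and on the residue classes of `r` and `s`
modulo `N`. (In the grading by `ℤ × (1/N)ℤ`, the degree of `𝔤_{r,s}` is `(r, s/N)`.) -/
def IsQCompatible (N : ℕ) : Prop :=
  ∀ r s r' s' : ℤ, (r, s) ≠ (0, 0) → (r', s') ≠ (0, 0) →
    (r : ZMod N) = r' → (s : ZMod N) = s' → r * s = r' * s' →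
    Nonempty ((act.rootRep r s).Equiv (act.rootRep r' s'))

/-- A system of abstract `H`-modules that replaces the `𝔤_{r,s}`: `V a b n` with `a, b` in `ℤ/Nℤ`
and `n` in `ℤ` is what is denoted `V^{a, b/N}_{n/N}` in the grading by `ℤ × (1/N)ℤ`. Nothing is
required of those `V a b n` that do not occur as a root space. -/
structure RootModules (N : ℕ) where
  V : ZMod N → ZMod N → ℤ → Type x
  [addCommGroup : ∀ a b n, AddCommGroup (V a b n)]
  [module : ∀ a b n, Module ℂ (V a b n)]
  rep : ∀ a b n, Representation ℂ H (V a b n)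
  equiv : ∀ r s : ℤ, (r, s) ≠ (0, 0) →
    (act.rootRep r s).Equiv (rep (r : ZMod N) (s : ZMod N) (r * s))

attribute [instance] RootModules.addCommGroup RootModules.module

open Classical in
/-- Every level `N` q-compatible action admits a system of abstract `H`-modules. -/
theorem IsQCompatible.nonempty_rootModules {N : ℕ} (hq : act.IsQCompatible N) :
    Nonempty (RootModules.{u, v, w, u} act N) := by
  let P : ZMod N → ZMod N → ℤ → ℤ × ℤ → Prop := fun a b n t =>
    t ≠ (0, 0) ∧ (t.1 : ZMod N) = a ∧ (t.2 : ZMod N) = b ∧ t.1 * t.2 = n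
  let pick : ZMod N → ZMod N → ℤ → ℤ × ℤ := fun a b n =>
    if h : ∃ t, P a b n t then h.choose else (0, 0)
  have hpick : ∀ r s : ℤ, (r, s) ≠ (0, 0) → P r s (r * s) (pick r s (r * s)) := by
    intro r s hrs
    have h : ∃ t, P r s (r * s) t := ⟨(r, s), hrs, rfl, rfl, rfl⟩
    simp only [pick, dif_pos h]
    exact h.choose_spec
  exact ⟨{
    V := fun a b n => F.rootSpace (pick a b n).1 (pick a b n).2
    rep := fun a b n => act.rootRep (pick a b n).1 (pick a b n).2
    equiv := fun r s hrs =>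
      let h := hpick r s hrs
      (hq r s _ _ hrs h.1 h.2.1.symm h.2.2.1.symm h.2.2.2.symm).some }⟩

/-! ### Trace functions and Hecke operators -/

namespace RootModules

variable {act} {N : ℕ} [NeZero N] (M : RootModules.{u, v, w, x} act N) (h : H)

/-- The normalized trace function `f_{k,ℓ,m}`, a formal series in integral powers of `q^{1/N}`,
through its coefficients: the coefficient of `q^{t/N}` is the sum over the residue classes
`r = b/N` modulo `ℤ` such that `k r - t/N` is an integer of `exp(2πi ℓ r) Tr(h^m | V^{k,r}_{t/N})`. -/
def traceFn (k l m : ℤ) (t : ℤ) : ℂ :=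
  ∑ b : ZMod N, if (k : ZMod N) * b = (t : ZMod N) then
    Complex.exp (2 * Real.pi * Complex.I * l * ((b.val : ℂ) / N)) *
      LinearMap.trace ℂ (M.V k b t) (M.rep k b t (h ^ m))
  else 0

end RootModules

end HomogeneousAction

/-- For a formal series `f = ∑ c(t) q^{t/N}`, the formal series `f(exp(2πi b/d) q^{a/d})` in
rational powers of `q`, through its coefficients: each `q^{t/N}` is replaced by
`exp(2πi b t/(dN)) q^{at/(dN)}`. For positive `a, d, N` the coefficient of `q^y` has at most one
contribution. -/
def evalRoot (N : ℕ) (c : ℤ → ℂ) (a d b : ℕ) (y : ℚ) : ℂ :=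
  ∑ᶠ t : {t : ℤ // (a : ℚ) * t / (d * N) = y},
    Complex.exp (2 * Real.pi * Complex.I * b * (t : ℤ) / (d * N)) * c t

/-- The coefficient of `p^m q^y` in
`-∑_{m ≥ 1} (p^m / m) ∑_{ad = m, 0 ≤ b < d} f_{d,-b,a}(exp(2πi b/d) q^{a/d})`. -/
def heckeSide {𝔤 : Type u} [LieRing 𝔤] [LieAlgebra ℂ 𝔤] {F : FrickeStructure.{u, v} 𝔤}
    {H : Type w} [Group H] {act : HomogeneousAction F H} {N : ℕ} [NeZero N]
    (M : HomogeneousAction.RootModules.{u, v, w, x} act N) (h : H) (m : ℕ) (y : ℚ) : ℂ :=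
  -(1 / (m : ℂ)) * ∑ ad ∈ m.divisorsAntidiagonal, ∑ b ∈ Finset.range ad.2,
    evalRoot N (M.traceFn h ad.2 (-(b : ℤ)) ad.1) ad.1 ad.2 b y

/-- Formal series in rational powers of `q` with well-ordered support. -/
abbrev QSeries : Type := HahnSeries ℚ ℂ

end FrickeLie

end

/-! The positive part of a Fricke Lie algebra is almost free. Since `ρ` is isotropic and no simple
root has norm zero, the Weyl vector condition places every simple root at `(1, n_i)`, with `n_i =
-1` for the real one `r` and `n_i ≥ 1` otherwise (`simpleRoot_eq`). Imaginary simple roots are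
therefore never orthogonal to each other, and the only relations among the `e_i` are those between
`e_r` and the others. The root spaces with positive first coordinate together form `ℂ e_r` plus a
free Lie algebra on the letters `(ad e_r)^k e_i`, `0 ≤ k < n_i` (`Adapted.E_eq`,
`letterLift_e_injective`). Freeness comes from an explicit action of `𝔤(A)` on the free associative
algebra on the letters, in which each letter acts by left multiplication (`letterLift_injective`).
Passing to the quotient by a central ideal loses nothing, because some `h_j` acts on the free part
with nonzero eigenvalues.

For a graded free Lie algebra, the product of `(1 - e^γ)^(dim γ)` is `1` minus the sum of the
weights of the generators; this is proved by Lazard elimination (`wittFormula`). To include `h`,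
which need not act semisimply, the imaginary `e_i` are replaced by generalized eigenvectors with
eigenvalues `μ_i`, and the eigenvalue becomes a further coordinate of the grading. The dimensions of
the refined pieces then determine `Tr(h^a)` for all `a` at once (`trace_rootRep_of_nonneg`).

With `q` for `q^(1/N)`, multiplying by the factor `1 - ζ p q⁻¹` of the real root makes the strings
telescope: `(1 - ζ p q⁻¹)(1 - ∑_i ∑_k μ_i ζ^k p^(k+1) q^(n_i-k)) = p (f(ζp) - f(q))`, which is the
twisted denominator formula (`truncMap_denominator`). Its logarithm is minus the sum of `Tr(h^a |
𝔤_{d,s}) p^(ad) q^(as) / a`. The sum over `b` in the Hecke operator is a character sum that isolates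
exactly these traces (`sum_traceFn`).

The computation takes place after `p ↦ p q`, where all exponents of `q` are natural numbers and all
products are finite modulo a power of `q`. The logarithm is characterized by `L · X G' = X L'` and
`G(0) = 0` (`logOf_eq_of_mul_euler`), an algebraic condition that survives ring homomorphisms and so
returns to the original variables. -/

namespace FrickeLie

open Module

attribute [local instance] LieRing.ofAssociativeRing

/-- The bracket of operators is the commutator. -/
abbrev endLieRingModule (V : Type*) [AddCommGroup V] [Module ℂ V] :
    LieRingModule (Module.End ℂ V) (Module.End ℂ V) := lieRingSelfModule

attribute [local instance] endLieRingModule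

/-! ### Free Lie algebras and operators on free associative algebras -/

section FreeLie

variable {X : Type*}

theorem freeLie_subalgebra_eq_top (S : LieSubalgebra ℂ (FreeLieAlgebra ℂ X))
    (h : ∀ x, FreeLieAlgebra.of ℂ x ∈ S) : S = ⊤ := by
  let φ : FreeLieAlgebra ℂ X →ₗ⁅ℂ⁆ S := FreeLieAlgebra.lift ℂ fun x => ⟨_, h x⟩
  have hφ : S.incl.comp φ = LieHom.id := by
    apply FreeLieAlgebra.hom_ext
    intro x
    simp [φ]
  rw [eq_top_iff]
  intro y _
  have := LieHom.congr_fun hφ y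
  rw [LieHom.comp_apply, LieHom.id_apply] at this
  rw [← this]
  exact (φ y).2

theorem freeLie_induction {p : FreeLieAlgebra ℂ X → Prop}
    (of : ∀ x, p (FreeLieAlgebra.of ℂ x)) (zero : p 0)
    (add : ∀ a b, p a → p b → p (a + b)) (smul : ∀ (c : ℂ) a, p a → p (c • a))
    (lie : ∀ a b, p a → p b → p ⁅a, b⁆) (y : FreeLieAlgebra ℂ X) : p y := by
  let S : LieSubalgebra ℂ (FreeLieAlgebra ℂ X) :=
    { carrier := {y | p y}
      add_mem' := fun ha hb => add _ _ ha hb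
      zero_mem' := zero
      smul_mem' := fun c a ha => smul c a ha
      lie_mem' := fun ha hb => lie _ _ ha hb }
  have : y ∈ S := by
    rw [freeLie_subalgebra_eq_top S of]
    trivial
  exact this

/-- Left multiplication by a generator of the free associative algebra. -/
noncomputable def leftMul (x : X) : Module.End ℂ (FreeAlgebra ℂ X) :=
  LinearMap.mulLeft ℂ (FreeAlgebra.ι ℂ x)

theorem leftMul_apply (x : X) (m : FreeAlgebra ℂ X) : leftMul x m = FreeAlgebra.ι ℂ x * m := rfl

theorem freeAlgebra_left_induction {p : FreeAlgebra ℂ X → Prop} (one : p 1)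
    (add : ∀ a b, p a → p b → p (a + b)) (smul : ∀ (c : ℂ) a, p a → p (c • a))
    (mul : ∀ x a, p a → p (FreeAlgebra.ι ℂ x * a)) (a : FreeAlgebra ℂ X) : p a := by
  suffices h : ∀ m, p m → p (a * m) by simpa using h 1 one
  induction a with
  | grade0 r =>
    intro m hm
    rw [← Algebra.smul_def]
    exact smul r m hm
  | grade1 x => exact fun m hm => mul x m hm
  | mul a b ha hb =>
    intro m hm
    rw [mul_assoc]
    exact ha _ (hb _ hm)
  | add a b ha hb =>
    intro m hm
    rw [add_mul]
    exact add _ _ (ha _ hm) (hb _ hm)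

/-- An operator on the free associative algebra is determined by its value at `1` and its
commutators with the left multiplications. -/
theorem end_eq_of_comm {S S' : Module.End ℂ (FreeAlgebra ℂ X)} (h1 : S 1 = S' 1)
    (hx : ∀ x : X, ⁅S, leftMul x⁆ = ⁅S', leftMul x⁆) : S = S' := by
  ext a
  induction a using freeAlgebra_left_induction with
  | one => exact h1
  | add a b ha hb => rw [map_add, map_add, ha, hb]
  | smul c a ha => rw [map_smul, map_smul, ha]
  | mul x a ha =>
    have h := LinearMap.congr_fun (hx x) a
    simp only [Ring.lie_def, LinearMap.sub_apply, Module.End.mul_apply, leftMul_apply, ha] at h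
    exact sub_left_injective h

/-- There is an operator on the free associative algebra with prescribed value at `1` and
prescribed commutators with the left multiplications. -/
theorem exists_end_of_comm (a₀ : FreeAlgebra ℂ X) (G : X → Module.End ℂ (FreeAlgebra ℂ X)) :
    ∃ S : Module.End ℂ (FreeAlgebra ℂ X), S 1 = a₀ ∧ ∀ x, ⁅S, leftMul x⁆ = G x := by
  let T := FreeAlgebra ℂ X
  -- A triangular action on `T × T`: its values on `(1, a₀)` trace out the graph of the desired `S`,
  -- and the off-diagonal entry `G x` encodes `S (x m) = x (S m) + G x m`.
  let g : X → Module.End ℂ (T × T) := fun x =>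
    LinearMap.prod (leftMul x ∘ₗ LinearMap.fst ℂ T T)
      (leftMul x ∘ₗ LinearMap.snd ℂ T T + G x ∘ₗ LinearMap.fst ℂ T T)
  let Θ : T →ₐ[ℂ] Module.End ℂ (T × T) := FreeAlgebra.lift ℂ g
  have hΘ : ∀ x, Θ (FreeAlgebra.ι ℂ x) = g x := fun x => FreeAlgebra.lift_ι_apply g x
  have hfst : ∀ m : T, (Θ m (1, a₀)).1 = m := by
    intro m
    induction m using freeAlgebra_left_induction with
    | one => simp
    | add a b ha hb => simp [ha, hb]
    | smul c a ha => simp [ha]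
    | mul x a ha =>
      rw [map_mul, Module.End.mul_apply, hΘ]
      change FreeAlgebra.ι ℂ x * (Θ a (1, a₀)).1 = _
      rw [ha]
  let S : Module.End ℂ T :=
    { toFun := fun m => (Θ m (1, a₀)).2
      map_add' := by intro a b; simp
      map_smul' := by intro c a; simp }
  refine ⟨S, by simp [S], fun x => ?_⟩
  ext m
  have h : S (FreeAlgebra.ι ℂ x * m) = FreeAlgebra.ι ℂ x * S m + G x m := by
    change (Θ (FreeAlgebra.ι ℂ x * m) (1, a₀)).2 = _
    rw [map_mul, Module.End.mul_apply, hΘ]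
    simp [g, leftMul_apply, hfst, S]
  simp only [Ring.lie_def, LinearMap.sub_apply, Module.End.mul_apply, leftMul_apply, h]
  abel

/-- The canonical map from the free Lie algebra to the free associative algebra. -/
noncomputable def freeLieToAssoc (X : Type*) : FreeLieAlgebra ℂ X →ₗ⁅ℂ⁆ FreeAlgebra ℂ X :=
  FreeLieAlgebra.lift ℂ (FreeAlgebra.ι ℂ)

theorem freeLieToAssoc_of (x : X) :
    freeLieToAssoc X (FreeLieAlgebra.of ℂ x) = FreeAlgebra.ι ℂ x :=
  FreeLieAlgebra.lift_of_apply _ _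

end FreeLie

/-! ### Spans of homogeneous brackets -/

section GradedSpan

variable {G : Type*} [LieRing G] [LieAlgebra ℂ G] {X Γ : Type*} [AddCommMonoid Γ]

/-- Iterated brackets in the family `g`, with their total weight. -/
inductive IsBracket (g : X → G) (wt : X → Γ) : Γ → G → Prop
  | of (x : X) : IsBracket g wt (wt x) (g x)
  | lie {γ δ : Γ} {a b : G} (ha : IsBracket g wt γ a) (hb : IsBracket g wt δ b) :
      IsBracket g wt (γ + δ) ⁅a, b⁆

/-- The span of the iterated brackets of weight `γ`. -/
def gradedSpan (g : X → G) (wt : X → Γ) (γ : Γ) : Submodule ℂ G :=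
  Submodule.span ℂ {a | IsBracket g wt γ a}

variable {g : X → G} {wt : X → Γ}

theorem mem_gradedSpan (x : X) : g x ∈ gradedSpan g wt (wt x) :=
  Submodule.subset_span (IsBracket.of x)

theorem lie_mem_span_of_forall {s t : Set G} {P : Submodule ℂ G}
    (h : ∀ a ∈ s, ∀ b ∈ t, ⁅a, b⁆ ∈ P) {a b : G} (ha : a ∈ Submodule.span ℂ s)
    (hb : b ∈ Submodule.span ℂ t) : ⁅a, b⁆ ∈ P := by
  induction ha using Submodule.span_induction with
  | zero => simp
  | add a a' _ _ ha ha' => rw [add_lie]; exact P.add_mem ha ha'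
  | smul c a _ ha => rw [smul_lie]; exact P.smul_mem c ha
  | mem a ha =>
    induction hb using Submodule.span_induction with
    | zero => simp
    | add b b' _ _ hb hb' => rw [lie_add]; exact P.add_mem hb hb'
    | smul c b _ hb => rw [lie_smul]; exact P.smul_mem c hb
    | mem b hb => exact h a ha b hb

theorem lie_mem_gradedSpan {γ δ : Γ} {a b : G} (ha : a ∈ gradedSpan g wt γ)
    (hb : b ∈ gradedSpan g wt δ) : ⁅a, b⁆ ∈ gradedSpan g wt (γ + δ) :=
  lie_mem_span_of_forall (fun _ ha _ hb => Submodule.subset_span (IsBracket.lie ha hb)) ha hb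

theorem gradedSpan_le {P : Γ → Submodule ℂ G} (hg : ∀ x : X, g x ∈ P (wt x))
    (hP : ∀ γ δ a b, a ∈ P γ → b ∈ P δ → ⁅a, b⁆ ∈ P (γ + δ)) (γ : Γ) :
    gradedSpan g wt γ ≤ P γ := by
  refine Submodule.span_le.2 fun a ha => ?_
  induction ha with
  | of x => exact hg x
  | lie _ _ ha hb => exact hP _ _ _ _ ha hb

theorem lie_mem_iSup {ι : Type*} {P : ι → Submodule ℂ G} {Q : Submodule ℂ G}
    (h : ∀ i j, ∀ a ∈ P i, ∀ b ∈ P j, ⁅a, b⁆ ∈ Q) {a b : G} (ha : a ∈ ⨆ i, P i)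
    (hb : b ∈ ⨆ i, P i) : ⁅a, b⁆ ∈ Q := by
  rw [Submodule.iSup_eq_span] at ha hb
  refine lie_mem_span_of_forall ?_ ha hb
  intro a ha b hb
  obtain ⟨i, hi⟩ := Set.mem_iUnion.1 ha
  obtain ⟨j, hj⟩ := Set.mem_iUnion.1 hb
  exact h i j a hi b hj

/-- The subalgebra generated by a family is the sum of the spans of homogeneous brackets. -/
def bracketSubalgebra (g : X → G) (wt : X → Γ) : LieSubalgebra ℂ G :=
  { (⨆ γ, gradedSpan g wt γ : Submodule ℂ G) with
    lie_mem' := fun {_ _} ha hb => lie_mem_iSup (Q := ⨆ γ, gradedSpan g wt γ)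
      (fun γ δ _ ha _ hb => Submodule.mem_iSup_of_mem (γ + δ) (lie_mem_gradedSpan ha hb)) ha hb }

theorem mem_bracketSubalgebra {a : G} :
    a ∈ bracketSubalgebra g wt ↔ a ∈ ⨆ γ, gradedSpan g wt γ := Iff.rfl

theorem iSup_gradedSpan_freeLie (wt : X → Γ) :
    ⨆ γ, gradedSpan (FreeLieAlgebra.of ℂ) wt γ = (⊤ : Submodule ℂ (FreeLieAlgebra ℂ X)) := by
  have := freeLie_subalgebra_eq_top (bracketSubalgebra (FreeLieAlgebra.of ℂ (X := X)) wt)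
    fun x => Submodule.mem_iSup_of_mem (wt x) (mem_gradedSpan x)
  rw [eq_top_iff]
  intro y _
  rw [← mem_bracketSubalgebra, this]
  trivial

theorem map_gradedSpan {G' : Type*} [LieRing G'] [LieAlgebra ℂ G'] (φ : G →ₗ⁅ℂ⁆ G') (γ : Γ) :
    (gradedSpan g wt γ).map (φ : G →ₗ[ℂ] G') = gradedSpan (fun x => φ (g x)) wt γ := by
  apply le_antisymm
  · rw [Submodule.map_le_iff_le_comap]
    refine gradedSpan_le (P := fun γ => (gradedSpan (fun x => φ (g x)) wt γ).comap
      (φ : G →ₗ[ℂ] G')) (fun x => mem_gradedSpan (g := fun x => φ (g x)) x) ?_ γ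
    intro γ δ a b ha hb
    change φ ⁅a, b⁆ ∈ gradedSpan (fun x => φ (g x)) wt (γ + δ)
    rw [LieHom.map_lie]
    exact lie_mem_gradedSpan ha hb
  · refine gradedSpan_le (g := fun x => φ (g x))
      (P := fun γ => (gradedSpan g wt γ).map (φ : G →ₗ[ℂ] G'))
      (fun x => Submodule.mem_map_of_mem (mem_gradedSpan (g := g) x)) ?_ γ
    rintro γ δ _ _ ⟨a, ha, rfl⟩ ⟨b, hb, rfl⟩
    exact ⟨⁅a, b⁆, lie_mem_gradedSpan ha hb, LieHom.map_lie φ a b⟩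

theorem gradedSpan_eq_bot_of_deg_le {k : ℕ} (deg : Γ →+ ℕ) (hk : ∀ x, k < deg (wt x)) {γ : Γ}
    (hγ : deg γ ≤ k) : gradedSpan g wt γ = ⊥ := by
  have h : ∀ γ a, IsBracket g wt γ a → k < deg γ := by
    intro γ a h
    induction h with
    | of x => exact hk x
    | lie _ _ ha hb => rw [map_add]; omega
  rw [gradedSpan, Submodule.span_eq_bot]
  intro a ha
  exact absurd (h γ a ha) (by omega)

end GradedSpan

/-- An operator is injective on the sum of its eigenspaces for nonzero eigenvalues. -/
theorem eq_zero_of_mem_iSup_eigenspace {V : Type*} [AddCommGroup V] [Module ℂ V]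
    (T : Module.End ℂ V) {y : V} (hy : y ∈ ⨆ c : {c : ℂ // c ≠ 0}, T.eigenspace c)
    (hT : T y = 0) : y = 0 := by
  have h := (T.eigenspaces_iSupIndep).disjoint_biSup (x := (0 : ℂ)) (y := {c | c ≠ 0}) (by simp)
  refine (Submodule.disjoint_def.1 h) y ?_ ?_
  · rw [Module.End.mem_eigenspace_iff, hT, zero_smul]
  · rw [iSup_subtype'] 
    exact hy

/-- Let `x` act on `L × ℂ` by `(y, c) ↦ (⁅x, y⁆ + c x, 0)`. For `z` in the free Lie algebra `L`, the
first component `E z` of `z · (0, 1)` is a derivation of `L` that fixes the generators, hence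
multiplies degree `n` by `n`. The action factors through the free associative algebra, so `E`
vanishes on the kernel. All degrees are positive, so `E` is injective. This takes the place of the
Poincaré–Birkhoff–Witt theorem. -/
theorem freeLieToAssoc_injective (X : Type*) : Function.Injective (freeLieToAssoc X) := by
  rw [injective_iff_map_eq_zero]
  intro y hy
  let g : X → Module.End ℂ ((FreeLieAlgebra ℂ X) × ℂ) := fun x =>
    LinearMap.inl ℂ (FreeLieAlgebra ℂ X) ℂ ∘ₗ
      ((LieAlgebra.ad ℂ (FreeLieAlgebra ℂ X) (FreeLieAlgebra.of ℂ x) : Module.End ℂ (FreeLieAlgebra ℂ X)) ∘ₗ LinearMap.fst ℂ (FreeLieAlgebra ℂ X) ℂ +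
        (LinearMap.toSpanSingleton ℂ (FreeLieAlgebra ℂ X) (FreeLieAlgebra.of ℂ x)) ∘ₗ LinearMap.snd ℂ (FreeLieAlgebra ℂ X) ℂ)
  let ρ : (FreeLieAlgebra ℂ X) →ₗ⁅ℂ⁆ Module.End ℂ ((FreeLieAlgebra ℂ X) × ℂ) := FreeLieAlgebra.lift ℂ g
  let Θ : FreeAlgebra ℂ X →ₐ[ℂ] Module.End ℂ ((FreeLieAlgebra ℂ X) × ℂ) := FreeAlgebra.lift ℂ g
  have hΘ : ∀ z, Θ (freeLieToAssoc X z) = ρ z := by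
    intro z
    have : (Θ.toLieHom).comp (freeLieToAssoc X) = ρ := by
      apply FreeLieAlgebra.hom_ext
      intro x
      simp [ρ, Θ, freeLieToAssoc_of]
    exact LieHom.congr_fun this z
  let E : Module.End ℂ (FreeLieAlgebra ℂ X) := LinearMap.fst ℂ (FreeLieAlgebra ℂ X) ℂ ∘ₗ LinearMap.applyₗ ((0 : (FreeLieAlgebra ℂ X)), (1 : ℂ)) ∘ₗ
    (ρ : (FreeLieAlgebra ℂ X) →ₗ[ℂ] Module.End ℂ ((FreeLieAlgebra ℂ X) × ℂ))
  have hE : ∀ z, E z = (ρ z (0, 1)).1 := fun z => rfl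
  have hρof : ∀ x, ρ (FreeLieAlgebra.of ℂ x) = g x := FreeLieAlgebra.lift_of_apply g
  have hρ : ∀ z, ∀ a : (FreeLieAlgebra ℂ X) × ℂ, ρ z a = (⁅z, a.1⁆ + a.2 • E z, 0) := by
    intro z
    induction z using freeLie_induction with
    | of x =>
      intro a
      rw [hE, hρof]
      simp [g]
    | zero => intro a; simp [Prod.ext_iff]
    | add a b ha hb =>
      intro c
      rw [map_add, LinearMap.add_apply, ha, hb, map_add]
      simp only [Prod.mk_add_mk, add_lie, smul_add, add_zero]
      congr 1
      abel
    | smul r a ha =>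
      intro c
      rw [map_smul, LinearMap.smul_apply, ha, map_smul]
      simp only [Prod.smul_mk, smul_add, smul_lie, smul_zero, smul_comm r]
    | lie a b ha hb =>
      intro c
      have : E ⁅a, b⁆ = ⁅a, E b⁆ - ⁅b, E a⁆ := by
        rw [hE, LieHom.map_lie, Ring.lie_def, LinearMap.sub_apply, Module.End.mul_apply,
          Module.End.mul_apply, hb, ha, ha, hb]
        simp
      rw [this, LieHom.map_lie, Ring.lie_def, LinearMap.sub_apply, Module.End.mul_apply,
          Module.End.mul_apply, hb, ha, ha, hb]
      simp only [Prod.mk_sub_mk, lie_add, zero_smul, add_zero, sub_self, smul_sub, lie_lie]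
      congr 1
      rw [show ⁅a, c.2 • E b⁆ = c.2 • ⁅a, E b⁆ from lie_smul _ _ _,
        show ⁅b, c.2 • E a⁆ = c.2 • ⁅b, E a⁆ from lie_smul _ _ _, add_sub_add_comm]
  have hlie : ∀ a b, E ⁅a, b⁆ = ⁅a, E b⁆ - ⁅b, E a⁆ := by
    intro a b
    rw [hE, LieHom.map_lie, Ring.lie_def, LinearMap.sub_apply, Module.End.mul_apply,
          Module.End.mul_apply, hρ b, hρ a, hρ a, hρ b]
    simp
  have hEof : ∀ x, E (FreeLieAlgebra.of ℂ x) = FreeLieAlgebra.of ℂ x := by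
    intro x
    rw [hE, hρof]
    simp [g]
  have hspan : ∀ n : ℕ, gradedSpan (FreeLieAlgebra.of ℂ (X := X)) (fun _ => (1 : ℕ)) n ≤
      E.eigenspace (n : ℂ) := by
    refine gradedSpan_le (P := fun n : ℕ => E.eigenspace (n : ℂ)) ?_ ?_
    · intro x
      simp [hEof]
    · intro m n a b ha hb
      rw [Module.End.mem_eigenspace_iff] at *
      rw [hlie, ha, hb, lie_smul, lie_smul, ← lie_skew a b, smul_neg, smul_neg, Nat.cast_add, add_smul]
      abel
  refine eq_zero_of_mem_iSup_eigenspace E ?_ ?_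
  · have : y ∈ (⊤ : Submodule ℂ (FreeLieAlgebra ℂ X)) := trivial
    rw [← iSup_gradedSpan_freeLie (fun _ : X => (1 : ℕ))] at this
    refine SetLike.le_def.1 (iSup_le fun n => ?_) this
    rcases Nat.eq_zero_or_pos n with rfl | hn
    · rw [gradedSpan_eq_bot_of_deg_le (k := 0) (AddMonoidHom.id ℕ) (by simp) (by simp)]
      exact bot_le
    · refine (hspan n).trans ?_
      exact le_iSup (fun c : {c : ℂ // c ≠ 0} => E.eigenspace c) ⟨(n : ℂ), by
        exact_mod_cast hn.ne'⟩
  · rw [hE, ← hΘ, hy, map_zero]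
    rfl

/-! ### Chevalley relations -/

/-- The relations of a Borcherds-Kac-Moody Lie algebra except for the Serre relations and the
orthogonality relations. -/
structure ChevalleyRel {I : Type*} (A : Matrix I I ℝ) {G : Type*} [LieRing G] [LieAlgebra ℂ G]
    (h e f : I → G) : Prop where
  he : ∀ i k, ⁅h i, e k⁆ = (A i k : ℂ) • e k
  hf : ∀ i k, ⁅h i, f k⁆ = -((A i k : ℂ) • f k)
  ef_self : ∀ i, ⁅e i, f i⁆ = h i
  ef_ne : ∀ i j, i ≠ j → ⁅e i, f j⁆ = 0

namespace ChevalleyRel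

variable {I : Type*} {A : Matrix I I ℝ} {G : Type*} [LieRing G] [LieAlgebra ℂ G] {h e f : I → G}

theorem swap (C : ChevalleyRel A h e f) : ChevalleyRel A (fun i => -h i) f e where
  he i k := by rw [neg_lie, C.hf, neg_neg]
  hf i k := by rw [neg_lie, C.he]
  ef_self i := by rw [← lie_skew, C.ef_self]
  ef_ne i j hij := by rw [← lie_skew, C.ef_ne j i hij.symm, neg_zero]

theorem map {G' : Type*} [LieRing G'] [LieAlgebra ℂ G'] (C : ChevalleyRel A h e f)
    (φ : G →ₗ⁅ℂ⁆ G') :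
    ChevalleyRel A (fun i => φ (h i)) (fun i => φ (e i)) (fun i => φ (f i)) where
  he i k := by rw [← LieHom.map_lie, C.he, map_smul]
  hf i k := by rw [← LieHom.map_lie, C.hf, map_neg, map_smul]
  ef_self i := by rw [← LieHom.map_lie, C.ef_self]
  ef_ne i j hij := by rw [← LieHom.map_lie, C.ef_ne i j hij, map_zero]

theorem lie_pow_ad {a b y : G} (hab : ⁅b, a⁆ = 0) (n : ℕ) :
    ⁅b, (LieAlgebra.ad ℂ G a ^ n) y⁆ = (LieAlgebra.ad ℂ G a ^ n) ⁅b, y⁆ := by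
  induction n with
  | zero => simp
  | succ n ih =>
    rw [pow_succ', Module.End.mul_apply, Module.End.mul_apply, LieAlgebra.ad_apply,
      LieAlgebra.ad_apply, leibniz_lie, hab, zero_lie, zero_add, ih]

theorem lie_h_pow_ad {a c y : G} {α β : ℂ} (ha : ⁅c, a⁆ = α • a) (hy : ⁅c, y⁆ = β • y) (n : ℕ) :
    ⁅c, (LieAlgebra.ad ℂ G a ^ n) y⁆ = (β + n * α) • (LieAlgebra.ad ℂ G a ^ n) y := by
  induction n with
  | zero => simp [hy]
  | succ n ih =>
    rw [pow_succ', Module.End.mul_apply, LieAlgebra.ad_apply, leibniz_lie, ha, smul_lie, ih,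
      lie_smul, ← add_smul]
    congr 1
    push_cast
    ring

/-- The `sl₂` computation for a vector `y` of weight `β` killed by `f_i`. The coefficient vanishes
for `β = -n`, which is why Serre elements are annihilated by `f_i`. -/
theorem lie_f_pow_ad (C : ChevalleyRel A h e f) {i : I} (hi : A i i = 2) {y : G} {β : ℂ}
    (hy : ⁅h i, y⁆ = β • y) (hfy : ⁅f i, y⁆ = 0) (n : ℕ) :
    ⁅f i, (LieAlgebra.ad ℂ G (e i) ^ (n + 1)) y⁆ =
      (-((n + 1) * (β + n)) : ℂ) • (LieAlgebra.ad ℂ G (e i) ^ n) y := by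
  have hfe : ⁅f i, e i⁆ = -h i := by rw [← lie_skew, C.ef_self]
  have hh := fun n : ℕ => lie_h_pow_ad (C.he i i) hy n
  induction n with
  | zero =>
    rw [zero_add, pow_one, LieAlgebra.ad_apply, leibniz_lie, hfe, hfy]
    simp [hy]
  | succ n ih =>
    rw [pow_succ', Module.End.mul_apply, LieAlgebra.ad_apply, leibniz_lie, hfe, neg_lie, hh, ih,
      lie_smul, ← LieAlgebra.ad_apply ℂ, ← Module.End.mul_apply, ← pow_succ', ← neg_smul,
      ← add_smul, hi]
    congr 1
    push_cast
    ring

/-- The Serre elements in the `e_i` commute with the `f_k`. -/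
theorem lie_f_serre (C : ChevalleyRel A h e f) (hA : IsGeneralizedCartanMatrix A) {i j : I}
    {n : ℕ} (hi : 0 < A i i) (hij : i ≠ j) (hn : A i j = -(n : ℝ)) (k : I) :
    ⁅f k, (LieAlgebra.ad ℂ G (e i) ^ (n + 1)) (e j)⁆ = 0 := by
  have hfe : ∀ k l, k ≠ l → ⁅f k, e l⁆ = 0 := C.swap.ef_ne
  by_cases hki : k = i
  · subst hki
    rw [C.lie_f_pow_ad (hA.diag_of_pos k hi) (C.he k j) (hfe k j hij), hn]
    simp
  · rw [lie_pow_ad (hfe k i hki)]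
    by_cases hkj : k = j
    · subst hkj
      have hek : ⁅e i, h k⁆ = -((A k i : ℂ) • e i) := by rw [← lie_skew, C.he]
      rw [show ⁅f k, e k⁆ = -h k from C.swap.ef_self k, map_neg, pow_succ, Module.End.mul_apply,
        LieAlgebra.ad_apply, hek]
      -- What remains is `a_{ki}` times `(ad e_i)^n e_i`. For `n > 0` it vanishes by `⁅e_i, e_i⁆ =
      -- 0`; for `n = 0` the hypothesis is `a_{ik} = 0`, which gives `a_{ki} = 0` by
      -- symmetrizability.
      cases n with
      | zero =>
        obtain ⟨q, hq, hqA⟩ := hA.symmetrizable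
        have h1 := hqA i k
        rw [hn] at h1
        have h2 : A k i = 0 := by
          simpa [(hq k).ne'] using h1.symm
        simp [h2]
      | succ n =>
        rw [pow_succ, Module.End.mul_apply, map_neg, map_smul, LieAlgebra.ad_apply, lie_self,
          smul_zero, neg_zero, map_zero, neg_zero]
    · rw [hfe k j hkj, map_zero]

theorem lie_f_orth (C : ChevalleyRel A h e f) (hA : IsGeneralizedCartanMatrix A) {i j : I}
    (hij : A i j = 0) (k : I) : ⁅f k, ⁅e i, e j⁆⁆ = 0 := by
  have hji : A j i = 0 := by
    obtain ⟨q, hq, hqA⟩ := hA.symmetrizable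
    simpa [hij, (hq j).ne'] using (hqA i j).symm
  have hfe : ∀ k l, k ≠ l → ⁅f k, e l⁆ = 0 := C.swap.ef_ne
  have hfs : ∀ k, ⁅f k, e k⁆ = -h k := C.swap.ef_self
  have hA1 : ⁅h i, e j⁆ = 0 := by rw [C.he, hij]; simp
  have hA2 : ⁅e i, h j⁆ = 0 := by rw [← lie_skew, C.he, hji]; simp
  rw [leibniz_lie]
  by_cases h1 : k = i <;> by_cases h2 : k = j
  · subst h1; subst h2; rw [hfs, neg_lie, hA1, lie_neg, hA2]; simp
  · subst h1; rw [hfs, hfe k j h2, neg_lie, hA1]; simp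
  · subst h2; rw [hfs, hfe k i h1, lie_neg, hA2]; simp
  · rw [hfe k i h1, hfe k j h2]; simp

end ChevalleyRel

/-- The homomorphism from the free Lie algebra on the symbols `h_i, e_i, f_i`. -/
noncomputable def genLift {I : Type*} {G : Type*} [LieRing G] [LieAlgebra ℂ G] (h e f : I → G) :
    FreeGen I →ₗ⁅ℂ⁆ G :=
  FreeLieAlgebra.lift ℂ fun
    | CartanMatrix.Generators.H i => h i
    | CartanMatrix.Generators.E i => e i
    | CartanMatrix.Generators.F i => f i

section GenLift

variable {I : Type*} {G : Type*} [LieRing G] [LieAlgebra ℂ G] (h e f : I → G)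

@[simp] theorem genLift_H (i : I) : genLift h e f (genH i) = h i :=
  FreeLieAlgebra.lift_of_apply _ _

@[simp] theorem genLift_E (i : I) : genLift h e f (genE i) = e i :=
  FreeLieAlgebra.lift_of_apply _ _

@[simp] theorem genLift_F (i : I) : genLift h e f (genF i) = f i :=
  FreeLieAlgebra.lift_of_apply _ _

end GenLift

theorem map_pow_ad {G G' : Type*} [LieRing G] [LieAlgebra ℂ G] [LieRing G'] [LieAlgebra ℂ G']
    (φ : G →ₗ⁅ℂ⁆ G') (a y : G) (n : ℕ) :
    φ ((LieAlgebra.ad ℂ G a ^ n) y) = (LieAlgebra.ad ℂ G' (φ a) ^ n) (φ y) := by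
  induction n with
  | zero => simp
  | succ n ih =>
    rw [pow_succ', pow_succ', Module.End.mul_apply, Module.End.mul_apply, LieAlgebra.ad_apply,
      LieAlgebra.ad_apply, LieHom.map_lie, ih]

end FrickeLie

namespace FrickeLie

open Module

attribute [local instance] LieRing.ofAssociativeRing
attribute [local instance] endLieRingModule

/-! ### The generators `e_i` are nonzero -/

section Verma

variable {I : Type*}

theorem end_lie_apply {V : Type*} [AddCommGroup V] [Module ℂ V] (a b : Module.End ℂ V) (m : V) :
    (⁅a, b⁆ : Module.End ℂ V) m = a (b m) - b (a m) := by
  rw [Ring.lie_def, LinearMap.sub_apply, Module.End.mul_apply, Module.End.mul_apply]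

theorem end_apply_leftMul (S : Module.End ℂ (FreeAlgebra ℂ I)) (x : I) (m : FreeAlgebra ℂ I) :
    S (leftMul x m) = leftMul x (S m) + ⁅S, leftMul x⁆ m := by
  rw [Ring.lie_def, LinearMap.sub_apply, Module.End.mul_apply, Module.End.mul_apply]
  abel

theorem end_lie_one {S T : Module.End ℂ (FreeAlgebra ℂ I)} {a b : ℂ} (hS : S 1 = a • 1)
    (hT : T 1 = b • 1) : ⁅S, T⁆ 1 = 0 := by
  rw [Ring.lie_def, LinearMap.sub_apply, Module.End.mul_apply, Module.End.mul_apply, hT, hS,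
    map_smul, map_smul, hS, hT, smul_comm, sub_self]

/-- A Verma module with lowest weight `h_i ↦ 1`. -/
theorem exists_verma (A : Matrix I I ℝ) :
    ∃ h f : I → Module.End ℂ (FreeAlgebra ℂ I), ChevalleyRel A h leftMul f ∧
      (∀ i, h i 1 = 1) ∧ ∀ i, f i 1 = 0 := by
  classical
  -- `e_k` is left multiplication, so the relations dictate the commutators of `h_i` and `f_i` with
  -- it. The value `h_i 1 = 1` makes `f_i e_i 1 = -1` nonzero, which is what the module is for.
  choose h h1 hx using fun i : I => exists_end_of_comm (X := I) 1 fun k => (A i k : ℂ) • leftMul k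
  choose f f1 fx using fun i : I => exists_end_of_comm (X := I) 0 fun k =>
    if i = k then -h i else 0
  have h1' : ∀ i, h i 1 = (1 : ℂ) • 1 := fun i => by rw [h1, one_smul]
  have f1' : ∀ i, f i 1 = (0 : ℂ) • 1 := fun i => by rw [f1, zero_smul]
  have hh : ∀ i k, ⁅h i, h k⁆ = 0 := by
    intro i k
    refine end_eq_of_comm ?_ fun x => ?_
    · rw [end_lie_one (h1' i) (h1' k), LinearMap.zero_apply]
    · rw [lie_lie, hx, hx, lie_smul, lie_smul, hx, hx, smul_comm, sub_self, zero_lie]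
  refine ⟨h, f, ⟨hx, ?_, ?_, ?_⟩, h1, f1⟩
  · intro i k
    refine end_eq_of_comm ?_ fun x => ?_
    · rw [end_lie_one (h1' i) (f1' k), LinearMap.neg_apply, LinearMap.smul_apply, f1, smul_zero,
        neg_zero]
    · rw [lie_lie, hx, fx, lie_smul, fx, neg_lie, smul_lie, fx]
      by_cases hk : k = x
      · subst hk
        simp [hh]
      · simp [hk]
  · intro i
    rw [← lie_skew, fx, if_pos rfl, neg_neg]
  · intro i j hij
    rw [← lie_skew, fx, if_neg hij.symm, neg_zero]

/-- The coefficient of the empty word. -/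
noncomputable def vac (I : Type*) : FreeAlgebra ℂ I →ₗ[ℂ] ℂ :=
  (FreeAlgebra.algebraMapInv : FreeAlgebra ℂ I →ₐ[ℂ] ℂ).toLinearMap

theorem vac_leftMul (i : I) (m : FreeAlgebra ℂ I) : vac I (leftMul i m) = 0 := by
  simp [vac, leftMul_apply, FreeAlgebra.algebraMapInv]

theorem vac_one : vac I 1 = 1 := by
  simp [vac]

/-- Products of the operators `f_i`. -/
def wordOp (f : I → Module.End ℂ (FreeAlgebra ℂ I)) : List I → Module.End ℂ (FreeAlgebra ℂ I)
  | [] => 1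
  | k :: l => wordOp f l * f k

/-- `K` consists of the vectors of the Verma module from which no word in the `f_k` recovers a
vacuum component; it is a submodule. Relators in the `f_k` act as zero. Relators in the `e_k`
commute with every `f_k` and have no vacuum component, so they map into `K`. Thus `𝔤(A)` acts on the
quotient by `K`, where `e_i 1` survives because `f_i e_i 1 = -h_i 1 = -1`. -/
theorem of_genE_ne_zero {A : Matrix I I ℝ} (hA : IsGeneralizedCartanMatrix A) (i : I) :
    UniversalBKM.of A (genE i) ≠ 0 := by
  obtain ⟨h, f, C, h1, f1⟩ := exists_verma A
  let K : Set (FreeAlgebra ℂ I) := {m | ∀ l, vac I (wordOp f l m) = 0}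
  have hvac : ∀ i m, vac I (h i m) = vac I m := by
    intro i m
    induction m using freeAlgebra_left_induction with
    | one => rw [h1]
    | add a b ha hb => simp [ha, hb]
    | smul c a ha => simp [ha]
    | mul x a ha =>
      rw [← leftMul_apply, end_apply_leftMul, C.he, map_add, LinearMap.smul_apply, map_smul,
        vac_leftMul, vac_leftMul, smul_zero, add_zero]
  have hf : ∀ k, ∀ m ∈ K, f k m ∈ K := fun k m hm l => hm (k :: l)
  have hKh : ∀ l i, ∀ m ∈ K, vac I (wordOp f l (h i m)) = 0 := by
    intro l
    induction l with
    | nil => exact fun i m hm => (hvac i m).trans (hm [])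
    | cons k l ih =>
      intro i m hm
      have h2 : f k (h i m) = h i (f k m) + (A i k : ℂ) • f k m := by
        have := end_lie_apply (h i) (f k) m
        rw [C.hf, LinearMap.neg_apply, LinearMap.smul_apply] at this
        rw [← sub_eq_iff_eq_add', ← neg_sub, ← this, neg_neg]
      rw [wordOp, Module.End.mul_apply, h2, map_add, map_add, ih i _ (hf k m hm), map_smul,
        map_smul, hf k m hm l, smul_zero, add_zero]
  have hKe : ∀ l i, ∀ m ∈ K, vac I (wordOp f l (leftMul i m)) = 0 := by
    intro l
    induction l with
    | nil => exact fun i m hm => vac_leftMul i m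
    | cons k l ih =>
      intro i m hm
      rw [wordOp, Module.End.mul_apply, end_apply_leftMul, map_add, map_add, ih i _ (hf k m hm),
        zero_add]
      by_cases hk : k = i
      · subst hk
        rw [C.swap.ef_self, LinearMap.neg_apply, map_neg, map_neg, hKh l k m hm, neg_zero]
      · rw [C.swap.ef_ne k i hk]
        simp
  let ρ := genLift h leftMul f
  have hρK : ∀ y, ∀ m ∈ K, ρ y m ∈ K := by
    intro y
    induction y using freeLie_induction with
    | of x =>
      intro m hm
      cases x with
      | H i =>
        rw [show ρ (FreeLieAlgebra.of ℂ (CartanMatrix.Generators.H i)) = h i from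
          genLift_H _ _ _ _]
        exact fun l => hKh l i m hm
      | E i =>
        rw [show ρ (FreeLieAlgebra.of ℂ (CartanMatrix.Generators.E i)) = leftMul i from
          genLift_E _ _ _ _]
        exact fun l => hKe l i m hm
      | F i =>
        rw [show ρ (FreeLieAlgebra.of ℂ (CartanMatrix.Generators.F i)) = f i from
          genLift_F _ _ _ _]
        exact hf i m hm
    | zero => exact fun m _ l => by simp
    | add a b ha hb =>
      intro m hm l
      rw [map_add, LinearMap.add_apply, map_add, map_add, ha m hm l, hb m hm l, add_zero]
    | smul c a ha =>
      intro m hm l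
      rw [map_smul, LinearMap.smul_apply, map_smul, map_smul, ha m hm l, smul_zero]
    | lie a b ha hb =>
      intro m hm l
      rw [LieHom.map_lie, end_lie_apply, map_sub, map_sub, ha _ (hb m hm) l, hb _ (ha m hm) l, sub_zero]
  let J : LieIdeal ℂ (FreeGen I) :=
    { carrier := {y | ∀ m, ρ y m ∈ K}
      add_mem' := fun {a b} ha hb m l => by
        rw [map_add, LinearMap.add_apply, map_add, map_add, ha m l, hb m l, add_zero]
      zero_mem' := fun m l => by simp
      smul_mem' := fun c a ha m l => by
        rw [map_smul, LinearMap.smul_apply, map_smul, map_smul, ha m l, smul_zero]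
      lie_mem := fun {a b} hb m l => by
        rw [LieHom.map_lie, end_lie_apply, map_sub, map_sub, hρK a _ (hb m) l, hb _ l, sub_zero] }
  have hcomm : ∀ θ : Module.End ℂ (FreeAlgebra ℂ I), (∀ k, ⁅f k, θ⁆ = 0) →
      (∀ m, vac I (θ m) = 0) → ∀ m, θ m ∈ K := by
    intro θ h1 h2 m l
    induction l generalizing m with
    | nil => exact h2 m
    | cons k l ih =>
      have := end_lie_apply (f k) θ m
      rw [h1, LinearMap.zero_apply] at this
      rw [wordOp, Module.End.mul_apply, sub_eq_zero.1 this.symm]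
      exact ih _
  have hzero : ∀ θ : Module.End ℂ (FreeAlgebra ℂ I), (∀ k : I, ⁅leftMul k, θ⁆ = 0) →
      θ 1 = 0 → θ = 0 := by
    intro θ h1 h2
    refine end_eq_of_comm h2 fun x => ?_
    rw [← lie_skew, h1, neg_zero, zero_lie]
  have hfone : ∀ i j n, (LieAlgebra.ad ℂ (Module.End ℂ (FreeAlgebra ℂ I)) (f i) ^ n) (f j) 1
      = 0 := by
    intro i j n
    induction n with
    | zero => simp [f1]
    | succ n ih =>
      rw [pow_succ', Module.End.mul_apply, LieAlgebra.ad_apply, end_lie_apply, ih, f1, map_zero, map_zero,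
        sub_zero]
  have hevac : ∀ i j n m, vac I ((LieAlgebra.ad ℂ (Module.End ℂ (FreeAlgebra ℂ I)) (leftMul i) ^ n)
      (leftMul j) m) = 0 := by
    intro i j n
    induction n with
    | zero => intro m; simp [vac_leftMul]
    | succ n ih =>
      intro m
      rw [pow_succ', Module.End.mul_apply, LieAlgebra.ad_apply, end_lie_apply, map_sub, ih, vac_leftMul,
        sub_zero]
  have hJ : relIdeal A ≤ J := by
    have h0 : ∀ y, ρ y = 0 → y ∈ J := fun y hy m l => by rw [hy]; simp
    refine LieSubmodule.lieSpan_le.2 fun y hy => ?_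
    change y ∈ J
    cases hy with
    | he i k =>
      apply h0
      rw [map_sub, LieHom.map_lie, map_smul, genLift_H, genLift_E, C.he, sub_self]
    | hf i k =>
      apply h0
      rw [map_add, LieHom.map_lie, map_smul, genLift_H, genLift_F, C.hf, neg_add_cancel]
    | ef_self i =>
      apply h0
      rw [map_sub, LieHom.map_lie, genLift_H, genLift_E, genLift_F, C.ef_self, sub_self]
    | ef_ne i j hij =>
      apply h0
      rw [LieHom.map_lie, genLift_E, genLift_F, C.ef_ne i j hij]
    | serre_e i j n hi hij hn =>
      refine hcomm _ (fun k => ?_) fun m => ?_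
      · rw [map_pow_ad, genLift_E, genLift_E]
        exact C.lie_f_serre hA hi hij hn k
      · rw [map_pow_ad, genLift_E, genLift_E]
        exact hevac i j _ m
    | serre_f i j n hi hij hn =>
      apply h0
      rw [map_pow_ad, genLift_F, genLift_F]
      exact hzero _ (C.swap.lie_f_serre hA hi hij hn) (hfone _ _ _)
    | orth_e i j hij =>
      refine hcomm _ (fun k => ?_) fun m => ?_
      · rw [LieHom.map_lie, genLift_E, genLift_E]
        exact C.lie_f_orth hA hij k
      · rw [LieHom.map_lie, genLift_E, genLift_E]
        exact hevac i j 1 m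
    | orth_f i j hij =>
      apply h0
      rw [LieHom.map_lie, genLift_F, genLift_F]
      exact hzero _ (C.swap.lie_f_orth hA hij) (hfone i j 1)
  intro h0
  have h2 : genE i ∈ J := hJ ((LieSubmodule.Quotient.mk_eq_zero (N := relIdeal A)).1 h0)
  have h3 := h2 1 [i]
  rw [show ρ (genE i) = leftMul i from genLift_E _ _ _ _] at h3
  simp only [wordOp, one_mul] at h3
  rw [end_apply_leftMul, f1, map_zero, zero_add, C.swap.ef_self, LinearMap.neg_apply, h1, map_neg,
    vac_one] at h3
  norm_num at h3

end Verma

end FrickeLie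

namespace FrickeLie

open Module

attribute [local instance] LieRing.ofAssociativeRing
attribute [local instance] endLieRingModule

/-! ### A faithful module for the free part of the positive subalgebra -/

section Letters

variable {I : Type*} {r : I} {t : I → ℕ}

/-- The pairs `(i, k)` with `i ≠ r` and `k < t i`; such a pair stands for `(ad e_r)^k e_i`. -/
abbrev Letter (r : I) (t : I → ℕ) : Type _ := {x : I × ℕ // x.1 ≠ r ∧ x.2 < t x.1}

open Classical in
/-- Left multiplication by a letter, or zero if the indices are out of range. -/
noncomputable def letterMul (r : I) (t : I → ℕ) (i : I) (k : ℕ) :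
    Module.End ℂ (FreeAlgebra ℂ (Letter r t)) :=
  if h : i ≠ r ∧ k < t i then leftMul ⟨(i, k), h⟩ else 0

theorem letterMul_letter (x : Letter r t) : letterMul r t x.1.1 x.1.2 = leftMul x :=
  dif_pos x.2

theorem letterMul_eq_zero {i : I} {k : ℕ} (h : i ≠ r → t i ≤ k) : letterMul r t i k = 0 :=
  dif_neg fun h' => absurd (h h'.1) (by omega)

theorem end_eq_of_letter {S S' : Module.End ℂ (FreeAlgebra ℂ (Letter r t))} (h1 : S 1 = 0)
    (h1' : S' 1 = 0) (h : ∀ i k, i ≠ r → ⁅S, letterMul r t i k⁆ = ⁅S', letterMul r t i k⁆) :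
    S = S' :=
  end_eq_of_comm (h1.trans h1'.symm) fun x => by
    rw [← letterMul_letter]
    exact h _ _ x.2.1

/-- Operators with prescribed commutators with the letters. -/
theorem exists_end_of_letter (G : I → ℕ → Module.End ℂ (FreeAlgebra ℂ (Letter r t)))
    (hG : ∀ i k, i ≠ r → t i ≤ k → G i k = 0) :
    ∃ S : Module.End ℂ (FreeAlgebra ℂ (Letter r t)), S 1 = 0 ∧
      ∀ i k, i ≠ r → ⁅S, letterMul r t i k⁆ = G i k := by
  obtain ⟨S, h1, hS⟩ := exists_end_of_comm (X := Letter r t) 0 fun x => G x.1.1 x.1.2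
  refine ⟨S, h1, fun i k hi => ?_⟩
  by_cases hk : k < t i
  · rw [← hS ⟨(i, k), hi, hk⟩, ← letterMul_letter]
  · rw [letterMul_eq_zero fun _ => not_lt.1 hk, hG i k hi (not_lt.1 hk), lie_zero]

end Letters

theorem relIdeal_le_ker {I : Type*} {A : Matrix I I ℝ} {G : Type*} [LieRing G] [LieAlgebra ℂ G]
    {h e f : I → G} (C : ChevalleyRel A h e f)
    (serre_e : ∀ i j (n : ℕ), 0 < A i i → i ≠ j → A i j = -(n : ℝ) →
      (LieAlgebra.ad ℂ G (e i) ^ (n + 1)) (e j) = 0)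
    (serre_f : ∀ i j (n : ℕ), 0 < A i i → i ≠ j → A i j = -(n : ℝ) →
      (LieAlgebra.ad ℂ G (f i) ^ (n + 1)) (f j) = 0)
    (orth_e : ∀ i j, A i j = 0 → ⁅e i, e j⁆ = 0) (orth_f : ∀ i j, A i j = 0 → ⁅f i, f j⁆ = 0)
    {y : FreeGen I} (hy : y ∈ relIdeal A) : genLift h e f y = 0 := by
  suffices hle : relIdeal A ≤ (genLift h e f).ker from LieHom.mem_ker.1 (hle hy)
  refine LieSubmodule.lieSpan_le.2 fun y hy => ?_
  rw [SetLike.mem_coe, LieHom.mem_ker]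
  cases hy with
  | he i k => rw [map_sub, LieHom.map_lie, map_smul, genLift_H, genLift_E, C.he, sub_self]
  | hf i k => rw [map_add, LieHom.map_lie, map_smul, genLift_H, genLift_F, C.hf, neg_add_cancel]
  | ef_self i =>
    rw [map_sub, LieHom.map_lie, genLift_H, genLift_E, genLift_F, C.ef_self, sub_self]
  | ef_ne i j hij => rw [LieHom.map_lie, genLift_E, genLift_F, C.ef_ne i j hij]
  | serre_e i j n hi hij hn =>
    rw [map_pow_ad, genLift_E, genLift_E, serre_e i j n hi hij hn]
  | serre_f i j n hi hij hn =>
    rw [map_pow_ad, genLift_F, genLift_F, serre_f i j n hi hij hn]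
  | orth_e i j hij => rw [LieHom.map_lie, genLift_E, genLift_E, orth_e i j hij]
  | orth_f i j hij => rw [LieHom.map_lie, genLift_F, genLift_F, orth_f i j hij]

/-- The map from the free Lie algebra on the letters that sends `(i, k)` to `(ad e_r)^k e_i`. -/
noncomputable def letterLift {I : Type*} {G : Type*} [LieRing G] [LieAlgebra ℂ G] (e : I → G)
    (r : I) (t : I → ℕ) : FreeLieAlgebra ℂ (Letter r t) →ₗ⁅ℂ⁆ G :=
  FreeLieAlgebra.lift ℂ fun x => (LieAlgebra.ad ℂ G (e r) ^ x.1.2) (e x.1.1)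

theorem letterLift_of {I : Type*} {G : Type*} [LieRing G] [LieAlgebra ℂ G] (e : I → G)
    (r : I) (t : I → ℕ) (x : Letter r t) : letterLift e r t (FreeLieAlgebra.of ℂ x) =
      (LieAlgebra.ad ℂ G (e r) ^ x.1.2) (e x.1.1) :=
  FreeLieAlgebra.lift_of_apply _ _

theorem letterLift_map {I : Type*} {G G' : Type*} [LieRing G] [LieAlgebra ℂ G] [LieRing G']
    [LieAlgebra ℂ G'] (φ : G →ₗ⁅ℂ⁆ G') (e : I → G) (r : I) (t : I → ℕ)
    (y : FreeLieAlgebra ℂ (Letter r t)) :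
    φ (letterLift e r t y) = letterLift (fun i => φ (e i)) r t y := by
  have : φ.comp (letterLift e r t) = letterLift (fun i => φ (e i)) r t := by
    apply FreeLieAlgebra.hom_ext
    intro x
    rw [LieHom.comp_apply, letterLift_of, letterLift_of, map_pow_ad]
  exact LieHom.congr_fun this y

/-- The map from a free Lie algebra is injective if the generators act by left multiplication on
the free associative algebra. -/
theorem eq_zero_of_leftMul {I : Type*} {r : I} {t : I → ℕ}
    {e : I → Module.End ℂ (FreeAlgebra ℂ (Letter r t))}
    (he : ∀ x : Letter r t, (LieAlgebra.ad ℂ (Module.End ℂ (FreeAlgebra ℂ (Letter r t)))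
      (e r) ^ x.1.2) (e x.1.1) = leftMul x) {y : FreeLieAlgebra ℂ (Letter r t)}
    (hy : letterLift e r t y 1 = 0) : y = 0 := by
  have h : letterLift e r t = ((Algebra.lmul ℂ (FreeAlgebra ℂ (Letter r t))).toLieHom).comp
      (freeLieToAssoc (Letter r t)) := by
    apply FreeLieAlgebra.hom_ext
    intro x
    rw [letterLift_of, he, LieHom.comp_apply, freeLieToAssoc_of]
    rfl
  apply freeLieToAssoc_injective
  rw [map_zero, ← hy, h, LieHom.comp_apply]
  exact (mul_one _).symm

/-- In the Borcherds-Kac-Moody algebra with one real simple root `r`, the elements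
`(ad e_r)^k e_i` with `k < 1 - a_{ri}` generate a free Lie algebra freely. -/
theorem letterLift_injective {I : Type*} {A : Matrix I I ℝ} (hA : IsGeneralizedCartanMatrix A)
    {r : I} {t : I → ℕ} (hr : 0 < A r r) (hpos : ∀ i, 0 < A i i → i = r)
    (ht : ∀ i, i ≠ r → A r i = 1 - (t i : ℝ)) (ht1 : ∀ i, i ≠ r → 1 ≤ t i)
    (hne : ∀ i j, i ≠ r → j ≠ r → A i j ≠ 0) {y : FreeLieAlgebra ℂ (Letter r t)}
    (hy : letterLift genE r t y ∈ relIdeal A) : y = 0 := by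
  classical
  have hr2 : A r r = 2 := hA.diag_of_pos r hr
  have hsymm : ∀ i j, A i j = 0 → A j i = 0 := by
    obtain ⟨q, hq, hqA⟩ := hA.symmetrizable
    intro i j hij
    simpa [hij, (hq j).ne'] using (hqA i j).symm
  have htC : ∀ i, i ≠ r → (A r i : ℂ) = 1 - (t i : ℂ) := fun i hi => by
    rw [ht i hi]; push_cast; rfl
  -- `D`, `F` and `H r` are derivations through which `e_r`, `f_r`, `h_r` act; on the letters of
  -- index `i` they give the `sl₂`-string of length `t i` with lowest weight `a_{ri} = 1 - t i`. The
  -- coefficient `k (t i - k)` is the one from `lie_f_pow_ad`; it vanishes at `k = t i`, so cutting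
  -- the string off there is consistent.
  obtain ⟨D, D1, hD⟩ := exists_end_of_letter (r := r) (t := t)
    (fun i k => letterMul r t i (k + 1)) fun i k _ hk => letterMul_eq_zero fun _ => by omega
  obtain ⟨F, F1, hF⟩ := exists_end_of_letter (r := r) (t := t)
    (fun i k => ((k : ℂ) * (t i - k)) • letterMul r t i (k - 1)) fun i k _ hk => by
      rcases hk.eq_or_lt with h | h
      · simp [h]
      · rw [letterMul_eq_zero fun _ => by omega, smul_zero]
  choose H H1 hH using fun j => exists_end_of_letter (r := r) (t := t)
    (fun i k => (A j i + k * A j r : ℂ) • letterMul r t i k) fun i k _ hk => by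
      rw [letterMul_eq_zero fun _ => hk, smul_zero]
  -- In `𝔤(A)` one has `⁅f_j, e_j⁆ = -h_j` and `⁅f_j, ⁅e_r, e_j⁆⁆ = a_{jr} e_r`, with zero further
  -- up the string. If `t j = 1`, the letter at `k = 1` is absent, and then `a_{rj} = 0` forces
  -- `a_{jr} = 0`.
  choose f f1 hf using fun j : I => exists_end_of_letter (r := r) (t := t)
    (fun i k => if j = i then (if k = 0 then -H j else if k = 1 then (A j r : ℂ) • D else 0)
      else 0) fun i k hi hk => by
        have := ht1 i hi
        split_ifs with h1 h2 h3
        · omega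
        · have h4 : t i = 1 := by omega
          have : A r i = 0 := by rw [ht i hi, h4]; simp
          subst h1
          rw [hsymm _ _ this]
          simp
        · rfl
        · rfl
  have s0 : ∀ {S : Module.End ℂ (FreeAlgebra ℂ (Letter r t))}, S 1 = 0 → S 1 = (0 : ℂ) • 1 :=
    fun h => by rw [h, zero_smul]
  have hHH : ∀ i j, ⁅H i, H j⁆ = 0 := by
    intro i j
    refine end_eq_of_letter (end_lie_one (s0 (H1 i)) (s0 (H1 j))) rfl fun l k hl => ?_
    rw [lie_lie, hH _ _ _ hl, hH _ _ _ hl, lie_smul, lie_smul, hH _ _ _ hl, hH _ _ _ hl, smul_comm,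
      sub_self, zero_lie]
  have hHD : ∀ i, ⁅H i, D⁆ = (A i r : ℂ) • D := by
    intro i
    refine end_eq_of_letter (end_lie_one (s0 (H1 i)) (s0 D1)) (by simp [D1]) fun l k hl => ?_
    rw [lie_lie, hD _ _ hl, hH _ _ _ hl, hH _ _ _ hl, lie_smul, smul_lie, hD _ _ hl, ← sub_smul]
    congr 1
    push_cast
    ring
  have hHF : ∀ i, ⁅H i, F⁆ = -((A i r : ℂ) • F) := by
    intro i
    refine end_eq_of_letter (end_lie_one (s0 (H1 i)) (s0 F1)) (by simp [F1]) fun l k hl => ?_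
    rw [lie_lie, hF _ _ hl, hH _ _ _ hl, lie_smul, hH _ _ _ hl, lie_smul, neg_lie, smul_lie,
      hF _ _ hl, smul_smul, smul_smul, smul_smul, ← sub_smul, ← neg_smul]
    rcases k with _ | k
    · simp
    · congr 1
      simp only [Nat.add_sub_cancel, Nat.cast_add, Nat.cast_one]
      ring
  have hDF : ⁅D, F⁆ = H r := by
    refine end_eq_of_letter (end_lie_one (s0 D1) (s0 F1)) (H1 r) fun l k hl => ?_
    rw [lie_lie, hF _ _ hl, hD _ _ hl, hF _ _ hl, lie_smul, hD _ _ hl, hH _ _ _ hl, hr2, htC l hl,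
      Nat.add_sub_cancel]
    rcases k with _ | k
    · simp only [Nat.cast_zero, zero_add, zero_mul, zero_smul, zero_sub, ← neg_smul]
      congr 1
      push_cast
      ring
    · rw [Nat.add_sub_cancel, ← sub_smul]
      congr 1
      push_cast
      ring
  have hHf : ∀ i j, j ≠ r → ⁅H i, f j⁆ = -((A i j : ℂ) • f j) := by
    intro i j hj
    refine end_eq_of_letter (end_lie_one (s0 (H1 i)) (s0 (f1 j))) (by simp [f1]) fun l k hl => ?_
    rw [lie_lie, hf _ _ _ hl, hH _ _ _ hl, lie_smul, hf _ _ _ hl, neg_lie, smul_lie, hf _ _ _ hl]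
    split_ifs with h1 h2 h3
    · subst h1 h2
      simp [hHH]
    · subst h1 h3
      rw [lie_smul, hHD, smul_smul, smul_smul, smul_smul, ← sub_smul, ← neg_smul]
      congr 1
      push_cast
      ring
    · simp
    · simp
  have hDf : ∀ j, j ≠ r → ⁅D, f j⁆ = 0 := by
    intro j hj
    refine end_eq_of_letter (end_lie_one (s0 D1) (s0 (f1 j))) rfl fun l k hl => ?_
    rw [lie_lie, hf _ _ _ hl, hD _ _ hl, hf _ _ _ hl, zero_lie]
    by_cases h1 : j = l
    · rcases k with _ | _ | k
      · simp only [h1, if_true, zero_add, one_ne_zero, if_false]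
        rw [lie_neg, ← lie_skew, hHD, neg_neg, sub_self]
      · simp [h1]
      · simp [h1]
    · simp [h1]
  have hef : ∀ i j, i ≠ r → ⁅letterMul r t i 0, f j⁆ = if i = j then H i else 0 := by
    intro i j hi
    rw [← lie_skew, hf _ _ _ hi, if_pos rfl]
    by_cases hij : j = i
    · subst hij
      rw [if_pos rfl, if_pos rfl, neg_neg]
    · rw [if_neg hij, if_neg (Ne.symm hij), neg_zero]
  have hD0 : ∀ i k, i ≠ r → (LieAlgebra.ad ℂ (Module.End ℂ (FreeAlgebra ℂ (Letter r t))) D ^ k)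
      (letterMul r t i 0) = letterMul r t i k := by
    intro i k hi
    induction k with
    | zero => simp
    | succ k ih =>
      rw [pow_succ', Module.End.mul_apply, ih, LieAlgebra.ad_apply, hD _ _ hi]
  let e' : I → Module.End ℂ (FreeAlgebra ℂ (Letter r t)) :=
    fun i => if i = r then D else letterMul r t i 0
  let f' : I → Module.End ℂ (FreeAlgebra ℂ (Letter r t)) := fun i => if i = r then F else f i
  have er : e' r = D := if_pos rfl
  have fr : f' r = F := if_pos rfl
  have ei : ∀ i, i ≠ r → e' i = letterMul r t i 0 := fun i hi => if_neg hi
  have fi : ∀ i, i ≠ r → f' i = f i := fun i hi => if_neg hi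
  have C : ChevalleyRel A H e' f' := by
    refine ⟨fun i k => ?_, fun i k => ?_, fun i => ?_, fun i j hij => ?_⟩
    · by_cases hk : k = r
      · rw [hk, er, hHD]
      · rw [ei k hk, hH _ _ _ hk]
        simp
    · by_cases hk : k = r
      · rw [hk, fr, hHF]
      · rw [fi k hk, hHf _ _ hk]
    · by_cases hi : i = r
      · rw [hi, fr, er, hDF]
      · rw [ei i hi, fi i hi, hef _ _ hi, if_pos rfl]
    · by_cases hi : i = r
      · subst hi
        rw [er, fi j hij.symm, hDf j hij.symm]
      · rw [ei i hi]
        by_cases hj : j = r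
        · rw [hj, fr, ← lie_skew, hF _ _ hi]
          simp
        · rw [fi j hj, hef _ _ hi, if_neg hij]
  have f1' : ∀ i, f' i 1 = 0 := by
    intro i
    by_cases hi : i = r
    · rw [hi, fr, F1]
    · rw [fi i hi, f1]
  have hfone : ∀ i j n, (LieAlgebra.ad ℂ (Module.End ℂ (FreeAlgebra ℂ (Letter r t))) (f' i) ^ n)
      (f' j) 1 = 0 := by
    intro i j n
    induction n with
    | zero => simp [f1']
    | succ n ih =>
      rw [pow_succ', Module.End.mul_apply, LieAlgebra.ad_apply, end_lie_apply, ih, f1', map_zero,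
        map_zero, sub_zero]
  -- Every letter is obtained from a letter with `k = 0` by iterating `ad D`, so commuting with all
  -- `e'` implies commuting with all letters. This disposes of the relators in the `f'`.
  have hzero : ∀ θ : Module.End ℂ (FreeAlgebra ℂ (Letter r t)), (∀ k : I, ⁅e' k, θ⁆ = 0) →
      θ 1 = 0 → θ = 0 := by
    intro θ h1 h2
    refine end_eq_of_letter h2 rfl fun i k hi => ?_
    have hDθ : ⁅θ, D⁆ = 0 := by rw [← lie_skew, ← er, h1, neg_zero]
    rw [← hD0 i k hi, ChevalleyRel.lie_pow_ad hDθ, ← ei i hi, ← lie_skew, h1, neg_zero, map_zero,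
      zero_lie]
  have hAr : ∀ i j (n : ℕ), 0 < A i i → i ≠ j → A i j = -(n : ℝ) → i = r ∧ t j = n + 1 := by
    intro i j n hi hij hn
    have h1 := hpos i hi
    subst h1
    have h2 := ht j hij.symm
    rw [hn] at h2
    refine ⟨rfl, ?_⟩
    have : (t j : ℝ) = ((n + 1 : ℕ) : ℝ) := by push_cast; linarith
    exact_mod_cast this
  -- For the `e'`, the Serre relation says that the string of `j` stops at `t j`. By `hne`,
  -- orthogonality of distinct indices only occurs between `r` and a string of length one.
  have h0 := relIdeal_le_ker C (fun i j n hi hij hn => by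
      obtain ⟨rfl, h2⟩ := hAr i j n hi hij hn
      rw [er, ei j hij.symm, hD0 _ _ hij.symm, letterMul_eq_zero fun _ => h2.le])
    (fun i j n hi hij hn => hzero _ (C.swap.lie_f_serre hA hi hij hn) (hfone _ _ _))
    (fun i j hij => by
      by_cases hi : i = r
      · by_cases hj : j = r
        · rw [hi, hj, lie_self]
        · obtain ⟨-, h2⟩ := hAr r j 0 hr (Ne.symm hj) (by rw [← hi, hij]; simp)
          rw [hi, er, ei j hj, hD _ _ hj, letterMul_eq_zero fun _ => h2.le]
      · by_cases hj : j = r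
        · obtain ⟨-, h2⟩ := hAr r i 0 hr (Ne.symm hi) (by rw [← hj, hsymm _ _ hij]; simp)
          rw [hj, er, ei i hi, ← lie_skew, hD _ _ hi, letterMul_eq_zero fun _ => h2.le, neg_zero]
        · exact absurd hij (hne i j hi hj))
    (fun i j hij => hzero _ (C.swap.lie_f_orth hA hij) (hfone i j 1)) hy
  rw [letterLift_map] at h0
  simp only [genLift_E] at h0
  refine eq_zero_of_leftMul (e := e') (fun x => ?_) (by rw [h0]; rfl)
  rw [er, ei _ x.2.1, hD0 _ _ x.2.1, letterMul_letter]

end FrickeLie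

namespace FrickeLie

open Module

attribute [local instance] LieRing.ofAssociativeRing
attribute [local instance] endLieRingModule

/-! ### Elimination in free Lie algebras -/

section Elimination

variable {G : Type*} [LieRing G] [LieAlgebra ℂ G] {X Γ : Type*} [AddCommMonoid Γ]
  {g : X → G} {wt : X → Γ} {e : G} {w₀ : Γ}

/-- `ad e` is a derivation, so normalizing the subalgebra can be tested on its generators. -/
theorem lie_mem_gradedSpan_of_generators (h : ∀ x, ⁅e, g x⁆ ∈ gradedSpan g wt (w₀ + wt x)) {γ : Γ}
    {a : G} (ha : a ∈ gradedSpan g wt γ) : ⁅e, a⁆ ∈ gradedSpan g wt (w₀ + γ) := by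
  refine (gradedSpan_le (g := g) (wt := wt) (P := fun γ => gradedSpan g wt γ ⊓
    (gradedSpan g wt (w₀ + γ)).comap (LieAlgebra.ad ℂ G e : Module.End ℂ G))
    (fun x => ⟨mem_gradedSpan x, h x⟩) ?_ γ ha).2
  rintro γ δ a b ⟨ha, ha'⟩ ⟨hb, hb'⟩
  refine ⟨lie_mem_gradedSpan ha hb, ?_⟩
  change ⁅e, ⁅a, b⁆⁆ ∈ gradedSpan g wt (w₀ + (γ + δ))
  rw [leibniz_lie]
  refine Submodule.add_mem _ ?_ ?_
  · rw [← add_assoc]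
    exact lie_mem_gradedSpan ha' hb
  · rw [add_left_comm]
    exact lie_mem_gradedSpan ha hb'

/-- The homogeneous pieces of the subspace spanned by a graded subalgebra and one more element. -/
def adjoinPiece (g : X → G) (wt : X → Γ) (e : G) (w₀ : Γ) (γ : Γ) : Submodule ℂ G :=
  gradedSpan g wt γ ⊔ ⨆ _ : γ = w₀, Submodule.span ℂ {e}

theorem mem_adjoinPiece_self : e ∈ adjoinPiece g wt e w₀ w₀ :=
  Submodule.mem_sup_right (Submodule.mem_iSup_of_mem rfl (Submodule.mem_span_singleton_self e))

theorem gradedSpan_le_adjoinPiece (γ : Γ) : gradedSpan g wt γ ≤ adjoinPiece g wt e w₀ γ :=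
  le_sup_left

theorem lie_mem_adjoinPiece (h : ∀ x, ⁅e, g x⁆ ∈ gradedSpan g wt (w₀ + wt x)) {γ δ : Γ} {a b : G}
    (hab : a ∈ adjoinPiece g wt e w₀ γ) (hab' : b ∈ adjoinPiece g wt e w₀ δ) :
    ⁅a, b⁆ ∈ adjoinPiece g wt e w₀ (γ + δ) := by
  obtain ⟨a, ha, a', ha', rfl⟩ := Submodule.mem_sup.1 hab
  obtain ⟨b, hb, b', hb', rfl⟩ := Submodule.mem_sup.1 hab'
  have key : ∀ {γ} {a' : G}, (a' ∈ ⨆ _ : γ = w₀, Submodule.span ℂ {e}) →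
      a' = 0 ∨ (γ = w₀ ∧ ∃ c : ℂ, a' = c • e) := by
    intro γ a' ha'
    by_cases hγ : γ = w₀
    · rw [iSup_pos hγ] at ha'
      obtain ⟨c, rfl⟩ := Submodule.mem_span_singleton.1 ha'
      exact Or.inr ⟨hγ, c, rfl⟩
    · rw [iSup_neg hγ] at ha'
      exact Or.inl ((Submodule.mem_bot ℂ).1 ha')
  refine Submodule.mem_sup_left ?_
  rw [add_lie, lie_add, lie_add]
  refine Submodule.add_mem _ (Submodule.add_mem _ (lie_mem_gradedSpan ha hb) ?_)
    (Submodule.add_mem _ ?_ ?_)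
  · rcases key hb' with rfl | ⟨rfl, c, rfl⟩
    · simp
    · rw [lie_smul, ← lie_skew, add_comm γ]
      exact Submodule.smul_mem _ _ (Submodule.neg_mem _ (lie_mem_gradedSpan_of_generators h ha))
  · rcases key ha' with rfl | ⟨rfl, c, rfl⟩
    · simp
    · rw [smul_lie]
      exact Submodule.smul_mem _ _ (lie_mem_gradedSpan_of_generators h hb)
  · rcases key ha' with rfl | ⟨rfl, c, rfl⟩
    · simp
    · rcases key hb' with rfl | ⟨rfl, c', rfl⟩
      · simp
      · simp

end Elimination

/-! ### Lazard elimination of one generator of a free Lie algebra -/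

section Lazard

variable {X : Type*} (x₀ : X)

/-- The generators `(ad x₀)^k x`, `x ≠ x₀`, that remain after elimination of `x₀`. -/
abbrev Elim (x₀ : X) : Type _ := {z : X × ℕ // z.1 ≠ x₀}

/-- The map from the free Lie algebra on the remaining generators. -/
noncomputable def elimMap : FreeLieAlgebra ℂ (Elim x₀) →ₗ⁅ℂ⁆ FreeLieAlgebra ℂ X :=
  FreeLieAlgebra.lift ℂ fun z =>
    (LieAlgebra.ad ℂ (FreeLieAlgebra ℂ X) (FreeLieAlgebra.of ℂ x₀) ^ z.1.2)
      (FreeLieAlgebra.of ℂ z.1.1)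

theorem elimMap_of (z : Elim x₀) : elimMap x₀ (FreeLieAlgebra.of ℂ z) =
    (LieAlgebra.ad ℂ (FreeLieAlgebra ℂ X) (FreeLieAlgebra.of ℂ x₀) ^ z.1.2)
      (FreeLieAlgebra.of ℂ z.1.1) :=
  FreeLieAlgebra.lift_of_apply _ _

/-- Let `x₀` act by the derivation `(x, k) ↦ (x, k + 1)` and any other `x` by left multiplication by
`(x, 0)`. Then `(ad x₀)^k x` acts as left multiplication by `(x, k)`. Evaluation at `1` gives both
injectivity of `elimMap` and, since `x₀` kills `1`, that `x₀` lies outside its image. -/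
theorem exists_elim_rep : ∃ ρ : FreeLieAlgebra ℂ X →ₗ⁅ℂ⁆
    Module.End ℂ (FreeAlgebra ℂ (Elim x₀)), ρ (FreeLieAlgebra.of ℂ x₀) 1 = 0 ∧
      ∀ y, ρ (elimMap x₀ y) 1 = freeLieToAssoc (Elim x₀) y := by
  classical
  obtain ⟨D, D1, hD⟩ := exists_end_of_comm (X := Elim x₀) 0 fun z =>
    leftMul ⟨(z.1.1, z.1.2 + 1), z.2⟩
  let g : X → Module.End ℂ (FreeAlgebra ℂ (Elim x₀)) := fun x =>
    if h : x ≠ x₀ then leftMul ⟨(x, 0), h⟩ else D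
  let ρ := FreeLieAlgebra.lift ℂ g
  have hρ : ∀ x, ρ (FreeLieAlgebra.of ℂ x) = g x := FreeLieAlgebra.lift_of_apply g
  have g0 : g x₀ = D := dif_neg (by simp)
  refine ⟨ρ, by rw [hρ, g0, D1], fun y => ?_⟩
  have h : ρ.comp (elimMap x₀) = ((Algebra.lmul ℂ (FreeAlgebra ℂ (Elim x₀))).toLieHom).comp
      (freeLieToAssoc (Elim x₀)) := by
    apply FreeLieAlgebra.hom_ext
    rintro ⟨⟨x, k⟩, hx⟩
    rw [LieHom.comp_apply, elimMap_of, map_pow_ad, hρ, hρ, g0, LieHom.comp_apply, freeLieToAssoc_of]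
    change _ = leftMul (⟨(x, k), hx⟩ : Elim x₀)
    induction k with
    | zero => exact dif_pos hx
    | succ k ih =>
      rw [pow_succ', Module.End.mul_apply, ih hx, LieAlgebra.ad_apply, hD]
  rw [← LieHom.comp_apply, h, LieHom.comp_apply]
  exact mul_one _

theorem elimMap_injective : Function.Injective (elimMap x₀) := by
  obtain ⟨ρ, -, hρ⟩ := exists_elim_rep x₀
  rw [injective_iff_map_eq_zero]
  intro y hy
  apply freeLieToAssoc_injective
  rw [map_zero, ← hρ, hy, map_zero]
  rfl

theorem of_notMem_range_elimMap (y : FreeLieAlgebra ℂ (Elim x₀)) :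
    elimMap x₀ y ≠ FreeLieAlgebra.of ℂ x₀ := by
  obtain ⟨ρ, h0, hρ⟩ := exists_elim_rep x₀
  intro h
  have hy : y = 0 := by
    apply freeLieToAssoc_injective
    rw [map_zero, ← hρ, h, h0]
  rw [hy, map_zero] at h
  have := congrArg (freeLieToAssoc X) h
  rw [map_zero, freeLieToAssoc_of] at this
  exact FreeAlgebra.ι_ne_zero x₀ this.symm

variable {Γ : Type*} [AddCommMonoid Γ] (wt : X → Γ)

/-- The weight of a remaining generator. -/
def elimWt (z : Elim x₀) : Γ := z.1.2 • wt x₀ + wt z.1.1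

/-- `ad x₀` shifts the index `k` of the remaining generators, so their subalgebra together with `x₀`
is again a subalgebra, and it contains all of `X`. -/
theorem gradedSpan_elim (γ : Γ) : gradedSpan (FreeLieAlgebra.of ℂ) wt γ =
    (gradedSpan (FreeLieAlgebra.of ℂ) (elimWt x₀ wt) γ).map
      (elimMap x₀ : FreeLieAlgebra ℂ (Elim x₀) →ₗ[ℂ] FreeLieAlgebra ℂ X) ⊔
    ⨆ _ : γ = wt x₀, Submodule.span ℂ {FreeLieAlgebra.of ℂ x₀} := by
  rw [map_gradedSpan]
  apply le_antisymm
  · refine gradedSpan_le (P := adjoinPiece (fun z => elimMap x₀ (FreeLieAlgebra.of ℂ z))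
      (elimWt x₀ wt) (FreeLieAlgebra.of ℂ x₀) (wt x₀)) (fun x => ?_)
      (fun γ δ a b ha hb => lie_mem_adjoinPiece (fun z => ?_) ha hb) γ
    · by_cases hx : x = x₀
      · rw [hx]
        exact mem_adjoinPiece_self
      · refine gradedSpan_le_adjoinPiece _ ?_
        have := mem_gradedSpan (g := fun z => elimMap x₀ (FreeLieAlgebra.of ℂ z))
          (wt := elimWt x₀ wt) ⟨(x, 0), hx⟩
        simpa [elimMap_of, elimWt] using this
    · have := mem_gradedSpan (g := fun z => elimMap x₀ (FreeLieAlgebra.of ℂ z))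
          (wt := elimWt x₀ wt) ⟨(z.1.1, z.1.2 + 1), z.2⟩
      rw [elimMap_of, pow_succ', Module.End.mul_apply, LieAlgebra.ad_apply] at this
      rw [elimMap_of]
      convert this using 1
      simp only [elimWt]
      rw [succ_nsmul', add_assoc]
  · refine sup_le ?_ (iSup_le fun h => ?_)
    · refine gradedSpan_le (P := gradedSpan (FreeLieAlgebra.of ℂ) wt) (fun z => ?_)
        (fun γ δ a b ha hb => lie_mem_gradedSpan ha hb) γ
      rw [elimMap_of]
      obtain ⟨⟨x, k⟩, hx⟩ := z
      simp only [elimWt]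
      induction k with
      | zero => simpa using mem_gradedSpan x
      | succ k ih =>
        rw [pow_succ', Module.End.mul_apply, LieAlgebra.ad_apply, succ_nsmul', add_assoc]
        exact lie_mem_gradedSpan (mem_gradedSpan x₀) (ih hx)
    · rw [Submodule.span_singleton_le_iff_mem, h]
      exact mem_gradedSpan x₀

open Classical in
theorem finrank_gradedSpan_elim (γ : Γ)
    [FiniteDimensional ℂ (gradedSpan (FreeLieAlgebra.of ℂ) (elimWt x₀ wt) γ)] :
    FiniteDimensional ℂ (gradedSpan (FreeLieAlgebra.of ℂ) wt γ) ∧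
    finrank ℂ (gradedSpan (FreeLieAlgebra.of ℂ) wt γ) =
      finrank ℂ (gradedSpan (FreeLieAlgebra.of ℂ) (elimWt x₀ wt) γ) +
        if γ = wt x₀ then 1 else 0 := by
  have hinj : Function.Injective
      (elimMap x₀ : FreeLieAlgebra ℂ (Elim x₀) →ₗ[ℂ] FreeLieAlgebra ℂ X) := elimMap_injective x₀
  have hmap := (Submodule.equivMapOfInjective _ hinj
    (gradedSpan (FreeLieAlgebra.of ℂ) (elimWt x₀ wt) γ)).finrank_eq
  rw [gradedSpan_elim x₀ wt γ]
  by_cases hγ : γ = wt x₀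
  · rw [iSup_pos hγ, if_pos hγ]
    refine ⟨inferInstance, ?_⟩
    have h0 : FreeLieAlgebra.of ℂ x₀ ≠ 0 := by
      intro h
      exact of_notMem_range_elimMap x₀ 0 (by rw [map_zero, h])
    have hdisj : Disjoint ((gradedSpan (FreeLieAlgebra.of ℂ) (elimWt x₀ wt) γ).map
      (elimMap x₀ : FreeLieAlgebra ℂ (Elim x₀) →ₗ[ℂ] FreeLieAlgebra ℂ X))
      (Submodule.span ℂ {FreeLieAlgebra.of ℂ x₀}) := by
      rw [Submodule.disjoint_span_singleton' h0]
      rintro ⟨y, -, hy⟩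
      exact of_notMem_range_elimMap x₀ y hy
    have := Submodule.finrank_sup_add_finrank_inf_eq
      ((gradedSpan (FreeLieAlgebra.of ℂ) (elimWt x₀ wt) γ).map
      (elimMap x₀ : FreeLieAlgebra ℂ (Elim x₀) →ₗ[ℂ] FreeLieAlgebra ℂ X))
      (Submodule.span ℂ {FreeLieAlgebra.of ℂ x₀})
    rw [hdisj.eq_bot, finrank_bot, add_zero, finrank_span_singleton h0, ← hmap] at this
    exact this
  · rw [iSup_neg hγ, if_neg hγ, sup_bot_eq, ← hmap]
    exact ⟨inferInstance, rfl⟩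

end Lazard

end FrickeLie

namespace FrickeLie

open Module

/-! ### Dimensions of the homogeneous pieces of a free Lie algebra -/

section Witt

variable {Γ : Type*} [AddCommMonoid Γ] (deg : Γ →+ ℕ) {S : Type*} [CommRing S]
  (χ : Multiplicative Γ →* S) (D : ℕ)

/-- The product formula for the dimensions of the homogeneous pieces of a free Lie algebra, in a
ring in which the weights of degree greater than `D` evaluate to zero. -/
def WittFormula {X : Type u} (wt : X → Γ) : Prop :=
  (∀ γ, deg γ ≤ D → FiniteDimensional ℂ (gradedSpan (FreeLieAlgebra.of ℂ) wt γ)) ∧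
  {γ | deg γ ≤ D ∧ gradedSpan (FreeLieAlgebra.of ℂ) wt γ ≠ ⊥}.Finite ∧
  ∏ᶠ γ, (1 - χ (Multiplicative.ofAdd γ)) ^
      finrank ℂ (gradedSpan (FreeLieAlgebra.of ℂ) wt γ) =
    1 - ∑ᶠ x, χ (Multiplicative.ofAdd (wt x))

variable {deg χ D}

theorem wittFormula_of_lt (hχ : ∀ γ, D < deg γ → χ (Multiplicative.ofAdd γ) = 0)
    {X : Type u} {wt : X → Γ} (h : ∀ x, D < deg (wt x)) :
    WittFormula deg χ D wt := by
  have hbot : ∀ γ, deg γ ≤ D → gradedSpan (FreeLieAlgebra.of ℂ) wt γ = ⊥ :=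
    fun γ hγ => gradedSpan_eq_bot_of_deg_le deg h hγ
  refine ⟨fun γ hγ => ?_, ?_, ?_⟩
  · rw [hbot γ hγ]
    infer_instance
  · convert Set.finite_empty
    ext γ
    simp only [Set.mem_ofPred_eq, Set.mem_empty_iff_false, iff_false, not_and, not_not]
    exact hbot γ
  · rw [finsum_eq_zero_of_forall_eq_zero fun x => hχ _ (h x), sub_zero]
    refine finprod_eq_one_of_forall_eq_one fun γ => ?_
    by_cases hγ : deg γ ≤ D
    · rw [hbot γ hγ, finrank_bot, pow_zero]
    · rw [hχ γ (not_le.1 hγ), sub_zero, one_pow]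

/-- Eliminating `x₀` splits off one factor `1 - f x₀`. Multiplying it into `1 - ∑_{x ≠ x₀} ∑_k f x
(f x₀)^k` collapses the geometric series to `1 - ∑_x f x`; the series are finite because `x₀` has
positive degree. -/
theorem wittFormula_of_elim (hχ : ∀ γ, D < deg γ → χ (Multiplicative.ofAdd γ) = 0)
    {X : Type u} {wt : X → Γ} (x₀ : X)
    (h0 : ∀ x, 0 < deg (wt x))
    (hfin : {x | deg (wt x) ≤ D}.Finite) (hx₀ : deg (wt x₀) ≤ D)
    (hW : WittFormula deg χ D (elimWt x₀ wt)) : WittFormula deg χ D wt := by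
  classical
  obtain ⟨h1, h2, h3⟩ := hW
  refine ⟨fun γ hγ => ?_, ?_, ?_⟩
  · have := h1 γ hγ
    exact (finrank_gradedSpan_elim x₀ wt γ).1
  · refine (h2.union (Set.finite_singleton (wt x₀))).subset ?_
    rintro γ ⟨hγ, hne⟩
    by_cases hγ' : γ = wt x₀
    · exact Or.inr hγ'
    · refine Or.inl ⟨hγ, fun hbot => hne ?_⟩
      rw [gradedSpan_elim x₀ wt γ, hbot, iSup_neg hγ', Submodule.map_bot, sup_bot_eq]
  · have hfac : ∀ γ, (1 - χ (Multiplicative.ofAdd γ)) ^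
        finrank ℂ (gradedSpan (FreeLieAlgebra.of ℂ) wt γ) = (1 - χ (Multiplicative.ofAdd γ)) ^
        finrank ℂ (gradedSpan (FreeLieAlgebra.of ℂ) (elimWt x₀ wt) γ) *
        (1 - χ (Multiplicative.ofAdd γ)) ^ (if γ = wt x₀ then 1 else 0) := by
      intro γ
      by_cases hγ : deg γ ≤ D
      · have := h1 γ hγ
        rw [(finrank_gradedSpan_elim x₀ wt γ).2, pow_add]
      · simp [hχ γ (not_le.1 hγ)]
    rw [finprod_congr hfac, finprod_mul_distrib, h3, finprod_eq_single _ (wt x₀), if_pos rfl,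
      pow_one]
    · set f : X → S := fun x => χ (Multiplicative.ofAdd (wt x)) with hf
      have hfz : ∀ z : Elim x₀, χ (Multiplicative.ofAdd (elimWt x₀ wt z)) =
          f z.1.1 * f x₀ ^ z.1.2 := by
        intro z
        rw [elimWt, ofAdd_add, map_mul, ofAdd_nsmul, map_pow, mul_comm]
      have hpow : ∀ x, ∀ k, D < k → f x * f x₀ ^ k = 0 := by
        intro x k hk
        rw [hf, ← map_pow, ← map_mul, ← ofAdd_nsmul, ← ofAdd_add]
        apply hχ
        rw [map_add, map_nsmul, smul_eq_mul]
        have := h0 x₀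
        have := Nat.le_mul_of_pos_right k this
        omega
      set s := hfin.toFinset with hs
      have hfs : ∀ x, x ∉ s → f x = 0 := by
        intro x hx
        apply hχ
        simpa [hs] using hx
      have hx₀s : x₀ ∈ s := by simpa [hs] using hx₀
      have hX : ∑ᶠ x, f x = ∑ x ∈ s, f x :=
        finsum_eq_sum_of_support_subset _ fun x hx => by
          by_contra h
          exact hx (hfs x h)
      have hZ : ∑ᶠ z : Elim x₀, f z.1.1 * f x₀ ^ z.1.2 =
          ∑ z ∈ (s.erase x₀) ×ˢ Finset.range (D + 1), f z.1 * f x₀ ^ z.2 := by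
        have : ∑ᶠ z : Elim x₀, f z.1.1 * f x₀ ^ z.1.2 =
            ∑ᶠ z : X × ℕ, ∑ᶠ _ : z ∈ {z : X × ℕ | z.1 ≠ x₀}, f z.1 * f x₀ ^ z.2 :=
          finsum_set_coe_eq_finsum_mem (f := fun z : X × ℕ => f z.1 * f x₀ ^ z.2)
            {z : X × ℕ | z.1 ≠ x₀}
        rw [this]
        refine finsum_mem_eq_sum_of_inter_support_eq _ ?_
        ext ⟨x, k⟩
        simp only [Set.mem_inter_iff, Set.mem_ofPred_eq, Function.mem_support, Finset.coe_product,
          Set.mem_prod, Finset.mem_coe, Finset.mem_erase, Finset.mem_range]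
        constructor
        · rintro ⟨hx, hne⟩
          refine ⟨⟨⟨hx, ?_⟩, ?_⟩, hne⟩
          · by_contra h
            exact hne (by rw [hfs x h, zero_mul])
          · by_contra h
            exact hne (hpow x k (by omega))
        · rintro ⟨⟨⟨hx, -⟩, -⟩, hne⟩
          exact ⟨hx, hne⟩
      rw [finsum_congr hfz, hZ, hX, Finset.sum_product, ← Finset.add_sum_erase s f hx₀s]
      have hgeom : ∀ x, (1 - f x₀) * ∑ k ∈ Finset.range (D + 1), f x * f x₀ ^ k = f x := by
        intro x
        rw [← Finset.mul_sum, mul_left_comm, mul_neg_geom_sum, mul_sub, hpow x _ (Nat.lt_succ_self D),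
          mul_one, sub_zero]
      rw [sub_mul, one_mul, Finset.sum_mul]
      change 1 - f x₀ - ∑ x ∈ s.erase x₀,
        (∑ k ∈ Finset.range (D + 1), f x * f x₀ ^ k) * (1 - f x₀) = _
      simp_rw [mul_comm _ (1 - f x₀), hgeom]
      ring
    · intro γ hγ
      rw [if_neg hγ, pow_zero]
    · refine h2.subset fun γ hγ => ?_
      rw [Function.mem_mulSupport] at hγ
      refine ⟨?_, fun h => hγ ?_⟩
      · by_contra h
        exact hγ (by rw [hχ γ (not_le.1 h), sub_zero, one_pow])
      · rw [h, finrank_bot, pow_zero]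
    · refine (Set.finite_singleton (wt x₀)).subset fun γ hγ => ?_
      by_contra h
      exact hγ (by simp [show γ ≠ wt x₀ from h])

/-- Induction on the distance from `D` to a strict lower bound `k` for the degrees of the
generators, and inside it on the number of generators of degree `k + 1`. Eliminating one of these
adds only generators of larger degree. Once all degrees exceed `D`, both sides are `1`. -/
theorem wittFormula (hχ : ∀ γ, D < deg γ → χ (Multiplicative.ofAdd γ) = 0)
    {X : Type u} {wt : X → Γ} (h0 : ∀ x, 0 < deg (wt x))
    (hfin : ∀ n, {x | deg (wt x) ≤ n}.Finite) : WittFormula deg χ D wt := by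
  suffices H : ∀ j k, k + j = D → ∀ (X : Type u) (wt : X → Γ), (∀ x, k < deg (wt x)) →
      (∀ n, {x | deg (wt x) ≤ n}.Finite) → WittFormula deg χ D wt from
    H D 0 (zero_add D) X wt h0 hfin
  intro j
  induction j with
  | zero =>
    intro k hk X wt h _
    rw [add_zero] at hk
    subst hk
    exact wittFormula_of_lt hχ h
  | succ j ihj =>
    intro k hk
    suffices H : ∀ n (X : Type u) (wt : X → Γ), (∀ x, k < deg (wt x)) →
        (∀ n, {x | deg (wt x) ≤ n}.Finite) → {x | deg (wt x) ≤ k + 1}.ncard ≤ n →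
        WittFormula deg χ D wt from
      fun X wt h hfin => H _ X wt h hfin le_rfl
    intro n
    induction n with
    | zero =>
      intro X wt h hfin hn
      have hempty := (Set.ncard_eq_zero (hfin (k + 1))).1 (Nat.le_zero.1 hn)
      refine ihj (k + 1) (by omega) X wt (fun x => ?_) hfin
      by_contra hx
      have : x ∈ {x | deg (wt x) ≤ k + 1} := not_lt.1 hx
      rw [hempty] at this
      exact this
    | succ n ihn =>
      intro X wt h hfin hn
      by_cases hex : ∃ x₀, deg (wt x₀) ≤ k + 1
      · obtain ⟨x₀, hx₀⟩ := hex
        have hdeg : ∀ z : Elim x₀, deg (elimWt x₀ wt z) =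
            z.1.2 * deg (wt x₀) + deg (wt z.1.1) := by
          intro z
          rw [elimWt, map_add, map_nsmul, smul_eq_mul]
        refine wittFormula_of_elim hχ x₀ (fun x => (Nat.zero_le k).trans_lt (h x)) (hfin D)
          (by omega) (ihn _ _ (fun z => ?_) (fun m => ?_) ?_)
        · rw [hdeg]
          have := h z.1.1
          omega
        · have hsub : Set.InjOn (fun z : Elim x₀ => z.1) {z | deg (elimWt x₀ wt z) ≤ m} :=
            Subtype.val_injective.injOn
          refine Set.Finite.of_finite_image (((hfin m).prod (Set.finite_Iic m)).subset ?_) hsub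
          rintro _ ⟨z, hz, rfl⟩
          rw [Set.mem_ofPred_eq, hdeg] at hz
          have h1 := Nat.le_mul_of_pos_right z.1.2 ((Nat.zero_le k).trans_lt (h x₀))
          exact ⟨show deg (wt z.1.1) ≤ m by omega, show z.1.2 ≤ m by omega⟩
        · have hlt : ({x | deg (wt x) ≤ k + 1} \ {x₀}).ncard < {x | deg (wt x) ≤ k + 1}.ncard :=
            Set.ncard_sdiff_singleton_lt_of_mem hx₀ (hfin (k + 1))
          have hz0 : ∀ z : Elim x₀, deg (elimWt x₀ wt z) ≤ k + 1 →
              z.1.2 = 0 ∧ deg (wt z.1.1) ≤ k + 1 := by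
            intro z hz
            rw [hdeg] at hz
            have h1 := h z.1.1
            have h2 := h x₀
            have h3 : z.1.2 = 0 := by
              by_contra h4
              have := Nat.mul_le_mul (Nat.one_le_iff_ne_zero.2 h4) (Nat.succ_le_of_lt h2)
              omega
            exact ⟨h3, by omega⟩
          have hle : {z : Elim x₀ | deg (elimWt x₀ wt z) ≤ k + 1}.ncard ≤
              ({x | deg (wt x) ≤ k + 1} \ {x₀}).ncard := by
            refine Set.ncard_le_ncard_of_injOn (fun z => z.1.1) ?_ ?_ ((hfin (k + 1)).sdiff)
            · intro z hz
              exact ⟨(hz0 z hz).2, z.2⟩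
            · intro z hz z' hz' heq
              exact Subtype.ext (Prod.ext heq ((hz0 z hz).1.trans (hz0 z' hz').1.symm))
          omega
      · refine ihn X wt h hfin ?_
        rw [(Set.ncard_eq_zero (hfin (k + 1))).2]
        · exact Nat.zero_le n
        · ext x
          simpa using fun hx => hex ⟨x, hx⟩

end Witt

end FrickeLie

namespace FrickeLie

open Module

/-! ### The root system of a Fricke Lie algebra -/

/-- The projection from the free Lie algebra, as a homomorphism of Lie algebras. -/
noncomputable def universalMk {I : Type v} (A : Matrix I I ℝ) : FreeGen I →ₗ⁅ℂ⁆ UniversalBKM A where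
  toFun y := UniversalBKM.of A y
  map_add' _ _ := rfl
  map_smul' _ _ := rfl
  map_lie' := rfl

theorem universalMk_eq_zero {I : Type v} {A : Matrix I I ℝ} {y : FreeGen I} :
    universalMk A y = 0 ↔ y ∈ relIdeal A :=
  LieSubmodule.Quotient.mk_eq_zero (N := relIdeal A)

theorem universalMk_relator {I : Type v} {A : Matrix I I ℝ} {y : FreeGen I} (hy : IsRelator A y) :
    universalMk A y = 0 :=
  universalMk_eq_zero.2 (LieSubmodule.subset_lieSpan hy)

theorem chevalleyRel_universalMk {I : Type v} (A : Matrix I I ℝ) :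
    ChevalleyRel A (fun i => universalMk A (genH i)) (fun i => universalMk A (genE i))
      (fun i => universalMk A (genF i)) where
  he i k := by
    rw [← LieHom.map_lie, ← map_smul, ← sub_eq_zero, ← map_sub]
    exact universalMk_relator (.he i k)
  hf i k := by
    rw [← LieHom.map_lie, ← map_smul, ← sub_eq_zero, sub_neg_eq_add, ← map_add]
    exact universalMk_relator (.hf i k)
  ef_self i := by
    rw [← LieHom.map_lie, ← sub_eq_zero, ← map_sub]
    exact universalMk_relator (.ef_self i)
  ef_ne i j hij := by
    rw [← LieHom.map_lie]
    exact universalMk_relator (.ef_ne i j hij)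

namespace FrickeStructure

variable {𝔤 : Type u} [LieRing 𝔤] [LieAlgebra ℂ 𝔤] (F : FrickeStructure.{u, v} 𝔤)

/-- The generator `e_i`. -/
noncomputable def e (i : F.I) : 𝔤 := F.π (universalMk F.A (genE i))

/-- The generator `f_i`. -/
noncomputable def f (i : F.I) : 𝔤 := F.π (universalMk F.A (genF i))

/-- The element `h_i`. -/
noncomputable def h (i : F.I) : 𝔤 := F.π (universalMk F.A (genH i))

theorem chevalleyRel : ChevalleyRel F.A F.h F.e F.f :=
  (chevalleyRel_universalMk F.A).map F.π

theorem coe_coroot (i : F.I) : (F.coroot i : 𝔤) = F.h i := rfl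

/-- If `e_i` vanished in `𝔤`, it would be central in `𝔤(A)`; then `h_i = ⁅e_i, f_i⁆ = 0` and `a_{ii}
e_i = ⁅h_i, e_i⁆ = 0`, although `a_{ii} ≠ 0`. -/
theorem e_ne_zero (i : F.I) : F.e i ≠ 0 := by
  intro h0
  have hc := F.ker_central _ h0
  have C := chevalleyRel_universalMk F.A
  have h1 := C.he i i
  rw [← C.ef_self i, hc, zero_lie] at h1
  rcases smul_eq_zero.1 h1.symm with h2 | h2
  · exact F.norm_ne_zero i (by exact_mod_cast h2)
  · exact of_genE_ne_zero F.isGeneralizedCartanMatrix i h2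

theorem lie_cartan_e (i : F.I) (c : F.cartan) : ⁅(c : 𝔤), F.e i⁆ = F.simpleRoot i c • F.e i :=
  F.lie_e i c

theorem lie_cartan_f (i : F.I) (c : F.cartan) : ⁅(c : 𝔤), F.f i⁆ = -(F.simpleRoot i c • F.f i) :=
  F.lie_f i c

theorem simpleRoot_coroot (i j : F.I) : F.simpleRoot i (F.coroot j) = (F.A j i : ℂ) := by
  have h1 := F.lie_cartan_e i (F.coroot j)
  rw [coe_coroot, F.chevalleyRel.he] at h1
  exact (smul_left_injective ℂ (F.e_ne_zero i) h1).symm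

theorem form_simpleRoot_simpleRoot (i j : F.I) :
    F.form (F.simpleRoot i) (F.simpleRoot j) = (F.q i : ℂ) * F.A i j := by
  rw [F.form_simpleRoot, simpleRoot_coroot]

/-- The real simple root. -/
abbrev r : F.I := F.realIndex

theorem A_r_r_pos : 0 < F.A F.r F.r := (F.real_iff _).2 rfl

theorem A_r_r : F.A F.r F.r = 2 := F.isGeneralizedCartanMatrix.diag_of_pos _ F.A_r_r_pos

theorem weight_eq (m n : ℤ) :
    F.weight m n = (m : ℂ) • F.weight 1 0 + (n : ℂ) • F.weight 0 1 := by
  simp [weight]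

theorem weight_add (m n m' n' : ℤ) :
    F.weight (m + m') (n + n') = F.weight m n + F.weight m' n' := by
  rw [F.weight_eq, F.weight_eq m n, F.weight_eq m' n']
  push_cast
  rw [add_smul, add_smul]
  abel

theorem weight_neg (m n : ℤ) : F.weight (-m) (-n) = -F.weight m n := by
  rw [F.weight_eq, F.weight_eq m n]
  push_cast
  rw [neg_smul, neg_smul, neg_add]

theorem weight_zero : F.weight 0 0 = 0 := by
  simp [weight]

theorem simpleRoot_r : F.simpleRoot F.r = F.weight 1 0 - F.weight 0 1 := by
  simp [weight]

theorem form_r_ρ : F.form (F.simpleRoot F.r) F.ρ = -(F.q F.r : ℂ) := by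
  rw [F.form_simpleRoot_ρ, form_simpleRoot_simpleRoot, A_r_r]
  push_cast
  ring

theorem form_weight_10_10 : F.form (F.weight 1 0) (F.weight 1 0) = 0 := by
  simp [weight, F.form_ρ_ρ]

theorem form_weight_10_01 : F.form (F.weight 1 0) (F.weight 0 1) = -(F.q F.r : ℂ) := by
  have h1 := F.form_r_ρ
  rw [F.form_symm] at h1
  simp [weight, F.form_ρ_ρ, h1]

theorem form_weight_01_01 : F.form (F.weight 0 1) (F.weight 0 1) = 0 := by
  have h1 := F.form_r_ρ
  have h2 := h1
  have h3 := F.form_simpleRoot_simpleRoot F.r F.r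
  rw [F.form_symm] at h1
  rw [A_r_r] at h3
  simp only [weight, Int.cast_zero, zero_smul, Int.cast_one, one_smul, zero_add, map_sub, map_neg,
    LinearMap.sub_apply, LinearMap.neg_apply, F.form_ρ_ρ, h1, h2, h3]
  push_cast
  ring

/-- Both `-ρ` and `-ρ - α` are isotropic, the latter because `2 (ρ, α) = -(α, α)`. Hence only the
cross terms survive. -/
theorem form_lincomb (x y x' y' : ℂ) :
    F.form (x • F.weight 1 0 + y • F.weight 0 1) (x' • F.weight 1 0 + y' • F.weight 0 1) =
      -(F.q F.r : ℂ) * (x * y' + y * x') := by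
  have h := F.form_symm (F.weight 0 1) (F.weight 1 0)
  rw [form_weight_10_01] at h
  simp only [map_add, map_smul, LinearMap.add_apply, LinearMap.smul_apply, smul_eq_mul,
    form_weight_10_10, form_weight_10_01, form_weight_01_01, h]
  ring

theorem q_r_ne_zero : (F.q F.r : ℂ) ≠ 0 := by
  exact_mod_cast (F.q_pos _).ne'

instance finite_cartan : FiniteDimensional ℂ F.cartan :=
  Module.finite_of_finrank_eq_succ F.finrank_cartan

theorem linearIndependent_weight : LinearIndependent ℂ ![F.weight 1 0, F.weight 0 1] := by
  rw [LinearIndependent.pair_iff]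
  intro x y hxy
  have h1 := F.form_lincomb x y 1 0
  have h2 := F.form_lincomb x y 0 1
  rw [hxy, map_zero, LinearMap.zero_apply] at h1 h2
  have h0 := F.q_r_ne_zero
  constructor
  · simpa [h0] using h2.symm
  · simpa [h0] using h1.symm

theorem exists_lincomb (μ : Dual ℂ F.cartan) :
    ∃ x y : ℂ, μ = x • F.weight 1 0 + y • F.weight 0 1 := by
  have h := F.linearIndependent_weight.span_eq_top_of_card_eq_finrank' (by
    rw [Subspace.dual_finrank_eq, F.finrank_cartan, Fintype.card_fin])
  have hμ : μ ∈ Submodule.span ℂ (Set.range ![F.weight 1 0, F.weight 0 1]) := by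
    rw [h]
    trivial
  rw [Matrix.range_cons, Matrix.range_cons, Matrix.range_empty, Set.union_empty,
    Set.singleton_union, Submodule.mem_span_pair] at hμ
  obtain ⟨x, y, hxy⟩ := hμ
  exact ⟨x, y, hxy.symm⟩

/-- The second coordinate of a simple root; the first one is always `1`. -/
noncomputable def ht (i : F.I) : ℤ :=
  1 - (F.isGeneralizedCartanMatrix.integral_of_pos F.r F.A_r_r_pos i).choose

theorem A_r_eq (i : F.I) : F.A F.r i = 1 - (F.ht i : ℝ) := by
  rw [ht, Int.cast_sub, Int.cast_one, sub_sub_cancel]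
  exact (F.isGeneralizedCartanMatrix.integral_of_pos F.r F.A_r_r_pos i).choose_spec

theorem ht_r : F.ht F.r = -1 := by
  have h := F.A_r_eq F.r
  rw [A_r_r] at h
  have : (F.ht F.r : ℝ) = ((-1 : ℤ) : ℝ) := by push_cast; linarith
  exact_mod_cast this

theorem one_le_ht {i : F.I} (hi : i ≠ F.r) : 1 ≤ F.ht i := by
  have h := F.A_r_eq i
  have h1 := F.isGeneralizedCartanMatrix.offDiag_nonpos F.r i hi.symm
  have : ((1 : ℤ) : ℝ) ≤ F.ht i := by push_cast; linarith
  exact_mod_cast this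

theorem neg_one_le_ht (i : F.I) : -1 ≤ F.ht i := by
  by_cases hi : i = F.r
  · rw [hi, ht_r]
  · have := F.one_le_ht hi
    omega

/-- For an imaginary simple root with coordinates `(x, y)` the Weyl vector condition reads `y = x
y`, and `y ≠ 0` since the norm `-2 q_r x y` is nonzero; so `x = 1`. Pairing with the real root then
gives `y = 1 - a_{ri}`. -/
theorem simpleRoot_eq (i : F.I) : F.simpleRoot i = F.weight 1 (F.ht i) := by
  by_cases hi : i = F.r
  · rw [hi, ht_r, simpleRoot_r, F.weight_eq 1 (-1)]
    push_cast
    rw [one_smul, neg_smul, one_smul, sub_eq_add_neg]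
  · obtain ⟨x, y, hxy⟩ := F.exists_lincomb (F.simpleRoot i)
    have hq := F.q_r_ne_zero
    have h1 := F.form_simpleRoot_ρ i
    have h2 := F.form_simpleRoot_simpleRoot i i
    have h3 := F.form_simpleRoot_simpleRoot F.r i
    have hρ : F.ρ = (-1 : ℂ) • F.weight 1 0 + (0 : ℂ) • F.weight 0 1 := by simp [weight]
    have hr : F.simpleRoot F.r = (1 : ℂ) • F.weight 1 0 + (-1 : ℂ) • F.weight 0 1 := by
      rw [simpleRoot_r, one_smul, neg_smul, one_smul, sub_eq_add_neg]
    rw [hxy, hρ, form_lincomb, form_lincomb] at h1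
    rw [hxy, form_lincomb] at h2
    rw [hxy, hr, form_lincomb] at h3
    have hn : (F.q i : ℂ) * F.A i i ≠ 0 := by
      have := mul_ne_zero (F.q_pos i).ne' (F.norm_ne_zero i)
      exact_mod_cast this
    have hy : y ≠ 0 := by
      rintro rfl
      rw [← h2] at hn
      exact hn (by ring)
    have hx : x = 1 := by
      have h4 : (F.q F.r : ℂ) * y * (x - 1) = 0 := by linear_combination -h1
      have h5 := (mul_eq_zero.1 h4).resolve_left (mul_ne_zero hq hy)
      exact sub_eq_zero.1 h5
    have hy' : y = F.ht i := by
      rw [F.A_r_eq i, hx] at h3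
      push_cast at h3
      have h4 : (F.q F.r : ℂ) * (y - F.ht i) = 0 := by linear_combination -h3
      exact sub_eq_zero.1 ((mul_eq_zero.1 h4).resolve_left hq)
    rw [hxy, F.weight_eq 1 (F.ht i), hx, hy', Int.cast_one]

theorem q_mul_A (i j : F.I) : F.q i * F.A i j = -F.q F.r * (F.ht i + F.ht j) := by
  have h := F.form_simpleRoot_simpleRoot i j
  rw [simpleRoot_eq, simpleRoot_eq, F.weight_eq, F.weight_eq 1 (F.ht j), form_lincomb] at h
  have h' : ((F.q i * F.A i j : ℝ) : ℂ) = ((-F.q F.r * (F.ht i + F.ht j) : ℝ) : ℂ) := by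
    push_cast
    rw [← h]
    push_cast
    ring
  exact_mod_cast h'

/-- The inner product `-q_r (ht i + ht j)` of imaginary simple roots is strictly negative. Without
orthogonality relations among them, the imaginary part can be free. -/
theorem A_ne_zero {i j : F.I} (hi : i ≠ F.r) (hj : j ≠ F.r) : F.A i j ≠ 0 := by
  intro h0
  have h := F.q_mul_A i j
  have h1 : (1 : ℝ) ≤ F.ht i := by exact_mod_cast F.one_le_ht hi
  have h2 : (1 : ℝ) ≤ F.ht j := by exact_mod_cast F.one_le_ht hj
  have h3 := F.q_pos F.r
  rw [h0, mul_zero] at h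
  nlinarith

/-- The norm of `α_i` is `-2 q_r ht i`, so bounding the height above bounds the norm below. -/
theorem finite_ht_le (n : ℤ) : {i | F.ht i ≤ n}.Finite := by
  refine (F.finite_norm_gt (-F.q F.r * (2 * (n + 1)))).subset fun i hi => ?_
  have h3 := F.q_pos F.r
  have h4 : (F.ht i : ℝ) ≤ n := by exact_mod_cast hi
  rw [Set.mem_ofPred_eq, q_mul_A]
  nlinarith

/-! ### Root spaces -/

/-- The root space of degree `γ`. -/
abbrev E (γ : ℤ × ℤ) : Submodule ℂ 𝔤 := F.rootSpace γ.1 γ.2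

theorem mem_E {γ : ℤ × ℤ} {y : 𝔤} :
    y ∈ F.E γ ↔ ∀ c : F.cartan, ⁅(c : 𝔤), y⁆ = F.weight γ.1 γ.2 c • y := Iff.rfl

theorem lie_mem_E {γ δ : ℤ × ℤ} {a b : 𝔤} (ha : a ∈ F.E γ) (hb : b ∈ F.E δ) :
    ⁅a, b⁆ ∈ F.E (γ + δ) := by
  rw [mem_E] at *
  intro c
  rw [leibniz_lie, ha, hb, smul_lie, lie_smul, Prod.fst_add, Prod.snd_add, weight_add,
    LinearMap.add_apply, add_smul]

theorem e_mem_E (i : F.I) : F.e i ∈ F.E (1, F.ht i) := fun c => by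
  rw [lie_cartan_e, simpleRoot_eq]

theorem f_mem_E (i : F.I) : F.f i ∈ F.E (-1, -F.ht i) := fun c => by
  rw [lie_cartan_f, simpleRoot_eq, weight_neg, LinearMap.neg_apply, neg_smul]

theorem cartan_le_E : F.cartan ≤ F.E 0 := by
  have hh : ∀ i (c : F.cartan), ⁅(c : 𝔤), F.h i⁆ = 0 := by
    intro i c
    rw [← F.chevalleyRel.ef_self, leibniz_lie, lie_cartan_e, lie_cartan_f, smul_lie, lie_neg,
      lie_smul, add_neg_cancel]
  have hle : ∀ x : 𝔤, (∀ i, ⁅x, F.h i⁆ = 0) → (∀ d ∈ F.D, ⁅x, d⁆ = 0) →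
      F.cartan ≤ LinearMap.ker (LieAlgebra.ad ℂ 𝔤 x : Module.End ℂ 𝔤) := by
    intro x h1 h2
    rw [F.cartan_eq]
    refine sup_le (Submodule.span_le.2 ?_) fun d hd => h2 d hd
    rintro _ ⟨i, rfl⟩
    exact h1 i
  have hD : F.D ≤ F.cartan := by
    rw [F.cartan_eq]
    exact le_sup_right
  have hD' : ∀ d ∈ F.D, ∀ c : F.cartan, ⁅d, (c : 𝔤)⁆ = 0 := fun d hd c =>
    hle d (fun i => hh i ⟨d, hD hd⟩) (F.D_comm d hd) c.2
  intro y hy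
  rw [mem_E]
  intro c
  rw [show F.weight (0 : ℤ × ℤ).1 (0 : ℤ × ℤ).2 = 0 from F.weight_zero, LinearMap.zero_apply,
    zero_smul]
  exact hle c (fun i => hh i c) (fun d hd => by rw [← lie_skew, hD' d hd c, neg_zero]) hy

end FrickeStructure

end FrickeLie

namespace FrickeLie

open Module

/-! ### Linear algebra of graded decompositions -/

section GradedLinear

variable {V ι : Type*} [AddCommGroup V] [Module ℂ V] {P E : ι → Submodule ℂ V}

/-- Turns a spanning statement into an equality of homogeneous pieces; it serves both for root
spaces and for generalized eigenspaces. -/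
theorem eq_of_iSupIndep (hE : iSupIndep E) (hPE : ∀ i, P i ≤ E i) {i : ι}
    (hle : E i ≤ ⨆ j, P j) : P i = E i := by
  refine le_antisymm (hPE i) fun x hx => ?_
  have h1 : ⨆ j, P j ≤ P i ⊔ ⨆ (j) (_ : j ≠ i), E j := by
    refine iSup_le fun j => ?_
    by_cases hj : j = i
    · rw [hj]
      exact le_sup_left
    · exact le_sup_of_le_right ((hPE j).trans (le_iSup₂_of_le j hj le_rfl))
  obtain ⟨a, ha, b, hb, rfl⟩ := Submodule.mem_sup.1 (h1 (hle hx))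
  have hbE : b ∈ E i := by
    have := (E i).sub_mem hx (hPE i ha)
    rwa [add_sub_cancel_left] at this
  rw [(Submodule.disjoint_def.1 (hE i)) b hbE hb, add_zero]
  exact ha

end GradedLinear

/-! ### Finite-dimensionality of homogeneous pieces -/

section Finite

variable {G : Type*} [LieRing G] [LieAlgebra ℂ G] {X : Type u}

/-- Only the finiteness clause of `wittFormula` is needed, so the weights are evaluated in the zero
ring, where the product formula is vacuous. -/
theorem finiteDimensional_gradedSpan_nat (g : X → G) (wt : X → ℕ) (h0 : ∀ x, 0 < wt x)
    (hfin : ∀ n, {x | wt x ≤ n}.Finite) (n : ℕ) : FiniteDimensional ℂ (gradedSpan g wt n) := by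
  have h := (wittFormula (deg := AddMonoidHom.id ℕ) (χ := (1 : Multiplicative ℕ →* PUnit.{1})) (D := n)
    (fun _ _ => rfl) h0 hfin).1 n le_rfl
  have h2 := map_gradedSpan (FreeLieAlgebra.lift ℂ g) (g := FreeLieAlgebra.of ℂ) (wt := wt) n
  simp only [FreeLieAlgebra.lift_of_apply] at h2
  rw [← h2]
  infer_instance

theorem finiteDimensional_gradedSpan (g : X → G) (wt : X → ℤ × ℤ) (φ : ℤ × ℤ →+ ℤ)
    (h0 : ∀ x, 0 < φ (wt x)) (hfin : ∀ n, {x | φ (wt x) ≤ n}.Finite) (γ : ℤ × ℤ) :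
    FiniteDimensional ℂ (gradedSpan g wt γ) := by
  let wt' : X → ℕ := fun x => (φ (wt x)).toNat
  have hfd := finiteDimensional_gradedSpan_nat g wt' (fun x => by have := h0 x; simp only [wt']; omega)
    (fun n => (hfin n).subset fun x hx => by
      have : (φ (wt x)).toNat ≤ n := hx
      change φ (wt x) ≤ n
      omega)
  have hle : gradedSpan g wt γ ≤ gradedSpan g wt' (φ γ).toNat := by
    have := gradedSpan_le (g := g) (wt := wt)
      (P := fun γ => ⨆ _ : 0 ≤ φ γ, gradedSpan g wt' (φ γ).toNat) (fun x => ?_) ?_ γ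
    · exact this.trans (iSup_le fun _ => le_rfl)
    · exact Submodule.mem_iSup_of_mem (h0 x).le (mem_gradedSpan x)
    · intro γ δ a b ha hb
      by_cases hγ : 0 ≤ φ γ
      · by_cases hδ : 0 ≤ φ δ
        · rw [iSup_pos hγ] at ha
          rw [iSup_pos hδ] at hb
          have hadd : φ (γ + δ) = φ γ + φ δ := map_add φ γ δ
          have : (φ (γ + δ)).toNat = (φ γ).toNat + (φ δ).toNat := by omega
          rw [iSup_pos (by omega), this]
          exact lie_mem_gradedSpan ha hb
        · rw [iSup_neg hδ, Submodule.mem_bot] at hb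
          rw [hb, lie_zero]
          exact Submodule.zero_mem _
      · rw [iSup_neg hγ, Submodule.mem_bot] at ha
        rw [ha, zero_lie]
        exact Submodule.zero_mem _
  have := hfd (φ γ).toNat
  exact Submodule.finiteDimensional_of_le hle

end Finite

namespace FrickeStructure

variable {𝔤 : Type u} [LieRing 𝔤] [LieAlgebra ℂ 𝔤] (F : FrickeStructure.{u, v} 𝔤)

/-! ### The triangular decomposition -/

theorem exists_cartan_separating : ∃ c : F.cartan, F.weight 1 0 c = 1 ∧
    F.weight 0 1 c = ((√2 : ℝ) : ℂ) := by
  let T : F.cartan →ₗ[ℂ] ℂ × ℂ := LinearMap.prod (F.weight 1 0) (F.weight 0 1)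
  have hT : Function.Injective T := by
    rw [injective_iff_map_eq_zero]
    intro c hc
    rw [Prod.ext_iff] at hc
    rw [← Module.forall_dual_apply_eq_zero_iff ℂ]
    intro μ
    obtain ⟨x, y, rfl⟩ := F.exists_lincomb μ
    have h1 : F.weight 1 0 c = 0 := hc.1
    have h2 : F.weight 0 1 c = 0 := hc.2
    simp [h1, h2]
  have hS : Function.Surjective T :=
    (LinearMap.injective_iff_surjective_of_finrank_eq_finrank (by
      rw [F.finrank_cartan, Module.finrank_prod, Module.finrank_self])).1 hT
  obtain ⟨c, hc⟩ := hS (1, ((√2 : ℝ) : ℂ))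
  rw [Prod.ext_iff] at hc
  exact ⟨c, hc⟩

/-- By irrationality of `√2`, the values `m + n √2` are distinct, so the root spaces lie in
different eigenspaces of a single `ad c`. -/
theorem iSupIndep_E : iSupIndep F.E := by
  obtain ⟨c, h1, h2⟩ := F.exists_cartan_separating
  let T : Module.End ℂ 𝔤 := LieAlgebra.ad ℂ 𝔤 (c : 𝔤)
  let val : ℤ × ℤ → ℂ := fun γ => ((γ.1 + γ.2 * √2 : ℝ) : ℂ)
  have hval : Function.Injective val := by
    rintro ⟨m, n⟩ ⟨m', n'⟩ h
    have h3 : (m + n * √2 : ℝ) = m' + n' * √2 := Complex.ofReal_injective h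
    by_cases hn : n = n'
    · subst hn
      have : (m : ℝ) = m' := by linarith
      rw [Int.cast_injective this]
    · exfalso
      have hn' : ((n : ℝ) - n') ≠ 0 := sub_ne_zero.2 fun h => hn (Int.cast_injective h)
      refine irrational_sqrt_two ⟨((m' - m : ℤ) : ℚ) / ((n - n' : ℤ) : ℚ), ?_⟩
      push_cast
      rw [div_eq_iff hn']
      linarith
  refine ((T.eigenspaces_iSupIndep).comp hval).mono fun γ y hy => ?_
  change y ∈ T.eigenspace (val γ)
  rw [Module.End.mem_eigenspace_iff]
  change ⁅(c : 𝔤), y⁆ = _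
  rw [(F.mem_E.1 hy) c, F.weight_eq, LinearMap.add_apply, LinearMap.smul_apply,
    LinearMap.smul_apply, h1, h2]
  congr 1
  simp [val]

/-- The degree of `e_i`. -/
noncomputable def wtE (i : F.I) : ℤ × ℤ := (1, F.ht i)

/-- The degree of `f_i`. -/
noncomputable def wtF (i : F.I) : ℤ × ℤ := (-1, -F.ht i)

theorem gradedSpan_le_E {X : Type*} {g : X → 𝔤} {wt : X → ℤ × ℤ} (h : ∀ x, g x ∈ F.E (wt x))
    (γ : ℤ × ℤ) : gradedSpan g wt γ ≤ F.E γ :=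
  gradedSpan_le h (fun _ _ _ _ ha hb => F.lie_mem_E ha hb) γ

theorem lie_cartan_mem {X : Type*} {g : X → 𝔤} {wt : X → ℤ × ℤ} (h : ∀ x, g x ∈ F.E (wt x))
    {c y : 𝔤} (hc : c ∈ F.cartan) (hy : y ∈ bracketSubalgebra g wt) :
    ⁅c, y⁆ ∈ bracketSubalgebra g wt := by
  have : (⨆ γ, gradedSpan g wt γ) ≤ (bracketSubalgebra g wt).toSubmodule.comap
      (LieAlgebra.ad ℂ 𝔤 c : Module.End ℂ 𝔤) := by
    refine iSup_le fun γ y hy => ?_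
    change ⁅c, y⁆ ∈ bracketSubalgebra g wt
    rw [(F.mem_E.1 (F.gradedSpan_le_E h γ hy)) ⟨c, hc⟩]
    exact (bracketSubalgebra g wt).smul_mem _
      (Submodule.mem_iSup_of_mem (p := gradedSpan g wt) γ hy)
  exact this hy

/-- Applied with `a = f_i` and the `e_j`, or with the roles exchanged: brackets with generators land
in `𝔥`, which normalizes the subalgebra, and the Leibniz rule does the rest. -/
theorem lie_mem_sup_cartan {X : Type*} {g : X → 𝔤} {wt : X → ℤ × ℤ} (h : ∀ x, g x ∈ F.E (wt x))
    {a : 𝔤} (ha : ∀ x, ⁅a, g x⁆ ∈ F.cartan) {y : 𝔤} (hy : y ∈ bracketSubalgebra g wt) :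
    ⁅a, y⁆ ∈ (bracketSubalgebra g wt).toSubmodule ⊔ F.cartan := by
  set N := bracketSubalgebra g wt with hN
  have hle : ∀ γ, gradedSpan g wt γ ≤ N.toSubmodule := fun γ => le_iSup (gradedSpan g wt) γ
  have key : ∀ γ, gradedSpan g wt γ ≤ N.toSubmodule ⊓ (N.toSubmodule ⊔ F.cartan).comap
      (LieAlgebra.ad ℂ 𝔤 a : Module.End ℂ 𝔤) := by
    refine gradedSpan_le (P := fun _ => N.toSubmodule ⊓ (N.toSubmodule ⊔ F.cartan).comap
      (LieAlgebra.ad ℂ 𝔤 a : Module.End ℂ 𝔤)) (fun x => ⟨hle _ (mem_gradedSpan x),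
        Submodule.mem_sup_right (ha x)⟩) ?_
    have hlie : ∀ b c, b ∈ N.toSubmodule ⊔ F.cartan → c ∈ N → ⁅b, c⁆ ∈ N := by
      intro b c hbc hc
      obtain ⟨b, hb, b', hb', rfl⟩ := Submodule.mem_sup.1 hbc
      rw [add_lie]
      exact N.add_mem (N.lie_mem hb hc) (F.lie_cartan_mem h hb' hc)
    rintro γ δ b c ⟨hb, hb'⟩ ⟨hc, hc'⟩
    refine ⟨N.lie_mem hb hc, Submodule.mem_sup_left ?_⟩
    change ⁅a, ⁅b, c⁆⁆ ∈ N
    rw [leibniz_lie]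
    refine N.add_mem (hlie _ _ hb' hc) ?_
    rw [← lie_skew]
    exact N.neg_mem (hlie _ _ hc' hb)
  exact ((iSup_le key : (⨆ γ, gradedSpan g wt γ) ≤ _) hy).2

theorem e_mem (i : F.I) : F.e i ∈ F.E (F.wtE i) := F.e_mem_E i

theorem f_mem (i : F.I) : F.f i ∈ F.E (F.wtF i) := F.f_mem_E i

theorem coroot_mem_cartan (i : F.I) : F.h i ∈ F.cartan := (F.coroot i).2

/-- The sum contains all `e_i`, `f_i`, `h_i` and is stable under their adjoint actions, so it
contains the image of `𝔤(A)`. The complement `D` lies in `𝔥`. -/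
theorem triangular : (bracketSubalgebra F.e F.wtE).toSubmodule ⊔
    (bracketSubalgebra F.f F.wtF).toSubmodule ⊔ F.cartan = ⊤ := by
  set N := bracketSubalgebra F.e F.wtE
  set N' := bracketSubalgebra F.f F.wtF
  set V := N.toSubmodule ⊔ N'.toSubmodule ⊔ F.cartan
  have hN : N.toSubmodule ≤ V := le_sup_left.trans le_sup_left
  have hN' : N'.toSubmodule ≤ V := le_sup_right.trans le_sup_left
  have hc : F.cartan ≤ V := le_sup_right
  have heN : ∀ i, F.e i ∈ N := fun i =>
    Submodule.mem_iSup_of_mem (p := gradedSpan F.e F.wtE) (F.wtE i) (mem_gradedSpan i)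
  have hfN : ∀ i, F.f i ∈ N' := fun i =>
    Submodule.mem_iSup_of_mem (p := gradedSpan F.f F.wtF) (F.wtF i) (mem_gradedSpan i)
  have hlie : ∀ a : 𝔤, (∀ y ∈ N, ⁅a, y⁆ ∈ V) → (∀ y ∈ N', ⁅a, y⁆ ∈ V) →
      (∀ y ∈ F.cartan, ⁅a, y⁆ ∈ V) → ∀ y ∈ V, ⁅a, y⁆ ∈ V := by
    intro a h1 h2 h3
    have : V ≤ V.comap (LieAlgebra.ad ℂ 𝔤 a : Module.End ℂ 𝔤) :=
      sup_le (sup_le h1 h2) h3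
    exact this
  have C := F.chevalleyRel
  have hef : ∀ i j, ⁅F.e i, F.f j⁆ ∈ F.cartan := by
    intro i j
    by_cases hij : i = j
    · rw [hij, C.ef_self]
      exact F.coroot_mem_cartan j
    · rw [C.ef_ne i j hij]
      exact F.cartan.zero_mem
  have hcc : ∀ c ∈ F.cartan, ∀ d ∈ F.cartan, ⁅c, d⁆ = 0 := by
    intro c hc d hd
    rw [(F.mem_E.1 (F.cartan_le_E hd)) ⟨c, hc⟩, show F.weight (0 : ℤ × ℤ).1 (0 : ℤ × ℤ).2 = 0 from
      F.weight_zero, LinearMap.zero_apply, zero_smul]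
  have he : ∀ i, ∀ y ∈ V, ⁅F.e i, y⁆ ∈ V := by
    refine fun i => hlie _ (fun y hy => hN (N.lie_mem (heN i) hy)) (fun y hy => ?_) fun c hc => ?_
    · exact (sup_le hN' hc : _ ≤ V) (F.lie_mem_sup_cartan F.f_mem (hef i) hy)
    · rw [← lie_skew]
      exact V.neg_mem (hN (F.lie_cartan_mem F.e_mem hc (heN i)))
  have hf : ∀ i, ∀ y ∈ V, ⁅F.f i, y⁆ ∈ V := by
    refine fun i => hlie _ (fun y hy => ?_) (fun y hy => hN' (N'.lie_mem (hfN i) hy)) fun c hc => ?_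
    · refine (sup_le hN hc : _ ≤ V) (F.lie_mem_sup_cartan F.e_mem (fun j => ?_) hy)
      rw [← lie_skew]
      exact F.cartan.neg_mem (hef j i)
    · rw [← lie_skew]
      exact V.neg_mem (hN' (F.lie_cartan_mem F.f_mem hc (hfN i)))
  have hh : ∀ i, ∀ y ∈ V, ⁅F.h i, y⁆ ∈ V := by
    refine fun i => hlie _ (fun y hy => hN (F.lie_cartan_mem F.e_mem (F.coroot_mem_cartan i) hy))
      (fun y hy => hN' (F.lie_cartan_mem F.f_mem (F.coroot_mem_cartan i) hy)) fun c hc => ?_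
    rw [hcc _ (F.coroot_mem_cartan i) _ hc]
    exact V.zero_mem
  have hall : ∀ y : FreeGen F.I, F.π (universalMk F.A y) ∈ V ∧
      ∀ z ∈ V, ⁅F.π (universalMk F.A y), z⁆ ∈ V := by
    intro y
    induction y using freeLie_induction with
    | of x =>
      cases x with
      | H i => exact ⟨hc (F.coroot_mem_cartan i), hh i⟩
      | E i => exact ⟨hN (heN i), he i⟩
      | F i => exact ⟨hN' (hfN i), hf i⟩
    | zero =>
      rw [map_zero, map_zero]
      exact ⟨V.zero_mem, fun z _ => by rw [zero_lie]; exact V.zero_mem⟩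
    | add a b ha hb =>
      rw [map_add, map_add]
      exact ⟨V.add_mem ha.1 hb.1, fun z hz => by
        rw [add_lie]; exact V.add_mem (ha.2 z hz) (hb.2 z hz)⟩
    | smul c a ha =>
      rw [map_smul, map_smul]
      exact ⟨V.smul_mem c ha.1, fun z hz => by
        rw [smul_lie]; exact V.smul_mem c (ha.2 z hz)⟩
    | lie a b ha hb =>
      rw [LieHom.map_lie, LieHom.map_lie]
      exact ⟨ha.2 _ hb.1, fun z hz => by
        rw [lie_lie]; exact V.sub_mem (ha.2 _ (hb.2 z hz)) (hb.2 _ (ha.2 z hz))⟩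
  rw [eq_top_iff, ← F.isCompl.sup_eq_top]
  refine sup_le ?_ ?_
  · rintro _ ⟨y, rfl⟩
    obtain ⟨y, rfl⟩ := LieSubmodule.Quotient.surjective_mk' (relIdeal F.A) y
    exact (hall y).1
  · refine le_trans ?_ hc
    rw [F.cartan_eq]
    exact le_sup_right

/-- The homogeneous pieces of the triangular decomposition. -/
noncomputable def piece (γ : ℤ × ℤ) : Submodule ℂ 𝔤 :=
  gradedSpan F.e F.wtE γ ⊔ gradedSpan F.f F.wtF γ ⊔ ⨆ _ : γ = 0, F.cartan

theorem piece_eq_E (γ : ℤ × ℤ) : F.piece γ = F.E γ := by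
  refine eq_of_iSupIndep (P := F.piece) F.iSupIndep_E (fun γ => ?_) ?_
  · refine sup_le (sup_le (F.gradedSpan_le_E F.e_mem γ) (F.gradedSpan_le_E F.f_mem γ))
      (iSup_le fun h => ?_)
    rw [h]
    exact F.cartan_le_E
  · refine le_top.trans ?_
    rw [← F.triangular]
    refine sup_le (sup_le ?_ ?_) ?_
    · exact iSup_mono fun γ => le_sup_left.trans le_sup_left
    · exact iSup_mono fun γ => le_sup_right.trans le_sup_left
    · refine le_iSup_of_le 0 (le_sup_of_le_right ?_)
      rw [iSup_pos rfl]

theorem finiteDimensional_E (γ : ℤ × ℤ) : FiniteDimensional ℂ (F.E γ) := by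
  have hfin : ∀ n : ℤ, {i | F.ht i + 2 ≤ n}.Finite := fun n =>
    (F.finite_ht_le (n - 2)).subset fun i hi => by
      have : F.ht i + 2 ≤ n := hi
      change F.ht i ≤ n - 2
      omega
  -- The coefficient `2` makes `φ` positive on the real root `(1, -1)` as well: on a simple root it
  -- is `ht i + 2 ≥ 1`.
  let φ : ℤ × ℤ →+ ℤ := AddMonoidHom.snd ℤ ℤ + 2 • AddMonoidHom.fst ℤ ℤ
  have hφE : ∀ i, φ (F.wtE i) = F.ht i + 2 := fun i => by simp [φ, wtE]
  have hφF : ∀ i, (-φ) (F.wtF i) = F.ht i + 2 := fun i => by simp [φ, wtF]; ring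
  have h1 := finiteDimensional_gradedSpan F.e F.wtE φ
    (fun i => by have := F.neg_one_le_ht i; rw [hφE]; omega)
    (fun n => by simp only [hφE]; exact hfin n) γ
  have h2 := finiteDimensional_gradedSpan F.f F.wtF (-φ)
    (fun i => by have := F.neg_one_le_ht i; rw [hφF]; omega)
    (fun n => by simp only [hφF]; exact hfin n) γ
  have h3 : FiniteDimensional ℂ (⨆ _ : γ = 0, F.cartan : Submodule ℂ 𝔤) := by
    by_cases h : γ = 0
    · rw [iSup_pos h]
      exact F.finite_cartan
    · rw [iSup_neg h]
      infer_instance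
  rw [← piece_eq_E, piece]
  infer_instance

theorem E_eq_of_pos {γ : ℤ × ℤ} (hγ : 0 < γ.1) : F.E γ = gradedSpan F.e F.wtE γ := by
  have h : gradedSpan F.f F.wtF γ = ⊥ := by
    have := gradedSpan_le (g := F.f) (wt := F.wtF)
      (P := fun γ : ℤ × ℤ => ⨆ _ : γ.1 < 0, (⊤ : Submodule ℂ 𝔤)) (fun i => ?_) ?_ γ
    · rwa [iSup_neg (by omega), le_bot_iff] at this
    · exact Submodule.mem_iSup_of_mem (by simp [wtF]) Submodule.mem_top
    · intro γ δ a b ha hb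
      by_cases hγ : γ.1 < 0
      · by_cases hδ : δ.1 < 0
        · exact Submodule.mem_iSup_of_mem (by rw [Prod.fst_add]; omega) Submodule.mem_top
        · rw [iSup_neg hδ, Submodule.mem_bot] at hb
          rw [hb, lie_zero]
          exact Submodule.zero_mem _
      · rw [iSup_neg hγ, Submodule.mem_bot] at ha
        rw [ha, zero_lie]
        exact Submodule.zero_mem _
  have h0 : γ ≠ 0 := by
    rintro rfl
    exact lt_irrefl _ hγ
  rw [← piece_eq_E, piece, h, iSup_neg h0, sup_bot_eq, sup_bot_eq]

end FrickeStructure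

end FrickeLie

namespace FrickeLie

open Module

namespace FrickeStructure

variable {𝔤 : Type u} [LieRing 𝔤] [LieAlgebra ℂ 𝔤] (F : FrickeStructure.{u, v} 𝔤)

/-! ### The free part of the positive subalgebra -/

/-- The number of elements of the string `(ad e_r)^k e_i`. -/
noncomputable def t (i : F.I) : ℕ := (F.ht i).toNat

theorem coe_t {i : F.I} (hi : i ≠ F.r) : (F.t i : ℤ) = F.ht i := by
  have := F.one_le_ht hi
  rw [t]
  omega

theorem one_le_t {i : F.I} (hi : i ≠ F.r) : 1 ≤ F.t i := by
  have := F.one_le_ht hi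
  rw [t]
  omega

theorem A_r_eq_t {i : F.I} (hi : i ≠ F.r) : F.A F.r i = 1 - (F.t i : ℝ) := by
  rw [F.A_r_eq, ← F.coe_t hi, Int.cast_natCast]

/-- The degree of a letter. -/
noncomputable def wtL (x : Letter F.r F.t) : ℤ × ℤ := (x.1.2 + 1, F.t x.1.1 - x.1.2)

/-- The vectors `(ad e_r)^k b_i`. -/
noncomputable def letterVec (b : F.I → 𝔤) (x : Letter F.r F.t) : 𝔤 :=
  (LieAlgebra.ad ℂ 𝔤 (F.e F.r) ^ x.1.2) (b x.1.1)

/-- Families of vectors that can replace the `e_i` of imaginary simple roots. -/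
structure Adapted (b : F.I → 𝔤) : Prop where
  mem : ∀ i, i ≠ F.r → b i ∈ F.E (1, F.ht i)
  le_span : ∀ n : ℤ, 1 ≤ n → F.E (1, n) ≤ Submodule.span ℂ {y | ∃ i, F.ht i = n ∧ b i = y}

/-- A bracket of two or more of the `e_i` has first coordinate at least `2`. -/
theorem E_one_le (n : ℤ) : F.E (1, n) ≤ Submodule.span ℂ {y | ∃ i, F.ht i = n ∧ F.e i = y} := by
  rw [F.E_eq_of_pos (by simp)]
  have := gradedSpan_le (g := F.e) (wt := F.wtE) (P := fun γ : ℤ × ℤ => ⨆ _ : 1 ≤ γ.1,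
    ⨅ _ : γ.1 = 1, Submodule.span ℂ {y | ∃ i, F.ht i = γ.2 ∧ F.e i = y}) (fun i => ?_) ?_ (1, n)
  · rwa [iSup_pos (by simp), iInf_pos (by simp)] at this
  · rw [iSup_pos (by simp [wtE]), iInf_pos (by simp [wtE])]
    exact Submodule.subset_span ⟨i, rfl, rfl⟩
  · intro γ δ a b ha hb
    by_cases hγ : 1 ≤ γ.1
    · by_cases hδ : 1 ≤ δ.1
      · rw [iSup_pos (by rw [Prod.fst_add]; omega), iInf_neg (by rw [Prod.fst_add]; omega)]
        trivial
      · rw [iSup_neg hδ, Submodule.mem_bot] at hb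
        rw [hb, lie_zero]
        exact Submodule.zero_mem _
    · rw [iSup_neg hγ, Submodule.mem_bot] at ha
      rw [ha, zero_lie]
      exact Submodule.zero_mem _

theorem adapted_e : F.Adapted F.e where
  mem i _ := F.e_mem_E i
  le_span n _ := F.E_one_le n

theorem ne_r_of_one_le_ht {i : F.I} (h : 1 ≤ F.ht i) : i ≠ F.r := by
  rintro rfl
  rw [ht_r] at h
  omega

/-- The Serre exponent `1 - a_{ri}` equals `ht i`, so it is constant on the whole root space. Hence
the relation carries over from the `e_i` to any other spanning family. -/
theorem pow_ad_e_r_eq_zero {n : ℕ} (hn : 1 ≤ n) {y : 𝔤} (hy : y ∈ F.E (1, n)) :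
    (LieAlgebra.ad ℂ 𝔤 (F.e F.r) ^ n) y = 0 := by
  have : F.E (1, n) ≤ LinearMap.ker (LieAlgebra.ad ℂ 𝔤 (F.e F.r) ^ n) := by
    refine (F.E_one_le n).trans (Submodule.span_le.2 ?_)
    rintro _ ⟨i, hi, rfl⟩
    have hir : i ≠ F.r := F.ne_r_of_one_le_ht (by omega)
    have ht := F.coe_t hir
    obtain ⟨n, rfl⟩ : ∃ k, n = k + 1 := ⟨n - 1, by omega⟩
    have h1 := universalMk_relator (IsRelator.serre_e (A := F.A) F.r i n F.A_r_r_pos hir.symm (by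
      rw [F.A_r_eq, hi]
      push_cast
      ring))
    rw [map_pow_ad] at h1
    have h2 := congrArg F.π h1
    rw [map_pow_ad, map_zero] at h2
    exact h2
  exact this hy

variable {F}

theorem Adapted.letterVec_mem {b : F.I → 𝔤} (hb : F.Adapted b) (x : Letter F.r F.t) :
    F.letterVec b x ∈ F.E (F.wtL x) := by
  obtain ⟨⟨i, k⟩, hi, hk⟩ := x
  change (LieAlgebra.ad ℂ 𝔤 (F.e F.r) ^ k) (b i) ∈ F.E ((k : ℤ) + 1, (F.t i : ℤ) - k)
  replace hi : i ≠ F.r := hi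
  clear hk
  induction k with
  | zero =>
    have := hb.mem i hi
    rw [← F.coe_t hi] at this
    simpa using this
  | succ k ih =>
    rw [pow_succ', Module.End.mul_apply]
    have h1 := F.lie_mem_E (F.e_mem_E F.r) ih
    rw [F.ht_r] at h1
    have h2 : ((1 : ℤ), (-1 : ℤ)) + ((k : ℤ) + 1, (F.t i : ℤ) - k) =
        (((k + 1 : ℕ) : ℤ) + 1, (F.t i : ℤ) - (k + 1 : ℕ)) := by
      rw [Prod.mk_add_mk, Prod.mk.injEq]
      push_cast
      constructor <;> ring
    rw [← h2]
    exact h1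

theorem Adapted.lie_e_r_letterVec {b : F.I → 𝔤} (hb : F.Adapted b) (x : Letter F.r F.t) :
    ⁅F.e F.r, F.letterVec b x⁆ = 0 ∨
      ∃ h : x.1.2 + 1 < F.t x.1.1, ⁅F.e F.r, F.letterVec b x⁆ =
        F.letterVec b ⟨(x.1.1, x.1.2 + 1), x.2.1, h⟩ := by
  have h1 : ⁅F.e F.r, F.letterVec b x⁆ =
      (LieAlgebra.ad ℂ 𝔤 (F.e F.r) ^ (x.1.2 + 1)) (b x.1.1) := by
    rw [pow_succ', Module.End.mul_apply]
    rfl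
  have hlt := x.2.2
  rcases lt_or_ge (x.1.2 + 1) (F.t x.1.1) with h | h
  · exact Or.inr ⟨h, h1⟩
  · left
    rw [h1, show x.1.2 + 1 = F.t x.1.1 by omega]
    refine F.pow_ad_e_r_eq_zero (F.one_le_t x.2.1) ?_
    rw [F.coe_t x.2.1]
    exact hb.mem _ x.2.1

theorem Adapted.lie_e_r_mem {b : F.I → 𝔤} (hb : F.Adapted b) (x : Letter F.r F.t) :
    ⁅F.e F.r, F.letterVec b x⁆ ∈ gradedSpan (F.letterVec b) F.wtL ((1, -1) + F.wtL x) := by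
  rcases hb.lie_e_r_letterVec x with h | ⟨h, h'⟩
  · rw [h]
    exact Submodule.zero_mem _
  · rw [h']
    convert mem_gradedSpan (g := F.letterVec b) (wt := F.wtL) _ using 2
    ext
    · simp only [wtL, Prod.fst_add]
      push_cast
      ring
    · simp only [wtL, Prod.snd_add]
      push_cast
      ring

theorem Adapted.mem_span {b : F.I → 𝔤} (hb : F.Adapted b) {i : F.I} (hi : i ≠ F.r) {y : 𝔤}
    (hy : y ∈ F.E (1, F.ht i)) :
    y ∈ Submodule.span ℂ {y | ∃ j, j ≠ F.r ∧ F.t j = F.t i ∧ b j = y} := by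
  refine Submodule.span_mono ?_ (hb.le_span _ (F.one_le_ht hi) hy)
  rintro _ ⟨j, hj, rfl⟩
  exact ⟨j, F.ne_r_of_one_le_ht (hj ▸ F.one_le_ht hi), by rw [t, t, hj], rfl⟩

theorem Adapted.letterVec_mem_gradedSpan {b b' : F.I → 𝔤} (hb : F.Adapted b) (hb' : F.Adapted b')
    (x : Letter F.r F.t) : F.letterVec b' x ∈ gradedSpan (F.letterVec b) F.wtL (F.wtL x) := by
  have h : Submodule.span ℂ {y | ∃ j, j ≠ F.r ∧ F.t j = F.t x.1.1 ∧ b j = y} ≤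
      (gradedSpan (F.letterVec b) F.wtL (F.wtL x)).comap
        (LieAlgebra.ad ℂ 𝔤 (F.e F.r) ^ x.1.2) := by
    refine Submodule.span_le.2 ?_
    rintro _ ⟨j, hj, hjt, rfl⟩
    have h1 := mem_gradedSpan (g := F.letterVec b) (wt := F.wtL)
      ⟨(j, x.1.2), hj, hjt ▸ x.2.2⟩
    have h2 : F.wtL ⟨(j, x.1.2), hj, hjt ▸ x.2.2⟩ = F.wtL x := by
      simp only [wtL, hjt]
    rw [h2] at h1
    exact h1
  exact h (hb.mem_span x.2.1 (hb'.mem _ x.2.1))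

theorem Adapted.gradedSpan_eq {b b' : F.I → 𝔤} (hb : F.Adapted b) (hb' : F.Adapted b')
    (γ : ℤ × ℤ) : gradedSpan (F.letterVec b) F.wtL γ = gradedSpan (F.letterVec b') F.wtL γ :=
  le_antisymm
    (gradedSpan_le (hb'.letterVec_mem_gradedSpan hb) (fun _ _ _ _ => lie_mem_gradedSpan) γ)
    (gradedSpan_le (hb.letterVec_mem_gradedSpan hb') (fun _ _ _ _ => lie_mem_gradedSpan) γ)

/-- By the Serre relations `ad e_r` moves each letter to the next one in its string or to zero. So
the subalgebra of the letters plus `ℂ e_r` is closed under brackets, and it contains every `e_i`. -/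
theorem Adapted.E_eq {b : F.I → 𝔤} (hb : F.Adapted b) {γ : ℤ × ℤ} (hγ : 0 < γ.1) :
    F.E γ = adjoinPiece (F.letterVec b) F.wtL (F.e F.r) (1, -1) γ := by
  apply le_antisymm
  · rw [F.E_eq_of_pos hγ]
    refine gradedSpan_le (P := adjoinPiece (F.letterVec b) F.wtL (F.e F.r) (1, -1)) (fun i => ?_)
      (fun _ _ _ _ => lie_mem_adjoinPiece hb.lie_e_r_mem) γ
    by_cases hi : i = F.r
    · rw [hi, wtE, ht_r]
      exact mem_adjoinPiece_self
    · refine gradedSpan_le_adjoinPiece _ ?_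
      have h := hb.letterVec_mem_gradedSpan F.adapted_e ⟨(i, 0), hi, F.one_le_t hi⟩
      simpa [letterVec, wtL, wtE, F.coe_t hi] using h
  · refine sup_le (F.gradedSpan_le_E hb.letterVec_mem γ) (iSup_le fun h => ?_)
    rw [Submodule.span_le, Set.singleton_subset_iff, h, ← F.ht_r]
    exact F.e_mem_E F.r

theorem letterLift_e_of (x : Letter F.r F.t) :
    letterLift F.e F.r F.t (FreeLieAlgebra.of ℂ x) = F.letterVec F.e x :=
  letterLift_of _ _ _ _

variable (F)

/-- In `𝔤(A)` the letters are free by `letterLift_injective`; what has to be excluded is a central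
element among their brackets. If `j` is imaginary, `h_j` acts on degree `(m, n)` with `m, n > 0` by
`-q_r (n + m ht j) / q_j < 0`, so no nonzero combination commutes with it. Without imaginary `j`
there are no letters. -/
theorem letterLift_e_injective : Function.Injective (letterLift F.e F.r F.t) := by
  rw [injective_iff_map_eq_zero]
  intro y hy
  by_cases hex : ∃ j, j ≠ F.r
  swap
  · push Not at hex
    clear hy
    induction y using freeLie_induction with
    | of x => exact absurd (hex x.1.1) x.2.1
    | zero => rfl
    | add a b ha hb => rw [ha, hb, add_zero]
    | smul c a ha => rw [ha, smul_zero]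
    | lie a b ha hb => rw [ha, zero_lie]
  obtain ⟨j, hj⟩ := hex
  set E' : F.I → UniversalBKM F.A := fun i => universalMk F.A (genE i)
  set z := letterLift E' F.r F.t y with hz
  have hπ : F.π z = 0 := by
    rw [hz, letterLift_map]
    exact hy
  have hzero : z = 0 := by
    let T : Module.End ℂ (UniversalBKM F.A) :=
      LieAlgebra.ad ℂ (UniversalBKM F.A) (universalMk F.A (genH j))
    let val : ℤ × ℤ → ℂ := fun γ => ((-F.q F.r * (γ.2 + γ.1 * F.ht j) / F.q j : ℝ) : ℂ)
    have hq := F.q_pos F.r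
    have hqj := F.q_pos j
    have hA : ∀ i, F.A j i = -F.q F.r * (F.ht i + F.ht j) / F.q j := by
      intro i
      rw [eq_div_iff hqj.ne', mul_comm, q_mul_A]
      ring
    have hT : ∀ y, T y = ⁅universalMk F.A (genH j), y⁆ := fun _ => rfl
    have hgr : ∀ γ : ℤ × ℤ, gradedSpan (fun x => letterLift E' F.r F.t (FreeLieAlgebra.of ℂ x))
        F.wtL γ ≤ ⨆ _ : 0 < γ.1 ∧ 0 < γ.2, T.eigenspace (val γ) := by
      refine gradedSpan_le (P := fun γ : ℤ × ℤ => ⨆ _ : 0 < γ.1 ∧ 0 < γ.2, T.eigenspace (val γ))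
        (fun x => ?_) ?_
      · have hx := x.2.2
        rw [iSup_pos (by simp only [wtL]; omega), Module.End.mem_eigenspace_iff, letterLift_of, hT]
        rw [ChevalleyRel.lie_h_pow_ad ((chevalleyRel_universalMk F.A).he j F.r)
          ((chevalleyRel_universalMk F.A).he j x.1.1)]
        congr 1
        rw [hA, hA, F.ht_r, ← F.coe_t x.2.1]
        simp only [val, wtL]
        push_cast
        ring
      · intro γ δ a b ha hb
        by_cases hγ : 0 < γ.1 ∧ 0 < γ.2
        · by_cases hδ : 0 < δ.1 ∧ 0 < δ.2
          · rw [iSup_pos hγ, Module.End.mem_eigenspace_iff, hT] at ha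
            rw [iSup_pos hδ, Module.End.mem_eigenspace_iff, hT] at hb
            rw [iSup_pos (by rw [Prod.fst_add, Prod.snd_add]; omega), Module.End.mem_eigenspace_iff,
              hT, leibniz_lie, ha, hb, smul_lie, lie_smul, ← add_smul]
            congr 1
            simp only [val, Prod.fst_add, Prod.snd_add]
            push_cast
            ring
          · rw [iSup_neg hδ, Submodule.mem_bot] at hb
            rw [hb, lie_zero]
            exact Submodule.zero_mem _
        · rw [iSup_neg hγ, Submodule.mem_bot] at ha
          rw [ha, zero_lie]
          exact Submodule.zero_mem _
    refine eq_zero_of_mem_iSup_eigenspace T ?_ ?_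
    · have hy' : y ∈ (⊤ : Submodule ℂ (FreeLieAlgebra ℂ (Letter F.r F.t))) := trivial
      rw [← iSup_gradedSpan_freeLie F.wtL] at hy'
      have h1 := Submodule.mem_map_of_mem
        (f := (letterLift E' F.r F.t : _ →ₗ[ℂ] UniversalBKM F.A)) hy'
      rw [Submodule.map_iSup] at h1
      refine SetLike.le_def.1 (iSup_le fun γ => ?_) h1
      rw [map_gradedSpan]
      refine (hgr γ).trans (iSup_le fun hγ => ?_)
      refine le_iSup (fun c : {c : ℂ // c ≠ 0} => T.eigenspace c) ⟨val γ, ?_⟩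
      have h2 : (1 : ℝ) ≤ F.ht j := by exact_mod_cast F.one_le_ht hj
      have h3 : (0 : ℝ) < γ.1 := by exact_mod_cast hγ.1
      have h4 : (0 : ℝ) < γ.2 := by exact_mod_cast hγ.2
      have h5 : 0 < F.q F.r * (γ.2 + γ.1 * F.ht j) / F.q j := by positivity
      simp only [val]
      rw [Complex.ofReal_ne_zero]
      refine ne_of_lt ?_
      rw [neg_mul, neg_div]
      linarith
    · rw [hT, ← lie_skew, F.ker_central z hπ, neg_zero]
  refine letterLift_injective F.isGeneralizedCartanMatrix F.A_r_r_pos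
    (fun i => (F.real_iff i).1) (fun i hi => F.A_r_eq_t hi) (fun i hi => F.one_le_t hi)
    (fun i j hi hj => F.A_ne_zero hi hj) ?_
  rw [← universalMk_eq_zero, letterLift_map]
  exact hzero

end FrickeStructure

end FrickeLie

namespace FrickeLie

open Module

/-! ### Traces and generalized eigenspaces -/

section Trace

variable {V : Type*} [AddCommGroup V] [Module ℂ V]

/-- From `(T - μν)⁅x, y⁆ = ⁅(T - μ)x, T y⁆ + μ ⁅x, (T - ν)y⁆`, each application of `T - μν` uses up
one of the `i + j` available nilpotency steps. -/
theorem lie_mem_maxGenEigenspace {G : Type*} [LieRing G] [LieAlgebra ℂ G] {T : Module.End ℂ G}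
    (hT : ∀ x y, T ⁅x, y⁆ = ⁅T x, T y⁆) {μ ν : ℂ} {x y : G} (hx : x ∈ T.maxGenEigenspace μ)
    (hy : y ∈ T.maxGenEigenspace ν) : ⁅x, y⁆ ∈ T.maxGenEigenspace (μ * ν) := by
  rw [Module.End.mem_maxGenEigenspace] at *
  obtain ⟨i, hi⟩ := hx
  obtain ⟨j, hj⟩ := hy
  have key : ∀ (k i j : ℕ) (x y : G), i + j ≤ k → ((T - μ • 1) ^ i : Module.End ℂ G) x = 0 →
      ((T - ν • 1) ^ j : Module.End ℂ G) y = 0 →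
      ((T - (μ * ν) • 1) ^ k : Module.End ℂ G) ⁅x, y⁆ = 0 := by
    intro k
    induction k with
    | zero =>
      intro i j x y hk hx hy
      obtain rfl : i = 0 := by omega
      have : x = 0 := hx
      rw [this, zero_lie, map_zero]
    | succ k ih =>
      intro i j x y hk hx hy
      rcases i with _ | i
      · have : x = 0 := hx
        rw [this, zero_lie, map_zero]
      rcases j with _ | j
      · have : y = 0 := hy
        rw [this, lie_zero, map_zero]
      rw [pow_succ, Module.End.mul_apply] at hx hy ⊢
      have hcomm : Commute ((T - ν • 1) ^ (j + 1)) T :=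
        Commute.pow_left (Commute.sub_left rfl ((Commute.one_left T).smul_left ν)) _
      have hTy : ((T - ν • 1) ^ (j + 1)) (T y) = 0 := by
        rw [← Module.End.mul_apply, hcomm.eq, Module.End.mul_apply, pow_succ,
          Module.End.mul_apply, hy, map_zero]
      have hx' : ((T - μ • 1) ^ (i + 1)) x = 0 := by
        rw [pow_succ, Module.End.mul_apply, hx]
      have hsplit : (T - (μ * ν) • 1) ⁅x, y⁆ =
          ⁅(T - μ • 1) x, T y⁆ + μ • ⁅x, (T - ν • 1) y⁆ := by
        simp only [LinearMap.sub_apply, LinearMap.smul_apply, Module.End.one_apply, hT, sub_lie,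
          lie_sub, smul_lie, lie_smul, smul_sub, mul_smul]
        abel
      rw [hsplit, map_add, map_smul, ih i (j + 1) _ _ (by omega) hx hTy,
        ih (i + 1) j _ _ (by omega) hx' hy, smul_zero, add_zero]
  exact ⟨i + j, key _ i j x y le_rfl hi hj⟩

variable [FiniteDimensional ℂ V] (T : Module.End ℂ V)

theorem isInternal_maxGenEigenspace : DirectSum.IsInternal T.maxGenEigenspace := by
  rw [DirectSum.isInternal_submodule_iff_iSupIndep_and_iSup_eq_top]
  exact ⟨T.independent_maxGenEigenspace, T.iSup_maxGenEigenspace_eq_top⟩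

theorem finite_maxGenEigenspace_ne_bot : {μ | T.maxGenEigenspace μ ≠ ⊥}.Finite :=
  WellFoundedGT.finite_ne_bot_of_iSupIndep T.independent_maxGenEigenspace

/-- On a generalized eigenspace `T - μ` is nilpotent, so each factor `T` contributes `μ` to the
trace. -/
theorem trace_pow_eq (a : ℕ) : LinearMap.trace ℂ V (T ^ a) =
    ∑ᶠ μ, (finrank ℂ (T.maxGenEigenspace μ) : ℂ) * μ ^ a := by
  have hmaps := fun μ => Module.End.mapsTo_maxGenEigenspace_of_comm (Commute.refl T) μ
  have hmaps' := fun μ =>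
    Module.End.mapsTo_maxGenEigenspace_of_comm ((Commute.refl T).pow_right a) μ
  have hres : ∀ μ, LinearMap.trace ℂ _ ((T ^ a).restrict (hmaps' μ)) =
      (finrank ℂ (T.maxGenEigenspace μ) : ℂ) * μ ^ a := by
    intro μ
    have h1 := Module.End.isNilpotent_restrict_maxGenEigenspace_sub_algebraMap T μ
    have h2 : ∀ n : ℕ, LinearMap.trace ℂ _ ((T.restrict (hmaps μ)) ^ n) =
        (finrank ℂ (T.maxGenEigenspace μ) : ℂ) * μ ^ n := by
      intro n
      induction n with
      | zero => rw [pow_zero, pow_zero, LinearMap.trace_one, mul_one]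
      | succ n ih =>
        rw [pow_succ, Module.End.mul_eq_comp,
          LinearMap.trace_comp_eq_mul_of_commute_of_isNilpotent μ ((Commute.refl _).pow_left n),
          ih, pow_succ]
        · ring
        · exact h1
    exact (congrArg _ (Module.End.pow_restrict a (hmaps μ))).symm.trans (h2 a)
  rw [LinearMap.trace_eq_sum_trace_restrict' (isInternal_maxGenEigenspace T)
    (finite_maxGenEigenspace_ne_bot T) hmaps', finsum_eq_sum_of_support_subset]
  · exact Finset.sum_congr rfl fun μ _ => hres μ
  · intro μ hμ
    rw [Set.Finite.coe_toFinset]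
    intro hbot
    rw [Function.mem_support, hbot, finrank_bot, Nat.cast_zero, zero_mul] at hμ
    exact hμ rfl

theorem trace_pow_eq_of_iSup_eq_top {P : ℂ → Submodule ℂ V} (hP : ∀ μ, P μ ≤ T.maxGenEigenspace μ)
    (htop : ⨆ μ, P μ = ⊤) (a : ℕ) :
    LinearMap.trace ℂ V (T ^ a) = ∑ᶠ μ, (finrank ℂ (P μ) : ℂ) * μ ^ a := by
  rw [trace_pow_eq]
  refine finsum_congr fun μ => ?_
  rw [eq_of_iSupIndep T.independent_maxGenEigenspace hP (htop ▸ le_top)]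

/-- The index set `ι` is kept so that generalized eigenvectors can replace the `e_i` index by index.
-/
theorem exists_basis_maxGenEigenspace {ι : Type*} [Finite ι] (b : Basis ι ℂ V) :
    ∃ (b' : Basis ι ℂ V) (μ : ι → ℂ), (∀ i, b' i ∈ T.maxGenEigenspace (μ i)) ∧
      LinearMap.trace ℂ V T = ∑ᶠ i, μ i := by
  classical
  have : Fintype ι := Fintype.ofFinite ι
  let c := (isInternal_maxGenEigenspace T).collectedBasis
    fun μ => Module.finBasis ℂ (T.maxGenEigenspace μ)
  let e := c.indexEquiv b
  have : Finite (Σ μ : ℂ, Fin (finrank ℂ (T.maxGenEigenspace μ))) := Finite.of_equiv _ e.symm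
  have : Fintype (Σ μ : ℂ, Fin (finrank ℂ (T.maxGenEigenspace μ))) := Fintype.ofFinite _
  refine ⟨c.reindex e, fun i => (e.symm i).1, fun i => ?_, ?_⟩
  · rw [Basis.reindex_apply]
    exact (isInternal_maxGenEigenspace T).collectedBasis_mem _ _
  · have h := trace_pow_eq T 1
    rw [pow_one] at h
    rw [h]
    have h1 : ∑ᶠ i, (e.symm i).1 = ∑ᶠ x : (Σ μ : ℂ, Fin (finrank ℂ (T.maxGenEigenspace μ))), x.1 :=
      finsum_comp_equiv e.symm (f := fun x => x.1)
    rw [h1, finsum_eq_sum_of_fintype (fun x : Σ μ : ℂ, Fin (finrank ℂ (T.maxGenEigenspace μ)) => x.1), ← Finset.sum_fiberwise_of_maps_to (s := Finset.univ)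
      (t := (finite_maxGenEigenspace_ne_bot T).toFinset) (g := fun x => x.1)]
    · rw [finsum_eq_sum_of_support_subset (s := (finite_maxGenEigenspace_ne_bot T).toFinset)]
      · refine Finset.sum_congr rfl fun μ _ => ?_
        rw [Finset.sum_congr rfl (g := fun _ => μ) fun x hx => (Finset.mem_filter.1 hx).2,
          Finset.sum_const, pow_one, nsmul_eq_mul]
        congr 2
        rw [← Fintype.card_subtype]
        rw [Fintype.card_congr (Equiv.sigmaSubtype μ), Fintype.card_fin]
      · intro μ hμ
        rw [Set.Finite.coe_toFinset]
        intro hbot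
        rw [Function.mem_support, hbot, finrank_bot, Nat.cast_zero, zero_mul] at hμ
        exact hμ rfl
    · intro x _
      rw [Set.Finite.mem_toFinset]
      intro hbot
      have h0 : finrank ℂ (T.maxGenEigenspace x.1) = 0 := by rw [hbot, finrank_bot]
      have := x.2.2
      omega

end Trace

end FrickeLie

namespace FrickeLie

open Module

/-! ### Coarsening the grading -/

section Coarsen

variable {G : Type*} [LieRing G] [LieAlgebra ℂ G] {X Γ Γ' : Type*} [AddCommMonoid Γ]
  [AddCommMonoid Γ'] {g : X → G} {wt : X → Γ}

theorem gradedSpan_comp (φ : Γ →+ Γ') (γ' : Γ') : gradedSpan g (fun x => φ (wt x)) γ' =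
    ⨆ γ : {γ // φ γ = γ'}, gradedSpan g wt γ := by
  apply le_antisymm
  · have key : ∀ γ' a, IsBracket g (fun x => φ (wt x)) γ' a → ∃ γ, φ γ = γ' ∧ IsBracket g wt γ a := by
      intro γ' a h
      induction h with
      | of x => exact ⟨wt x, rfl, .of x⟩
      | lie _ _ ha hb =>
        obtain ⟨γ, rfl, ha⟩ := ha
        obtain ⟨δ, rfl, hb⟩ := hb
        exact ⟨γ + δ, map_add φ γ δ, .lie ha hb⟩
    refine Submodule.span_le.2 fun a ha => ?_
    obtain ⟨γ, hγ, h⟩ := key _ _ ha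
    exact Submodule.mem_iSup_of_mem ⟨γ, hγ⟩ (Submodule.subset_span h)
  · refine iSup_le ?_
    rintro ⟨γ, rfl⟩
    exact gradedSpan_le (P := fun γ => gradedSpan g (fun x => φ (wt x)) (φ γ))
      (fun x => mem_gradedSpan (g := g) (wt := fun x => φ (wt x)) x)
      (fun γ δ a b ha hb => by
        rw [map_add]
        exact lie_mem_gradedSpan ha hb) γ

theorem gradedSpan_le_comp (φ : Γ →+ Γ') (γ : Γ) :
    gradedSpan g wt γ ≤ gradedSpan g (fun x => φ (wt x)) (φ γ) := by
  rw [gradedSpan_comp]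
  exact le_iSup (fun γ : {γ' // φ γ' = φ γ} => gradedSpan g wt γ) ⟨γ, rfl⟩

theorem finrank_gradedSpan_of_injOn {y : X → G} {γ : Γ}
    (h : ∀ a ∈ gradedSpan (FreeLieAlgebra.of ℂ) wt γ, FreeLieAlgebra.lift ℂ y a = 0 → a = 0) :
    finrank ℂ (gradedSpan y wt γ) = finrank ℂ (gradedSpan (FreeLieAlgebra.of ℂ) wt γ) := by
  have h2 := map_gradedSpan (FreeLieAlgebra.lift ℂ y) (g := FreeLieAlgebra.of ℂ) (wt := wt) γ
  simp only [FreeLieAlgebra.lift_of_apply] at h2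
  rw [← h2, ← LinearMap.range_domRestrict, LinearMap.finrank_range_of_inj]
  rw [injective_iff_map_eq_zero]
  intro a ha
  exact Subtype.ext (h a a.2 ha)

/-- Rank–nullity: a family whose brackets span as large a piece as in the free Lie algebra satisfies
no relation in that degree. -/
theorem eq_zero_of_finrank_le {y : X → G} {γ : Γ}
    [FiniteDimensional ℂ (gradedSpan (FreeLieAlgebra.of ℂ) wt γ)]
    (h : finrank ℂ (gradedSpan (FreeLieAlgebra.of ℂ) wt γ) ≤ finrank ℂ (gradedSpan y wt γ))
    {a : FreeLieAlgebra ℂ X} (ha : a ∈ gradedSpan (FreeLieAlgebra.of ℂ) wt γ)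
    (ha0 : FreeLieAlgebra.lift ℂ y a = 0) : a = 0 := by
  have h2 := map_gradedSpan (FreeLieAlgebra.lift ℂ y) (g := FreeLieAlgebra.of ℂ) (wt := wt) γ
  simp only [FreeLieAlgebra.lift_of_apply] at h2
  set f := (FreeLieAlgebra.lift ℂ y : FreeLieAlgebra ℂ X →ₗ[ℂ] G).domRestrict
    (gradedSpan (FreeLieAlgebra.of ℂ) wt γ) with hf
  have h3 := f.finrank_range_add_finrank_ker
  have h4 : finrank ℂ (LinearMap.range f) = finrank ℂ (gradedSpan y wt γ) := by
    rw [hf, LinearMap.range_domRestrict, h2]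
  have h6 : LinearMap.ker f = ⊥ := Submodule.finrank_eq_zero.1 (by omega)
  have h5 : (⟨a, ha⟩ : gradedSpan (FreeLieAlgebra.of ℂ) wt γ) ∈ LinearMap.ker f := ha0
  rw [h6, Submodule.mem_bot] at h5
  exact congrArg Subtype.val h5

end Coarsen

/-- Projection to degree one: in the trivial square-zero extension by `X →₀ ℂ` all products of
generators vanish. -/
theorem linearIndependent_freeLie_of (X : Type*) :
    LinearIndependent ℂ (FreeLieAlgebra.of ℂ : X → FreeLieAlgebra ℂ X) := by
  let L : FreeAlgebra ℂ X →ₐ[ℂ] TrivSqZeroExt ℂ (X →₀ ℂ) :=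
    FreeAlgebra.lift ℂ fun x => TrivSqZeroExt.inr (Finsupp.single x 1)
  let M : FreeLieAlgebra ℂ X →ₗ[ℂ] X →₀ ℂ := TrivSqZeroExt.sndHom ℂ (X →₀ ℂ) ∘ₗ
    L.toLinearMap ∘ₗ (freeLieToAssoc X : FreeLieAlgebra ℂ X →ₗ[ℂ] FreeAlgebra ℂ X)
  refine LinearIndependent.of_comp M ?_
  convert Finsupp.linearIndependent_single_one ℂ X using 1
  ext1 x
  change TrivSqZeroExt.snd (L (freeLieToAssoc X (FreeLieAlgebra.of ℂ x))) = _
  rw [freeLieToAssoc_of]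
  simp [L]

/-! ### Bases of the root spaces with first coordinate one -/

namespace FrickeStructure

variable {𝔤 : Type u} [LieRing 𝔤] [LieAlgebra ℂ 𝔤] (F : FrickeStructure.{u, v} 𝔤)

theorem finite_ht_eq (n : ℤ) : Finite {i // F.ht i = n} :=
  ((F.finite_ht_le n).subset fun _ hi => le_of_eq hi).to_subtype

/-- The `e_i` with `i` of given height form a basis of a root space. -/
theorem exists_basis_E {n : ℤ} (hn : 1 ≤ n) :
    ∃ b : Basis {i // F.ht i = n} ℂ (F.E (1, n)), ∀ i, (b i : 𝔤) = F.e i := by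
  let v : {i // F.ht i = n} → F.E (1, n) := fun i => ⟨F.e i, by
    have := F.e_mem_E i
    rwa [i.2] at this⟩
  have hr : ∀ i : {i // F.ht i = n}, i.1 ≠ F.r := fun i =>
    F.ne_r_of_one_le_ht (by rw [i.2]; exact hn)
  have hli : LinearIndependent ℂ v := by
    refine LinearIndependent.of_comp (F.E (1, n)).subtype ?_
    have h1 := ((linearIndependent_freeLie_of (Letter F.r F.t)).map'
      (letterLift F.e F.r F.t : _ →ₗ[ℂ] 𝔤) (LinearMap.ker_eq_bot.2 F.letterLift_e_injective)).comp
      (fun i : {i // F.ht i = n} => (⟨(i.1, 0), hr i, F.one_le_t (hr i)⟩ : Letter F.r F.t)) (by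
        intro i j hij
        rw [Subtype.mk.injEq, Prod.mk.injEq] at hij
        exact Subtype.ext hij.1)
    have h2 : (F.E (1, n)).subtype ∘ v = (letterLift F.e F.r F.t ∘ FreeLieAlgebra.of ℂ) ∘
        fun i : {i // F.ht i = n} => (⟨(i.1, 0), hr i, F.one_le_t (hr i)⟩ : Letter F.r F.t) :=
      funext fun i => (letterLift_e_of ⟨(i.1, 0), hr i, F.one_le_t (hr i)⟩).symm
    rw [h2]
    exact h1
  refine ⟨Basis.mk hli ?_, fun i => ?_⟩
  · intro y _
    have h2 := F.E_one_le n y.2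
    have h3 : {y | ∃ i, F.ht i = n ∧ F.e i = y} = (F.E (1, n)).subtype '' Set.range v := by
      ext z
      constructor
      · rintro ⟨i, hi, rfl⟩
        exact ⟨_, ⟨⟨i, hi⟩, rfl⟩, rfl⟩
      · rintro ⟨_, ⟨i, rfl⟩, rfl⟩
        exact ⟨i, i.2, rfl⟩
    rw [h3, ← Submodule.map_span] at h2
    obtain ⟨z, hz, hzy⟩ := h2
    rwa [← Subtype.ext hzy]
  · rw [Basis.mk_apply]

theorem finite_letter_le (n : ℕ) : {x : Letter F.r F.t | F.t x.1.1 + 1 ≤ n}.Finite := by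
  refine (((F.finite_ht_le n).prod (Set.finite_Iio n)).preimage
    Subtype.val_injective.injOn).subset fun x hx => ?_
  have h1 := F.coe_t x.2.1
  have h2 := x.2.2
  have h3 : F.t x.1.1 + 1 ≤ n := hx
  refine Set.mem_prod.2 ⟨?_, ?_⟩
  · change F.ht x.1.1 ≤ n
    omega
  · change x.1.2 < n
    omega

theorem E_one_neg_one : F.E (1, -1) = Submodule.span ℂ {F.e F.r} := by
  apply le_antisymm
  · refine (F.E_one_le (-1)).trans (Submodule.span_mono ?_)
    rintro _ ⟨i, hi, rfl⟩
    by_cases hir : i = F.r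
    · rw [hir]
      rfl
    · have := F.one_le_ht hir
      omega
  · rw [Submodule.span_singleton_le_iff_mem, ← F.ht_r]
    exact F.e_mem_E F.r

end FrickeStructure

/-! ### Generalized eigenvectors of `h` as free generators -/

namespace HomogeneousAction

variable {𝔤 : Type u} [LieRing 𝔤] [LieAlgebra ℂ 𝔤] {F : FrickeStructure.{u, v} 𝔤}
  {H : Type w} [Group H] (act : HomogeneousAction F H) (h : H)

/-- The degree of a letter together with the generalized eigenvalue of `h`. -/
noncomputable def wtTrace (μ : F.I → ℂ) (x : Letter F.r F.t) : ℕ × ℕ × Additive ℂ :=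
  (x.1.2 + 1, F.t x.1.1 - x.1.2, Additive.ofMul (μ x.1.1 * act.zeta h ^ x.1.2))

/-- The projection to the `ℤ × ℤ`-grading. -/
def coarse : ℕ × ℕ × Additive ℂ →+ ℤ × ℤ where
  toFun γ := (γ.1, γ.2.1)
  map_zero' := rfl
  map_add' γ δ := by simp

theorem coarse_wtTrace (μ : F.I → ℂ) (x : Letter F.r F.t) :
    coarse (act.wtTrace h μ x) = F.wtL x := by
  have := x.2.2
  change ((((x.1.2 + 1 : ℕ) : ℤ), ((F.t x.1.1 - x.1.2 : ℕ) : ℤ)) : ℤ × ℤ) = (_, _)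
  rw [Nat.cast_sub this.le, Nat.cast_add, Nat.cast_one]

theorem finrank_rootSpace_one_neg_one : finrank ℂ (F.rootSpace 1 (-1)) = 1 := by
  change finrank ℂ (F.E (1, -1)) = 1
  rw [F.E_one_neg_one]
  exact finrank_span_singleton (F.e_ne_zero F.r)

theorem rootRep_one_neg_one : act.rootRep 1 (-1) h = act.zeta h • LinearMap.id := by
  have he : F.e F.r ∈ F.E (1, -1) := by
    rw [F.E_one_neg_one]
    exact Submodule.mem_span_singleton_self _
  have hT := act.map_rootSpace 1 (-1) h he
  change act.toRep h (F.e F.r) ∈ F.E (1, -1) at hT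
  rw [F.E_one_neg_one] at hT
  obtain ⟨c, hc⟩ := Submodule.mem_span_singleton.1 hT
  have hrep : act.rootRep 1 (-1) h = c • LinearMap.id := by
    ext1 ⟨y, hy⟩
    have hy' : y ∈ F.E (1, -1) := hy
    rw [F.E_one_neg_one] at hy'
    obtain ⟨a, rfl⟩ := Submodule.mem_span_singleton.1 hy'
    apply Subtype.ext
    change act.toRep h (a • F.e F.r) = c • a • F.e F.r
    rw [map_smul, ← hc, smul_comm]
  have hζ : act.zeta h = c := by
    have := F.finiteDimensional_E (1, -1)
    rw [zeta, hrep, map_smul, LinearMap.trace_id, finrank_rootSpace_one_neg_one, Nat.cast_one,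
      smul_eq_mul, mul_one]
  rw [hζ, hrep]

theorem toRep_e_r : act.toRep h (F.e F.r) = act.zeta h • F.e F.r := by
  have he : F.e F.r ∈ F.rootSpace 1 (-1) := by
    change F.e F.r ∈ F.E (1, -1)
    rw [F.E_one_neg_one]
    exact Submodule.mem_span_singleton_self _
  exact congrArg Subtype.val (LinearMap.congr_fun (act.rootRep_one_neg_one h) ⟨F.e F.r, he⟩)

theorem exists_adapted : ∃ (b : F.I → 𝔤) (μ : F.I → ℂ), F.Adapted b ∧
    (∀ i, i ≠ F.r → b i ∈ Module.End.maxGenEigenspace (act.toRep h) (μ i)) ∧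
    ∀ n : ℤ, 1 ≤ n → LinearMap.trace ℂ _ (act.rootRep 1 n h) =
      ∑ᶠ i : {i // F.ht i = n}, μ i := by
  have hex : ∀ n : ℤ, ∃ (b : {i // F.ht i = n} → F.E (1, n)) (μ : {i // F.ht i = n} → ℂ),
      1 ≤ n → ⊤ ≤ Submodule.span ℂ (Set.range b) ∧
      (∀ i, b i ∈ Module.End.maxGenEigenspace (act.rootRep 1 n h) (μ i)) ∧
      LinearMap.trace ℂ _ (act.rootRep 1 n h) = ∑ᶠ i, μ i := by
    intro n
    by_cases hn : 1 ≤ n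
    · have := F.finite_ht_eq n
      have := F.finiteDimensional_E (1, n)
      obtain ⟨b, -⟩ := F.exists_basis_E hn
      obtain ⟨b', μ, h1, h2⟩ := exists_basis_maxGenEigenspace (act.rootRep 1 n h) b
      exact ⟨b', μ, fun _ => ⟨b'.span_eq.ge, h1, h2⟩⟩
    -- Only `n ≥ 1` matters: the one index of smaller height is `r`, which never occurs in a letter.
    · exact ⟨0, 0, fun h => absurd h hn⟩
  choose b μ hb using hex
  refine ⟨fun i => b (F.ht i) ⟨i, rfl⟩, fun i => μ (F.ht i) ⟨i, rfl⟩, ⟨fun i _ => (b _ _).2, ?_⟩,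
    ?_, ?_⟩
  · intro n hn y hy
    have h1 := (hb n hn).1 (Submodule.mem_top (x := ⟨y, hy⟩))
    have h2 := Submodule.mem_map_of_mem (f := (F.E (1, n)).subtype) h1
    rw [Submodule.map_span] at h2
    refine Submodule.span_mono ?_ h2
    rintro _ ⟨_, ⟨i, rfl⟩, rfl⟩
    obtain ⟨i, rfl⟩ := i
    exact ⟨i, rfl, rfl⟩
  · intro i hi
    have h1 := (hb _ (F.one_le_ht hi)).2.1 ⟨i, rfl⟩
    have h2 := Module.End.genEigenspace_restrict (act.toRep h) (F.E (1, F.ht i)) ⊤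
      (μ (F.ht i) ⟨i, rfl⟩) (act.map_rootSpace 1 (F.ht i) h)
    exact h2.le h1
  · intro n hn
    rw [(hb n hn).2.2]
    refine finsum_congr ?_
    rintro ⟨i, rfl⟩
    rfl

variable {act h}

theorem letterVec_mem_maxGenEigenspace {b : F.I → 𝔤} {μ : F.I → ℂ}
    (hb : ∀ i, i ≠ F.r → b i ∈ Module.End.maxGenEigenspace (act.toRep h) (μ i))
    (x : Letter F.r F.t) : F.letterVec b x ∈
      Module.End.maxGenEigenspace (act.toRep h) (act.wtTrace h μ x).2.2.toMul := by
  obtain ⟨⟨i, k⟩, hi', hk⟩ := x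
  change (LieAlgebra.ad ℂ 𝔤 (F.e F.r) ^ k) (b i) ∈
    Module.End.maxGenEigenspace (act.toRep h) (μ i * act.zeta h ^ k)
  have hi : i ≠ F.r := hi'
  clear hk hi'
  have he : F.e F.r ∈ Module.End.maxGenEigenspace (act.toRep h) (act.zeta h) :=
    (Module.End.mem_maxGenEigenspace _ _ _).2 ⟨1, by
      rw [pow_one, LinearMap.sub_apply, LinearMap.smul_apply, act.toRep_e_r, Module.End.one_apply,
        sub_self]⟩
  induction k with
  | zero => simpa using hb i hi
  | succ k ih =>
    rw [pow_succ' (act.zeta h), mul_left_comm, pow_succ', Module.End.mul_apply]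
    exact lie_mem_maxGenEigenspace (act.map_lie h) he ih

theorem gradedSpan_le_maxGenEigenspace {b : F.I → 𝔤} {μ : F.I → ℂ}
    (hb : ∀ i, i ≠ F.r → b i ∈ Module.End.maxGenEigenspace (act.toRep h) (μ i))
    (γ : ℕ × ℕ × Additive ℂ) : gradedSpan (F.letterVec b) (act.wtTrace h μ) γ ≤
      Module.End.maxGenEigenspace (act.toRep h) γ.2.2.toMul :=
  gradedSpan_le (P := fun γ : ℕ × ℕ × Additive ℂ =>
      Module.End.maxGenEigenspace (act.toRep h) γ.2.2.toMul)
    (letterVec_mem_maxGenEigenspace hb)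
    (fun _ _ _ _ ha hb => lie_mem_maxGenEigenspace (act.map_lie h) ha hb) γ

/-- The dimensions of the homogeneous pieces of the free Lie algebra on the letters. -/
noncomputable def freeDim (act : HomogeneousAction F H) (h : H) (μ : F.I → ℂ)
    (γ : ℕ × ℕ × Additive ℂ) : ℕ :=
  finrank ℂ (gradedSpan (FreeLieAlgebra.of ℂ) (act.wtTrace h μ) γ)

/-- The letters formed from `b` span the same `ℤ × ℤ`-graded pieces as the free letters formed from
the `e_i`. These pieces are finite-dimensional, so equality of dimensions makes the new letters free
too, and the dimensions in the finer grading agree with the free ones. -/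
theorem finrank_gradedSpan_letterVec {b : F.I → 𝔤} (hb : F.Adapted b) (μ : F.I → ℂ)
    (γ : ℕ × ℕ × Additive ℂ) :
    finrank ℂ (gradedSpan (F.letterVec b) (act.wtTrace h μ) γ) = act.freeDim h μ γ := by
  have hinj := F.letterLift_e_injective
  have hlift : letterLift F.e F.r F.t = FreeLieAlgebra.lift ℂ (F.letterVec F.e) := rfl
  have h1 : finrank ℂ (gradedSpan (F.letterVec F.e) F.wtL (coarse γ)) =
      finrank ℂ (gradedSpan (FreeLieAlgebra.of ℂ) F.wtL (coarse γ)) :=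
    finrank_gradedSpan_of_injOn fun a _ ha => (injective_iff_map_eq_zero _).1 hinj a ha
  have hfin : FiniteDimensional ℂ (gradedSpan (F.letterVec F.e) F.wtL (coarse γ)) := by
    have := F.finiteDimensional_E (coarse γ)
    exact Submodule.finiteDimensional_of_le (F.gradedSpan_le_E F.adapted_e.letterVec_mem (coarse γ))
  have hfin' : FiniteDimensional ℂ
      (gradedSpan (FreeLieAlgebra.of ℂ (X := Letter F.r F.t)) F.wtL (coarse γ)) := by
    have h2 := map_gradedSpan (FreeLieAlgebra.lift ℂ (F.letterVec F.e)) (g := FreeLieAlgebra.of ℂ)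
      (wt := F.wtL) (coarse γ)
    simp only [FreeLieAlgebra.lift_of_apply] at h2
    have h3 : Function.Injective ((FreeLieAlgebra.lift ℂ (F.letterVec F.e) : _ →ₗ[ℂ] 𝔤).domRestrict
        (gradedSpan (FreeLieAlgebra.of ℂ) F.wtL (coarse γ))) :=
      hinj.comp Subtype.val_injective
    have := LinearEquiv.ofInjective _ h3
    rw [LinearMap.range_domRestrict, h2] at this
    exact Module.Finite.equiv this.symm
  have hle : gradedSpan (FreeLieAlgebra.of ℂ) (act.wtTrace h μ) γ ≤
      gradedSpan (FreeLieAlgebra.of ℂ) F.wtL (coarse γ) := by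
    have := gradedSpan_le_comp (g := FreeLieAlgebra.of ℂ) (wt := act.wtTrace h μ) coarse γ
    simpa only [coarse_wtTrace] using this
  refine finrank_gradedSpan_of_injOn fun a ha ha0 =>
    eq_zero_of_finrank_le (y := F.letterVec b) (wt := F.wtL) (γ := coarse γ) ?_ (hle ha) ha0
  rw [← h1, F.adapted_e.gradedSpan_eq hb]

end HomogeneousAction

end FrickeLie

namespace FrickeLie

open Module

namespace HomogeneousAction

variable {𝔤 : Type u} [LieRing 𝔤] [LieAlgebra ℂ 𝔤] {F : FrickeStructure.{u, v} 𝔤}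
  {H : Type w} [Group H] {act : HomogeneousAction F H} {h : H}

/-! ### The traces on the root spaces -/

theorem E_eq_iSup {b : F.I → 𝔤} (hb : F.Adapted b) (μ : F.I → ℂ) {d s : ℤ} (hd : 1 ≤ d)
    (hs : 0 ≤ s) : F.E (d, s) = ⨆ ν : ℂ, gradedSpan (F.letterVec b) (act.wtTrace h μ)
      (d.toNat, s.toNat, Additive.ofMul ν) := by
  have h1 := gradedSpan_comp (g := F.letterVec b) (wt := act.wtTrace h μ) coarse (d, s)
  simp only [coarse_wtTrace] at h1
  have hne : ((d, s) : ℤ × ℤ) ≠ (1, -1) := by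
    rw [Ne, Prod.mk.injEq]
    omega
  rw [hb.E_eq (by simp; omega), adjoinPiece, iSup_neg hne, sup_bot_eq, h1]
  apply le_antisymm
  · refine iSup_le ?_
    rintro ⟨⟨m, n, ν⟩, hγ⟩
    rw [coarse, AddMonoidHom.coe_mk, ZeroHom.coe_mk, Prod.mk.injEq] at hγ
    obtain ⟨rfl, rfl⟩ := hγ
    exact le_iSup (fun ν : ℂ => gradedSpan (F.letterVec b) (act.wtTrace h μ)
      (m, n, Additive.ofMul ν)) ν.toMul
  · refine iSup_le fun ν => ?_
    refine le_iSup (fun γ : {γ // coarse γ = (d, s)} =>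
      gradedSpan (F.letterVec b) (act.wtTrace h μ) γ) ⟨(d.toNat, s.toNat, Additive.ofMul ν), ?_⟩
    exact Prod.ext (Int.toNat_of_nonneg (by omega)) (Int.toNat_of_nonneg hs)

/-- Letters have positive second coordinate; among roots with `d ≥ 1`, only the real one has a
negative second coordinate. -/
theorem E_eq_bot {d s : ℤ} (hd : 1 ≤ d) (hs : s < 0) (hne : ¬ (d = 1 ∧ s = -1)) :
    F.E (d, s) = ⊥ := by
  have h1 := gradedSpan_le (g := F.letterVec F.e) (wt := F.wtL)
    (P := fun γ : ℤ × ℤ => ⨆ _ : 0 ≤ γ.2, (⊤ : Submodule ℂ 𝔤)) (fun x => ?_) ?_ (d, s)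
  · rw [iSup_neg (by simpa using hs), le_bot_iff] at h1
    rw [F.adapted_e.E_eq (by simp; omega), adjoinPiece, iSup_neg (by rwa [Prod.mk.injEq]),
      sup_bot_eq, h1]
  · have := x.2.2
    exact Submodule.mem_iSup_of_mem (by simp only [FrickeStructure.wtL]; omega) Submodule.mem_top
  · intro γ δ a b ha hb
    by_cases hγ : 0 ≤ γ.2
    · by_cases hδ : 0 ≤ δ.2
      · exact Submodule.mem_iSup_of_mem (by rw [Prod.snd_add]; omega) Submodule.mem_top
      · rw [iSup_neg hδ, Submodule.mem_bot] at hb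
        rw [hb, lie_zero]
        exact Submodule.zero_mem _
    · rw [iSup_neg hγ, Submodule.mem_bot] at ha
      rw [ha, zero_lie]
      exact Submodule.zero_mem _

/-- The refined pieces consist of generalized eigenvectors for `ν` and exhaust the root space. Hence
one set of dimensions serves all powers of `h`. -/
theorem trace_rootRep_of_nonneg {b : F.I → 𝔤} {μ : F.I → ℂ} (hb : F.Adapted b)
    (hμ : ∀ i, i ≠ F.r → b i ∈ Module.End.maxGenEigenspace (act.toRep h) (μ i))
    {d s : ℤ} (hd : 1 ≤ d) (hs : 0 ≤ s) (a : ℕ) :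
    LinearMap.trace ℂ _ (act.rootRep d s (h ^ a)) =
      ∑ᶠ ν : ℂ, (act.freeDim h μ (d.toNat, s.toNat, Additive.ofMul ν) : ℂ) * ν ^ a := by
  let Q : ℂ → Submodule ℂ 𝔤 := fun ν => gradedSpan (F.letterVec b) (act.wtTrace h μ)
    (d.toNat, s.toNat, Additive.ofMul ν)
  have hE : F.rootSpace d s = ⨆ ν, Q ν := E_eq_iSup hb μ hd hs
  have hQ : ∀ ν, Q ν ≤ F.rootSpace d s := fun ν => hE ▸ le_iSup Q ν
  have : FiniteDimensional ℂ (F.rootSpace d s) := F.finiteDimensional_E (d, s)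
  rw [map_pow, trace_pow_eq_of_iSup_eq_top (P := fun ν => (Q ν).comap (F.rootSpace d s).subtype)]
  · refine finsum_congr fun ν => ?_
    rw [(Submodule.comapSubtypeEquivOfLe (hQ ν)).finrank_eq, finrank_gradedSpan_letterVec hb]
  · intro ν y hy
    have h1 := gradedSpan_le_maxGenEigenspace hμ _ hy
    exact (Module.End.genEigenspace_restrict (act.toRep h) (F.rootSpace d s) ⊤ ν
      (act.map_rootSpace d s h)).ge h1
  · refine Submodule.map_injective_of_injective (F.rootSpace d s).injective_subtype ?_
    rw [Submodule.map_iSup, Submodule.map_subtype_top]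
    simp only [Submodule.map_comap_subtype]
    rw [hE]
    exact iSup_congr fun ν => inf_eq_right.2 (le_iSup Q ν)

theorem trace_rootRep_one_neg_one (a : ℕ) :
    LinearMap.trace ℂ _ (act.rootRep 1 (-1) (h ^ a)) = act.zeta h ^ a := by
  have : FiniteDimensional ℂ (F.rootSpace 1 (-1)) := F.finiteDimensional_E (1, -1)
  rw [map_pow, rootRep_one_neg_one, smul_pow, ← Module.End.one_eq_id, one_pow, map_smul,
    LinearMap.trace_one, finrank_rootSpace_one_neg_one, Nat.cast_one, smul_eq_mul, mul_one]

theorem trace_rootRep_of_neg {d s : ℤ} (hd : 1 ≤ d) (hs : s < 0) (hne : ¬ (d = 1 ∧ s = -1))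
    (g : H) : LinearMap.trace ℂ _ (act.rootRep d s g) = 0 := by
  have h1 : F.rootSpace d s = ⊥ := E_eq_bot hd hs hne
  have : Subsingleton (F.rootSpace d s) := by
    rw [h1]
    infer_instance
  rw [Subsingleton.elim (act.rootRep d s g) 0, map_zero]

end HomogeneousAction

end FrickeLie

namespace FrickeLie

open Module

/-! ### Logarithmic derivatives of power series -/

section Euler

open PowerSeries

variable {S : Type*} [CommRing S]

/-- The Euler operator `X d/dX`. -/
noncomputable def euler (f : PowerSeries S) : PowerSeries S := X * derivative S f

theorem coeff_euler (n : ℕ) (f : PowerSeries S) : coeff n (euler f) = n * coeff n f := by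
  cases n with
  | zero => simp [euler]
  | succ n =>
    rw [euler, coeff_succ_X_mul, coeff_derivative]
    push_cast
    ring

theorem euler_mul (f g : PowerSeries S) : euler (f * g) = f * euler g + g * euler f := by
  rw [euler, Derivation.leibniz, euler, euler, smul_eq_mul, smul_eq_mul]
  ring

theorem euler_one : euler (1 : PowerSeries S) = 0 := by
  ext n
  rw [coeff_euler, coeff_one]
  split_ifs with h <;> simp [h]

/-- Substitution of `L - 1` for `X` in `(1 + X) · d/dX log(1 + X) = 1`. -/
theorem mul_euler_logOf [Algebra ℚ S] {L : PowerSeries S} (hL : constantCoeff L = 1) :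
    L * euler (logOf L) = euler L := by
  have hs : HasSubst (L - 1) := HasSubst.of_constantCoeff_zero' (by simp [hL])
  have hlog : (1 + X : PowerSeries S) * derivative S (log S) = 1 := by
    rw [deriv_log]
    ext n
    rw [add_mul, one_mul, map_add, coeff_mk]
    cases n with
    | zero => simp
    | succ n =>
      rw [coeff_succ_X_mul, coeff_mk, coeff_one, if_neg (Nat.succ_ne_zero n), ← map_add, pow_succ]
      simp
  have h2 := congrArg (subst (L - 1)) hlog
  rw [← coe_substAlgHom hs, map_mul, map_add, map_one, coe_substAlgHom hs, subst_X hs,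
    add_sub_cancel] at h2
  rw [euler, logOf_eq, derivative_subst hs, map_sub, Derivation.map_one_eq_zero, sub_zero,
    euler, mul_left_comm, ← mul_assoc L, h2, one_mul]

theorem logOf_eq_of_mul_euler [Algebra ℚ S] {L G : PowerSeries S} (hL : constantCoeff L = 1)
    (hG : constantCoeff G = 0) (h : L * euler G = euler L) : logOf L = G := by
  have hu : IsUnit L := by
    rw [isUnit_iff_constantCoeff, hL]
    exact isUnit_one
  have h1 : euler (logOf L) = euler G := hu.mul_left_cancel ((mul_euler_logOf hL).trans h.symm)
  ext n
  cases n with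
  | zero =>
    rw [coeff_zero_eq_constantCoeff_apply, coeff_zero_eq_constantCoeff_apply,
      constantCoeff_logOf hL, hG]
  | succ n =>
    have h2 := congrArg (coeff (n + 1)) h1
    rw [coeff_euler, coeff_euler] at h2
    have hn : IsUnit ((n + 1 : ℕ) : S) := by
      have : ((n + 1 : ℕ) : S) = algebraMap ℚ S (n + 1 : ℕ) := by simp
      rw [this]
      exact (IsUnit.mk0 _ (by positivity)).map _
    exact hn.mul_left_cancel h2

/-- The logarithmic derivative of `1 - c X^m`. -/
noncomputable def logDeriv (c : S) (m : ℕ) : PowerSeries S :=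
  mk fun k => if m ∣ k ∧ k ≠ 0 then -(m * c ^ (k / m)) else 0

theorem mul_logDeriv (c : S) {m : ℕ} (hm : 0 < m) :
    (1 - C c * X ^ m) * logDeriv c m = euler (1 - C c * X ^ m) := by
  ext k
  rw [coeff_euler, sub_mul, one_mul, mul_assoc, map_sub, coeff_C_mul, coeff_X_pow_mul', map_sub,
    coeff_C_mul, coeff_X_pow, coeff_one, logDeriv, coeff_mk]
  rcases lt_trichotomy k m with h | rfl | h
  · rw [if_neg (not_le.2 h), if_neg h.ne, if_neg]
    · by_cases hk : k = 0
      · simp [hk]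
      · simp [hk]
    · rintro ⟨h1, h2⟩
      exact absurd (Nat.le_of_dvd (by omega) h1) (by omega)
  · have h1 : k ≠ 0 := by omega
    simp [h1, Nat.div_self hm]
  · have h1 : k ≠ 0 := by omega
    have h2 : k - m ≠ 0 := by omega
    have h3 : m ∣ k - m ↔ m ∣ k := by
      rw [← Nat.dvd_add_self_right, Nat.sub_add_cancel h.le]
    simp only [if_pos h.le, coeff_mk, if_neg h1, if_neg h.ne', h3]
    by_cases hd : m ∣ k
    · rw [if_pos ⟨hd, h1⟩, if_pos ⟨hd, h2⟩]
      obtain ⟨j, rfl⟩ := hd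
      have hj : 1 ≤ j := by
        rcases Nat.eq_zero_or_pos j with rfl | hj
        · simp at h1
        · exact hj
      obtain ⟨i, rfl⟩ : ∃ i, j = i + 1 := ⟨j - 1, by omega⟩
      rw [Nat.mul_div_cancel_left _ hm, show m * (i + 1) - m = m * i by
        rw [Nat.mul_succ, Nat.add_sub_cancel], Nat.mul_div_cancel_left _ hm]
      ring
    · rw [if_neg fun h => hd h.1, if_neg fun h => hd h.1]
      simp

theorem pow_mul_euler {f g : PowerSeries S} (h : f * g = euler f) (n : ℕ) :
    f ^ n * (n • g) = euler (f ^ n) := by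
  induction n with
  | zero => rw [pow_zero, euler_one, zero_smul, mul_zero]
  | succ n ih =>
    rw [pow_succ, euler_mul, ← ih, ← h, succ_nsmul]
    ring

theorem prod_mul_euler {ι : Type*} (s : Finset ι) {f g : ι → PowerSeries S}
    (h : ∀ i ∈ s, f i * g i = euler (f i)) :
    (∏ i ∈ s, f i) * ∑ i ∈ s, g i = euler (∏ i ∈ s, f i) := by
  classical
  induction s using Finset.induction_on with
  | empty => rw [Finset.prod_empty, Finset.sum_empty, mul_zero, euler_one]
  | insert i s hi ih =>
    rw [Finset.prod_insert hi, Finset.sum_insert hi, euler_mul,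
      ← ih fun j hj => h j (Finset.mem_insert_of_mem hj), ← h i (Finset.mem_insert_self i s)]
    ring

theorem euler_map {S' : Type*} [CommRing S'] (φ : S →+* S') (f : PowerSeries S) :
    euler (map φ f) = map φ (euler f) := by
  ext n
  simp only [coeff_euler, coeff_map, map_mul, map_natCast]

/-- Reduction of the coefficients modulo `X^(D + 1)`. -/
noncomputable def truncMap (D : ℕ) : PowerSeries (PowerSeries ℂ) →+*
    PowerSeries (PowerSeries ℂ ⧸ Ideal.span {(X : PowerSeries ℂ) ^ (D + 1)}) :=
  map (Ideal.Quotient.mk _)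

theorem truncMap_eq_iff {D : ℕ} {f g : PowerSeries (PowerSeries ℂ)} :
    truncMap D f = truncMap D g ↔ ∀ m, ∀ j ≤ D, coeff j (coeff m f) = coeff j (coeff m g) := by
  rw [PowerSeries.ext_iff]
  refine forall_congr' fun m => ?_
  rw [truncMap, coeff_map, coeff_map, Ideal.Quotient.eq, Ideal.mem_span_singleton, X_pow_dvd_iff]
  simp only [map_sub, sub_eq_zero, Nat.lt_succ_iff]

theorem truncMap_euler {D : ℕ} {f g : PowerSeries (PowerSeries ℂ)}
    (h : truncMap D f = truncMap D g) : truncMap D (euler f) = truncMap D (euler g) := by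
  rw [truncMap, ← euler_map, ← euler_map, ← truncMap, h]

theorem eq_of_truncMap {f g : PowerSeries (PowerSeries ℂ)}
    (h : ∀ D, truncMap D f = truncMap D g) : f = g := by
  ext m j
  exact truncMap_eq_iff.1 (h j) m j le_rfl

end Euler

end FrickeLie

namespace FrickeLie

open Module

/-! ### The product formula -/

section Monomials

open PowerSeries

/-- The monomial `ν p^m q^(m + n)`. -/
noncomputable def monomialHom : Multiplicative (ℕ × ℕ × Additive ℂ) →*
    PowerSeries (PowerSeries ℂ) where
  toFun γ := C (C (γ.toAdd.2.2.toMul) * X ^ (γ.toAdd.1 + γ.toAdd.2.1)) * X ^ γ.toAdd.1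
  map_one' := by simp
  map_mul' γ δ := by
    simp only [toAdd_mul, Prod.fst_add, Prod.snd_add, toMul_add, map_mul, map_pow, pow_add]
    ring

/-- The degree in `q`. -/
def totalDegree : ℕ × ℕ × Additive ℂ →+ ℕ where
  toFun γ := γ.1 + γ.2.1
  map_zero' := rfl
  map_add' γ δ := by
    simp only [Prod.fst_add, Prod.snd_add]
    omega

theorem monomialHom_apply (γ : ℕ × ℕ × Additive ℂ) : monomialHom (Multiplicative.ofAdd γ) =
    C (C (γ.2.2.toMul) * X ^ totalDegree γ) * X ^ γ.1 := rfl

theorem truncMap_monomialHom {D : ℕ} {γ : ℕ × ℕ × Additive ℂ} (h : D < totalDegree γ) :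
    truncMap D (monomialHom (Multiplicative.ofAdd γ)) = 0 := by
  rw [← map_zero (truncMap D), truncMap_eq_iff]
  intro m j hj
  rw [monomialHom_apply, coeff_C_mul_X_pow, map_zero, map_zero]
  split_ifs
  · rw [coeff_C_mul_X_pow, if_neg (by omega)]
  · rw [map_zero]

end Monomials

theorem sum_divisorsAntidiagonal_ite {k : ℕ} (hk : k ≠ 0) (m : ℕ) (φ : ℕ → ℂ) :
    ∑ ad ∈ k.divisorsAntidiagonal, (if ad.2 = m then φ ad.1 else 0) =
      if m ∣ k then φ (k / m) else 0 := by
  rw [Nat.sum_divisorsAntidiagonal' (fun a d => if d = m then φ a else 0), Finset.sum_ite_eq']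
  simp [Nat.mem_divisors, hk]

/-! ### The product over the letters modulo powers of `q` -/

namespace HomogeneousAction

variable {𝔤 : Type u} [LieRing 𝔤] [LieAlgebra ℂ 𝔤] {F : FrickeStructure.{u, v} 𝔤}
  {H : Type w} [Group H] (act : HomogeneousAction F H) (h : H) (μ : F.I → ℂ)

open PowerSeries

theorem totalDegree_wtTrace (x : Letter F.r F.t) :
    totalDegree (act.wtTrace h μ x) = F.t x.1.1 + 1 := by
  have := x.2.2
  change x.1.2 + 1 + (F.t x.1.1 - x.1.2) = _
  omega

theorem wittFormula_letter (D : ℕ) :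
    WittFormula totalDegree ((truncMap D).toMonoidHom.comp monomialHom) D (act.wtTrace h μ) :=
  wittFormula (fun _ hγ => truncMap_monomialHom hγ)
    (fun x => by rw [totalDegree_wtTrace]; omega)
    (fun n => by simp only [totalDegree_wtTrace]; exact F.finite_letter_le n)

/-- The degrees up to `D` that occur in the free Lie algebra on the letters. -/
noncomputable def freeSupport (D : ℕ) : Finset (ℕ × ℕ × Additive ℂ) :=
  (act.wittFormula_letter h μ D).2.1.toFinset

variable {act h μ} in
theorem mem_freeSupport {D : ℕ} {γ : ℕ × ℕ × Additive ℂ} : γ ∈ act.freeSupport h μ D ↔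
    totalDegree γ ≤ D ∧ gradedSpan (FreeLieAlgebra.of ℂ) (act.wtTrace h μ) γ ≠ ⊥ :=
  (act.wittFormula_letter h μ D).2.1.mem_toFinset

variable {act h μ} in
theorem pos_of_mem_freeSupport {D : ℕ} {γ : ℕ × ℕ × Additive ℂ}
    (hγ : γ ∈ act.freeSupport h μ D) : 0 < γ.1 := by
  by_contra h0
  exact (mem_freeSupport.1 hγ).2 (gradedSpan_eq_bot_of_deg_le (k := 0)
    (AddMonoidHom.fst ℕ (ℕ × Additive ℂ)) (fun x => Nat.succ_pos _) (not_lt.1 h0))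

variable {act h μ} in
theorem freeDim_eq_zero {D : ℕ} {γ : ℕ × ℕ × Additive ℂ} (hD : totalDegree γ ≤ D)
    (hγ : γ ∉ act.freeSupport h μ D) : act.freeDim h μ γ = 0 := by
  rw [mem_freeSupport, not_and, not_not] at hγ
  rw [freeDim, hγ hD, finrank_bot]

theorem truncMap_prod (D : ℕ) :
    truncMap D (∏ γ ∈ act.freeSupport h μ D,
      (1 - monomialHom (Multiplicative.ofAdd γ)) ^ act.freeDim h μ γ) =
    truncMap D (1 - ∑ x ∈ (F.finite_letter_le D).toFinset,
      monomialHom (Multiplicative.ofAdd (act.wtTrace h μ x))) := by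
  have hW := (act.wittFormula_letter h μ D).2.2
  rw [finprod_eq_prod_of_mulSupport_subset (s := act.freeSupport h μ D),
    finsum_eq_sum_of_support_subset (s := (F.finite_letter_le D).toFinset)] at hW
  · simp only [map_prod, map_pow, map_sub, map_one, map_sum]
    exact hW
  · intro x hx
    rw [Set.Finite.coe_toFinset]
    by_contra hx'
    refine hx (truncMap_monomialHom ?_)
    rw [totalDegree_wtTrace]
    exact not_le.1 hx'
  · intro γ hγ
    by_contra hγ'
    rw [Finset.mem_coe] at hγ'
    refine hγ ?_
    by_cases hD : totalDegree γ ≤ D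
    · have h0 := freeDim_eq_zero hD hγ'
      rw [freeDim] at h0
      beta_reduce
      rw [h0, pow_zero]
    · have h0 : ((truncMap D).toMonoidHom.comp monomialHom) (Multiplicative.ofAdd γ) = 0 :=
        truncMap_monomialHom (not_le.1 hD)
      beta_reduce
      rw [h0, sub_zero, one_pow]

/-- The logarithmic derivative of the truncated product. -/
noncomputable def truncLogDeriv (D : ℕ) : PowerSeries (PowerSeries ℂ) :=
  logDeriv (C (act.zeta h)) 1 + ∑ γ ∈ act.freeSupport h μ D,
    act.freeDim h μ γ • logDeriv (C (γ.2.2.toMul) * X ^ totalDegree γ) γ.1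

/-- After `p ↦ p q` the real root contributes the factor `1 - ζ p`, and the Witt formula turns the
other factor into a finite product. Logarithmic derivatives then add up. -/
theorem truncMap_mul_truncLogDeriv {D : ℕ} {L : PowerSeries (PowerSeries ℂ)}
    (hL : truncMap D L = truncMap D ((1 - C (C (act.zeta h)) * X) *
      (1 - ∑ x ∈ (F.finite_letter_le D).toFinset,
        monomialHom (Multiplicative.ofAdd (act.wtTrace h μ x))))) :
    truncMap D (L * act.truncLogDeriv h μ D) = truncMap D (euler L) := by
  set f := ∏ γ ∈ act.freeSupport h μ D,
      (1 - monomialHom (Multiplicative.ofAdd γ)) ^ act.freeDim h μ γ with hf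
  have h1 : truncMap D L = truncMap D ((1 - C (C (act.zeta h)) * X) * f) := by
    rw [hL, map_mul, map_mul, hf, truncMap_prod]
  have h2 : f * ∑ γ ∈ act.freeSupport h μ D,
      act.freeDim h μ γ • logDeriv (C (γ.2.2.toMul) * X ^ totalDegree γ) γ.1 = euler f :=
    prod_mul_euler _ fun γ hγ => pow_mul_euler (mul_logDeriv _ (pos_of_mem_freeSupport hγ)) _
  have h3 := mul_logDeriv (C (act.zeta h)) one_pos
  rw [pow_one] at h3
  have h4 : ((1 - C (C (act.zeta h)) * X) * f) * act.truncLogDeriv h μ D =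
      euler ((1 - C (C (act.zeta h)) * X) * f) := by
    rw [euler_mul, ← h2, ← h3, truncLogDeriv]
    ring
  rw [map_mul, h1, ← map_mul, h4]
  exact (truncMap_euler h1).symm

end HomogeneousAction

end FrickeLie

namespace FrickeLie

open Module

/-! ### The denominator and its factorization -/

namespace HomogeneousAction

variable {𝔤 : Type u} [LieRing 𝔤] [LieAlgebra ℂ 𝔤] {F : FrickeStructure.{u, v} 𝔤}
  {H : Type w} [Group H] (act : HomogeneousAction F H) (h : H)

open PowerSeries

theorem zeta_ne_zero : act.zeta h ≠ 0 := by
  intro h0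
  have h1 := act.toRep_e_r h
  rw [h0, zero_smul] at h1
  have h2 : act.toRep h⁻¹ (act.toRep h (F.e F.r)) = F.e F.r := by
    rw [← Module.End.mul_apply, ← map_mul, inv_mul_cancel, map_one, Module.End.one_apply]
  rw [h1, map_zero] at h2
  exact F.e_ne_zero F.r h2.symm

/-- The trace of a power of `h` on a root space. -/
noncomputable def rootTrace (d s : ℤ) (a : ℕ) : ℂ :=
  LinearMap.trace ℂ _ (act.rootRep d s (h ^ a))

theorem rootTrace_one_neg_one (a : ℕ) : act.rootTrace h 1 (-1) a = act.zeta h ^ a :=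
  trace_rootRep_one_neg_one a

/-- The numbers `μ i` are eigenvalues of `h` that account for all traces on root spaces. -/
structure IsTraceData (μ : F.I → ℂ) : Prop where
  simple : ∀ n : ℤ, 1 ≤ n → act.rootTrace h 1 n 1 = ∑ᶠ i : {i // F.ht i = n}, μ i
  root : ∀ d s : ℤ, 1 ≤ d → 0 ≤ s → ∀ a, act.rootTrace h d s a =
    ∑ᶠ ν : ℂ, (act.freeDim h μ (d.toNat, s.toNat, Additive.ofMul ν) : ℂ) * ν ^ a

theorem exists_isTraceData : ∃ μ, act.IsTraceData h μ := by
  obtain ⟨b, μ, hb, hμ, ht⟩ := act.exists_adapted h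
  exact ⟨μ, fun n hn => by rw [rootTrace, pow_one, ht n hn],
    fun d s hd hs a => trace_rootRep_of_nonneg hb hμ hd hs a⟩

/-- The series `p (f(ζ p) - f(q))` for the trace function `f`, with `p` replaced by `p q`. -/
noncomputable def denominator : PowerSeries (PowerSeries ℂ) :=
  PowerSeries.mk fun m => PowerSeries.mk fun j =>
    (if j = m then act.rootTrace h 1 (m - 1) 1 * act.zeta h ^ ((m : ℤ) - 1) else 0) -
      if m = 1 then act.rootTrace h 1 (j - 1) 1 else 0

variable {act h} {μ : F.I → ℂ}

theorem finite_t_le (D : ℕ) : {i | i ≠ F.r ∧ F.t i + 1 ≤ D}.Finite := by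
  refine (F.finite_ht_le D).subset fun i hi => ?_
  have h1 := F.coe_t hi.1
  have h2 := hi.2
  change F.ht i ≤ D
  omega

theorem sum_letter (D : ℕ) : ∑ x ∈ (F.finite_letter_le D).toFinset,
    monomialHom (Multiplicative.ofAdd (act.wtTrace h μ x)) =
    ∑ i ∈ (finite_t_le (F := F) D).toFinset, ∑ k ∈ Finset.range (F.t i),
      C (C (μ i * act.zeta h ^ k) * X ^ (F.t i + 1)) * X ^ (k + 1) := by
  rw [Finset.sum_sigma']
  refine Finset.sum_bij (fun x _ => ⟨x.1.1, x.1.2⟩) ?_ ?_ ?_ ?_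
  · intro x hx
    rw [Set.Finite.mem_toFinset] at hx
    rw [Finset.mem_sigma, Set.Finite.mem_toFinset, Finset.mem_range]
    exact ⟨⟨x.2.1, hx⟩, x.2.2⟩
  · rintro ⟨⟨i, k⟩, _⟩ _ ⟨⟨i', k'⟩, _⟩ _ heq
    simpa using heq
  · rintro ⟨i, k⟩ hik
    rw [Finset.mem_sigma, Set.Finite.mem_toFinset, Finset.mem_range] at hik
    exact ⟨⟨(i, k), hik.1.1, hik.2⟩, (F.finite_letter_le D).mem_toFinset.2 hik.1.2, rfl⟩
  · intro x _
    rw [monomialHom_apply, totalDegree_wtTrace]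
    rfl

/-- The string of one imaginary simple root telescopes. The two surviving terms are its
contributions to `p f(q)` and to `p f(ζp)`. -/
theorem geom_sum_letter (t : ℕ) (m z : ℂ) :
    (1 - C (C z) * X) * ∑ k ∈ Finset.range t, C (C (m * z ^ k) * X ^ (t + 1)) * X ^ (k + 1) =
      (C (C m * X ^ (t + 1)) * X ^ 1 - C (C (m * z ^ t) * X ^ (t + 1)) * X ^ (t + 1) :
        PowerSeries (PowerSeries ℂ)) := by
  have h1 : ∑ k ∈ Finset.range t, C (C (m * z ^ k) * X ^ (t + 1)) * X ^ (k + 1) =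
      (C (C m * X ^ (t + 1)) * X * ∑ k ∈ Finset.range t, (C (C z) * X) ^ k :
        PowerSeries (PowerSeries ℂ)) := by
    rw [Finset.mul_sum]
    refine Finset.sum_congr rfl fun k _ => ?_
    simp only [map_mul, map_pow]
    ring
  have h2 := mul_neg_geom_sum (C (C z) * X : PowerSeries (PowerSeries ℂ)) t
  rw [h1, mul_left_comm, h2]
  simp only [map_mul, map_pow]
  ring

theorem sum_eigenvalue (hμ : act.IsTraceData h μ) {D j : ℕ} (hj : j ≤ D) :
    ∑ i ∈ (finite_t_le (F := F) D).toFinset, (if j = F.t i + 1 then μ i else 0) =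
      if 2 ≤ j then act.rootTrace h 1 (j - 1) 1 else 0 := by
  split_ifs with h2
  · rw [hμ.simple _ (by omega), ← Finset.sum_filter, ← finsum_mem_coe_finset]
    rw [show ∑ᶠ i : {i // F.ht i = (j : ℤ) - 1}, μ i =
      ∑ᶠ i ∈ {i | F.ht i = (j : ℤ) - 1}, μ i from finsum_set_coe_eq_finsum_mem _]
    refine finsum_congr fun i => finsum_congr_Prop (propext ?_) fun _ => rfl
    rw [Finset.mem_coe, Finset.mem_filter, Set.Finite.mem_toFinset]
    constructor
    · rintro ⟨⟨hi, hD⟩, hj⟩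
      have := F.coe_t hi
      change F.ht i = (j : ℤ) - 1
      omega
    · intro hi
      have hi' : F.ht i = (j : ℤ) - 1 := hi
      have hir := F.ne_r_of_one_le_ht (i := i) (by omega)
      have := F.coe_t hir
      exact ⟨⟨hir, by omega⟩, by omega⟩
  · refine Finset.sum_eq_zero fun i hi => ?_
    rw [Set.Finite.mem_toFinset] at hi
    have := F.one_le_t hi.1
    rw [if_neg (by omega)]

theorem truncMap_denominator (hμ : act.IsTraceData h μ) (D : ℕ) :
    truncMap D (act.denominator h) = truncMap D ((1 - C (C (act.zeta h)) * X) *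
      (1 - ∑ x ∈ (F.finite_letter_le D).toFinset,
        monomialHom (Multiplicative.ofAdd (act.wtTrace h μ x)))) := by
  rw [truncMap_eq_iff]
  intro m j hj
  have key : coeff j (coeff m ((1 - C (C (act.zeta h)) * X) *
      ∑ x ∈ (F.finite_letter_le D).toFinset,
        monomialHom (Multiplicative.ofAdd (act.wtTrace h μ x)))) =
      ((if m = 1 then 1 else 0) - if j = m then act.zeta h ^ (j - 1) else 0) *
        if 2 ≤ j then act.rootTrace h 1 (j - 1) 1 else 0 := by
    rw [sum_letter, Finset.mul_sum, map_sum, map_sum, ← sum_eigenvalue hμ hj, Finset.mul_sum]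
    refine Finset.sum_congr rfl fun i _ => ?_
    rw [geom_sum_letter, map_sub, map_sub, coeff_C_mul_X_pow, coeff_C_mul_X_pow]
    by_cases hji : j = F.t i + 1
    · subst hji
      rw [if_pos rfl, Nat.add_sub_cancel, sub_mul]
      congr 1
      · split_ifs <;> simp
      · by_cases hm : m = F.t i + 1
        · rw [if_pos hm, if_pos hm.symm, coeff_C_mul_X_pow, if_pos rfl, mul_comm]
        · rw [if_neg hm, if_neg fun h => hm h.symm, map_zero, zero_mul]
    · rw [if_neg hji, mul_zero]
      have h0 : ∀ z : ℂ, coeff j (C z * X ^ (F.t i + 1) : PowerSeries ℂ) = 0 := fun z => by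
        rw [coeff_C_mul_X_pow, if_neg hji]
      split_ifs <;> simp only [h0, map_zero, sub_zero]
  rw [mul_sub, mul_one, map_sub, map_sub, key, denominator, coeff_mk, coeff_mk]
  have h1 : coeff j (coeff m (1 - C (C (act.zeta h)) * X : PowerSeries (PowerSeries ℂ))) =
      if j = 0 then (if m = 0 then 1 else 0) - (if m = 1 then act.zeta h else 0) else 0 := by
    rw [map_sub, map_sub, coeff_C_mul, coeff_X, coeff_one, mul_ite, mul_one, mul_zero]
    split_ifs <;> simp_all [coeff_one, coeff_C]
  have hz : act.rootTrace h 1 (-1) 1 = act.zeta h := by rw [rootTrace_one_neg_one, pow_one]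
  have hz0 := act.zeta_ne_zero h
  rw [h1]
  -- Here `j = 0` belongs to the real root and `j ≥ 2` to imaginary simple roots of height `j - 1`.
  -- For `j = 1` the constant term of `f` cancels between `f(ζp)` and `f(q)`.
  obtain rfl | rfl | hj2 : j = 0 ∨ j = 1 ∨ 2 ≤ j := by omega
  · by_cases hm : m = 0
    · subst hm
      simp [hz, hz0]
    · simp [hm, Ne.symm hm, hz]
  · by_cases hm : m = 1
    · subst hm
      simp
    · simp [hm, Ne.symm hm]
  · have hj0 : j ≠ 0 := by omega
    have hj1 : j ≠ 1 := by omega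
    by_cases hjm : j = m
    · subst hjm
      have h3 : ((j : ℤ) - 1) = ((j - 1 : ℕ) : ℤ) := by omega
      simp only [if_true, hj0, hj1, hj2, if_false, h3, zpow_natCast]
      ring
    · simp only [hjm, hj0, hj2, if_false, if_true]
      split_ifs <;> ring

end HomogeneousAction

end FrickeLie

namespace FrickeLie

open Module

/-! ### The logarithm of the denominator -/

namespace HomogeneousAction

variable {𝔤 : Type u} [LieRing 𝔤] [LieAlgebra ℂ 𝔤] {F : FrickeStructure.{u, v} 𝔤}
  {H : Type w} [Group H] (act : HomogeneousAction F H) (h : H)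

open PowerSeries

/-- The trace that contributes to the coefficient of `q^j` for a given divisor `a`. -/
noncomputable def heckeTrace (a d j : ℕ) : ℂ :=
  if a ∣ j then act.rootTrace h d ((j / a : ℕ) - d) a else 0

variable {act h} {μ : F.I → ℂ}

/-- After `p ↦ p q`, the term `Tr(h^a | 𝔤_{d,s}) p^(ad) q^(as)` has `q`-exponent `a (s + d)`. So `s
= j / a - d`, and `d ≤ j / a` means `s ≥ 0`. -/
theorem sum_freeSupport (hμ : act.IsTraceData h μ) {D a d j : ℕ} (ha : 0 < a) (hd : 0 < d)
    (hj : j ≤ D) : ∑ γ ∈ act.freeSupport h μ D, (if γ.1 = d ∧ a * totalDegree γ = j then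
      (act.freeDim h μ γ : ℂ) * γ.2.2.toMul ^ a else 0) =
    if a ∣ j ∧ d ≤ j / a then act.rootTrace h d ((j / a : ℕ) - d) a else 0 := by
  classical
  have htot : ∀ γ : ℕ × ℕ × Additive ℂ, totalDegree γ = γ.1 + γ.2.1 := fun _ => rfl
  split_ifs with hc
  · obtain ⟨⟨e, rfl⟩, hde⟩ := hc
    rw [Nat.mul_div_cancel_left _ ha] at hde ⊢
    have hs : ((e : ℤ) - d).toNat = e - d := by omega
    rw [hμ.root _ _ (by omega) (by omega), Int.toNat_natCast, hs, ← Finset.sum_filter]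
    have he : e ≤ D := (Nat.le_mul_of_pos_left e ha).trans hj
    set s := (act.freeSupport h μ D).filter fun γ => γ.1 = d ∧ a * totalDegree γ = a * e with hs
    have hmem : ∀ γ ∈ s, γ = (d, e - d, γ.2.2) := by
      rintro ⟨m, n, ν⟩ hγ
      obtain ⟨-, rfl, h2⟩ := Finset.mem_filter.1 hγ
      have h3 := Nat.eq_of_mul_eq_mul_left ha h2
      rw [htot] at h3
      change m + n = e at h3
      rw [← h3, Nat.add_sub_cancel_left]
    rw [finsum_eq_sum_of_support_subset (s := s.image fun γ => γ.2.2.toMul), Finset.sum_image]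
    · refine Finset.sum_congr rfl fun γ hγ => ?_
      conv_lhs => rw [hmem γ hγ]
      rfl
    · intro γ hγ δ hδ hγδ
      rw [hmem γ hγ, hmem δ hδ]
      exact congrArg (fun ν => (d, e - d, Additive.ofMul ν)) hγδ
    · intro ν hν
      by_contra hν'
      refine hν ?_
      beta_reduce
      have htd : totalDegree (d, e - d, Additive.ofMul ν) = e := by
        rw [htot]
        change d + (e - d) = e
        omega
      rw [freeDim_eq_zero (D := D) (htd.trans_le he), Nat.cast_zero, zero_mul]
      intro hmemν
      refine hν' (Finset.mem_coe.2 (Finset.mem_image.2 ⟨(d, e - d, Additive.ofMul ν), ?_, rfl⟩))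
      exact Finset.mem_filter.2 ⟨hmemν, rfl, by rw [htd]⟩
  · refine Finset.sum_eq_zero fun γ _ => if_neg ?_
    rintro ⟨rfl, rfl⟩
    refine hc ⟨dvd_mul_right _ _, ?_⟩
    rw [Nat.mul_div_cancel_left _ ha, htot]
    exact Nat.le_add_right _ _

/-- The last summand is the real root `(d, s) = (1, -1)`, the one nonzero root space with `d > 0`
that the free part misses. -/
theorem heckeTrace_eq (hμ : act.IsTraceData h μ) {D a d j : ℕ} (ha : 0 < a) (hd : 0 < d)
    (hj : j ≤ D) : act.heckeTrace h a d j =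
    ∑ γ ∈ act.freeSupport h μ D, (if γ.1 = d ∧ a * totalDegree γ = j then
      (act.freeDim h μ γ : ℂ) * γ.2.2.toMul ^ a else 0) +
    if d = 1 then if j = 0 then act.zeta h ^ a else 0 else 0 := by
  rw [sum_freeSupport hμ ha hd hj, heckeTrace]
  by_cases haj : a ∣ j
  · obtain ⟨e, rfl⟩ := haj
    simp only [dvd_mul_right, if_true, true_and, Nat.mul_div_cancel_left _ ha]
    have he : a * e = 0 ↔ e = 0 := by simp [ha.ne']
    by_cases hde : d ≤ e
    · rw [if_pos hde]
      have : ¬ (a * e = 0) := by rw [he]; omega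
      rw [if_neg this, ite_self, add_zero]
    · rw [if_neg hde, zero_add]
      by_cases hd1 : d = 1
      · subst hd1
        obtain rfl : e = 0 := by omega
        simp [rootTrace_one_neg_one]
      · rw [if_neg hd1, rootTrace, trace_rootRep_of_neg (by omega) (by omega) (by omega)]
  · have hj0 : j ≠ 0 := by
      rintro rfl
      exact haj (dvd_zero a)
    simp [haj, hj0]

/-- A factor `1 - ν p^d q^e` contributes `-d ν^a` at `p^(ad) q^(ae)`. Collecting factors with the
same `d` turns the powers `ν^a` into traces of `h^a`. -/
theorem coeff_truncLogDeriv (hμ : act.IsTraceData h μ) {D j : ℕ} (hj : j ≤ D) (k : ℕ) :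
    coeff j (coeff k (act.truncLogDeriv h μ D)) =
      -∑ ad ∈ k.divisorsAntidiagonal, (ad.2 : ℂ) * act.heckeTrace h ad.1 ad.2 j := by
  rcases Nat.eq_zero_or_pos k with rfl | hk
  · simp [truncLogDeriv, logDeriv]
  have h1 : ∀ ad ∈ k.divisorsAntidiagonal, (ad.2 : ℂ) * act.heckeTrace h ad.1 ad.2 j =
      (if ad.2 = 1 then if j = 0 then act.zeta h ^ ad.1 else 0 else 0) +
      ∑ γ ∈ act.freeSupport h μ D, if ad.2 = γ.1 then (γ.1 : ℂ) * if j = ad.1 * totalDegree γ then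
        (act.freeDim h μ γ : ℂ) * γ.2.2.toMul ^ ad.1 else 0 else 0 := by
    intro ad had
    rw [Nat.mem_divisorsAntidiagonal] at had
    have hpos : 0 < ad.1 * ad.2 := by
      rw [had.1]
      exact hk
    have ha : 0 < ad.1 := Nat.pos_of_mul_pos_right hpos
    have hd : 0 < ad.2 := Nat.pos_of_mul_pos_left hpos
    rw [heckeTrace_eq hμ ha hd hj, mul_add, add_comm, Finset.mul_sum]
    congr 1
    · split_ifs with h1 <;> simp [h1]
    · refine Finset.sum_congr rfl fun γ _ => ?_
      by_cases h1 : ad.2 = γ.1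
      · rw [if_pos h1, h1]
        simp only [true_and, eq_comm]
      · rw [if_neg h1, if_neg fun h => h1 h.1.symm, mul_zero]
  rw [Finset.sum_congr rfl h1, Finset.sum_add_distrib, Finset.sum_comm,
    sum_divisorsAntidiagonal_ite hk.ne' 1 fun a => if j = 0 then act.zeta h ^ a else 0,
    if_pos (one_dvd k), Nat.div_one, truncLogDeriv, map_add, map_add, map_sum, map_sum, neg_add,
    ← Finset.sum_neg_distrib]
  congr 1
  · rw [logDeriv, coeff_mk, if_pos ⟨one_dvd k, hk.ne'⟩, Nat.div_one, Nat.cast_one, one_mul, map_neg,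
      ← map_pow, coeff_C]
  · refine Finset.sum_congr rfl fun γ _ => ?_
    rw [sum_divisorsAntidiagonal_ite hk.ne' γ.1 fun a => (γ.1 : ℂ) * if j = a * totalDegree γ then
        (act.freeDim h μ γ : ℂ) * γ.2.2.toMul ^ a else 0, map_nsmul, map_nsmul, logDeriv, coeff_mk,
      nsmul_eq_mul]
    by_cases hd : γ.1 ∣ k
    · rw [if_pos ⟨hd, hk.ne'⟩, if_pos hd, map_neg, mul_pow, ← map_pow, ← pow_mul, ← mul_assoc,
        mul_comm (totalDegree γ), ← map_natCast (C : ℂ →+* PowerSeries ℂ), ← map_mul,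
        coeff_C_mul_X_pow]
      split_ifs <;> ring
    · rw [if_neg fun h => hd h.1, if_neg hd]
      simp

variable (act h)

/-- The logarithm of the denominator. -/
noncomputable def logDenominator : PowerSeries (PowerSeries ℂ) :=
  PowerSeries.mk fun k => PowerSeries.mk fun j =>
    -(1 / (k : ℂ)) * ∑ ad ∈ k.divisorsAntidiagonal, (ad.2 : ℂ) * act.heckeTrace h ad.1 ad.2 j

/-- Checked modulo each power of `q` separately, because the product over all roots is finite only
after truncation. -/
theorem denominator_mul_euler :
    act.denominator h * euler (act.logDenominator h) = euler (act.denominator h) := by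
  obtain ⟨μ, hμ⟩ := act.exists_isTraceData h
  refine eq_of_truncMap fun D => ?_
  rw [← truncMap_mul_truncLogDeriv act h μ (truncMap_denominator hμ D), map_mul, map_mul]
  congr 1
  rw [truncMap_eq_iff]
  intro k j hj
  rw [coeff_truncLogDeriv hμ hj, coeff_euler, logDenominator, coeff_mk,
    ← map_natCast (C : ℂ →+* PowerSeries ℂ), coeff_C_mul, coeff_mk]
  rcases Nat.eq_zero_or_pos k with rfl | hk
  · simp
  · have : (k : ℂ) ≠ 0 := by exact_mod_cast hk.ne'
    field_simp

end HomogeneousAction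

end FrickeLie

namespace FrickeLie

open Module

/-! ### Fractional powers of `q` -/

section Fractional

open PowerSeries

variable (N : ℕ) [NeZero N]

/-- The homomorphism that replaces `q` by `q^(1/N)`. -/
noncomputable def rootHom : PowerSeries ℂ →+* QSeries :=
  (HahnSeries.embDomainRingHom ((AddMonoidHom.mulRight ((N : ℚ)⁻¹)).comp (Nat.castAddMonoidHom ℚ))
    (fun i j hij => by
      have hN : ((N : ℚ)⁻¹) ≠ 0 := inv_ne_zero (by exact_mod_cast NeZero.ne N)
      exact Nat.cast_injective (mul_right_cancel₀ hN hij))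
    (fun i j => by
      have hN : 0 < ((N : ℚ)⁻¹) := inv_pos.2 (by exact_mod_cast NeZero.pos N)
      change (i : ℚ) * (N : ℚ)⁻¹ ≤ j * (N : ℚ)⁻¹ ↔ i ≤ j
      rw [mul_le_mul_iff_left₀ hN, Nat.cast_le])).comp
    (RingEquiv.toRingHom HahnSeries.toPowerSeries.symm)

variable {N}

theorem coeff_rootHom {f : PowerSeries ℂ} {j : ℕ} {y : ℚ} (hy : y * N = j) :
    (rootHom N f).coeff y = coeff j f := by
  have hN : (N : ℚ) ≠ 0 := by exact_mod_cast NeZero.ne N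
  obtain rfl : y = (j : ℚ) * (N : ℚ)⁻¹ := by
    rw [← hy]
    field_simp
  exact HahnSeries.embDomain_coeff.trans HahnSeries.coeff_toPowerSeries_symm

theorem coeff_rootHom_eq_zero {f : PowerSeries ℂ} {y : ℚ} (hy : ∀ j : ℕ, y * N ≠ j) :
    (rootHom N f).coeff y = 0 := by
  have hN : (N : ℚ) ≠ 0 := by exact_mod_cast NeZero.ne N
  refine HahnSeries.embDomain_notin_image_support ?_
  rintro ⟨j, -, rfl⟩
  refine hy j ?_
  change (j : ℚ) * (N : ℚ)⁻¹ * N = j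
  field_simp

variable (N)

/-- The homomorphism that replaces `q` by `q^(1/N)` and `p` by `p q^(-1/N)`. -/
noncomputable def unscaleHom : PowerSeries (PowerSeries ℂ) →+* PowerSeries QSeries :=
  (rescale (HahnSeries.single (-(N : ℚ)⁻¹) (1 : ℂ))).comp (map (rootHom N))

variable {N}

theorem coeff_coeff_unscaleHom_aux (f : PowerSeries (PowerSeries ℂ)) (m : ℕ) (y : ℚ) :
    (coeff m (unscaleHom N f)).coeff y = (rootHom N (coeff m f)).coeff (y + m * (N : ℚ)⁻¹) := by
  rw [unscaleHom, RingHom.comp_apply, coeff_rescale, coeff_map, HahnSeries.single_pow, one_pow,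
    HahnSeries.coeff_single_mul, one_mul]
  congr 1
  rw [nsmul_eq_mul]
  ring

theorem coeff_coeff_unscaleHom {f : PowerSeries (PowerSeries ℂ)} {m j : ℕ} {y : ℚ}
    (hy : y * N + m = j) : (coeff m (unscaleHom N f)).coeff y = coeff j (coeff m f) := by
  have hN : (N : ℚ) ≠ 0 := by exact_mod_cast NeZero.ne N
  rw [coeff_coeff_unscaleHom_aux, coeff_rootHom]
  rw [← hy]
  field_simp

theorem coeff_coeff_unscaleHom_eq_zero {f : PowerSeries (PowerSeries ℂ)} {m : ℕ} {y : ℚ}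
    (hy : ∀ j : ℕ, y * N + m ≠ j) : (coeff m (unscaleHom N f)).coeff y = 0 := by
  have hN : (N : ℚ) ≠ 0 := by exact_mod_cast NeZero.ne N
  rw [coeff_coeff_unscaleHom_aux, coeff_rootHom_eq_zero]
  intro j hj
  refine hy j ?_
  rw [← hj]
  field_simp

theorem euler_rescale {S : Type*} [CommRing S] (a : S) (f : PowerSeries S) :
    euler (rescale a f) = rescale a (euler f) := by
  ext n
  rw [coeff_euler, coeff_rescale, coeff_rescale, coeff_euler]
  ring

theorem euler_unscaleHom (f : PowerSeries (PowerSeries ℂ)) :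
    euler (unscaleHom N f) = unscaleHom N (euler f) := by
  rw [unscaleHom, RingHom.comp_apply, RingHom.comp_apply, euler_rescale, euler_map]

theorem ofPowerSeries_sub_X_mul_C {S : Type*} [CommRing S] (f : PowerSeries S) (c : S) :
    HahnSeries.ofPowerSeries ℤ S (f - X * C c) =
      HahnSeries.single 1 1 * (HahnSeries.single (-1) 1 * HahnSeries.ofPowerSeries ℤ S f -
        HahnSeries.C c) := by
  rw [map_sub, map_mul, HahnSeries.ofPowerSeries_X, HahnSeries.ofPowerSeries_C, mul_sub,
    ← mul_assoc, HahnSeries.single_mul_single, add_neg_cancel, one_mul,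
    HahnSeries.single_zero_one, one_mul]

end Fractional

/-! ### Return to the original variables -/

namespace HomogeneousAction

variable {𝔤 : Type u} [LieRing 𝔤] [LieAlgebra ℂ 𝔤] {F : FrickeStructure.{u, v} 𝔤}
  {H : Type w} [Group H] (act : HomogeneousAction F H) (h : H) (N : ℕ) [NeZero N]

open PowerSeries

theorem coeff_zero_denominator : coeff 0 (act.denominator h) = 1 := by
  ext j
  have hz := act.zeta_ne_zero h
  rw [denominator, coeff_mk, coeff_mk, coeff_one]
  simp [rootTrace_one_neg_one, hz]

theorem constantCoeff_unscaleHom_denominator :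
    constantCoeff (unscaleHom N (act.denominator h)) = 1 := by
  rw [← coeff_zero_eq_constantCoeff_apply, unscaleHom, RingHom.comp_apply, coeff_rescale, coeff_map,
    coeff_zero_denominator, map_one (rootHom N), pow_zero, one_mul]

/-- The change of variables is a ring homomorphism commuting with the Euler operator in `p`, so the
relation `L · X G' = X L'` is transported without any continuity argument. -/
theorem logOf_unscaleHom_denominator [Algebra ℚ QSeries] :
    logOf (unscaleHom N (act.denominator h)) = unscaleHom N (act.logDenominator h) := by
  refine logOf_eq_of_mul_euler (act.constantCoeff_unscaleHom_denominator h N) ?_ ?_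
  · have h0 : coeff 0 (act.logDenominator h) = 0 := by
      ext j
      rw [logDenominator, coeff_mk, coeff_mk]
      simp
    rw [← coeff_zero_eq_constantCoeff_apply, unscaleHom, RingHom.comp_apply, coeff_rescale,
      coeff_map, h0, map_zero, mul_zero]
  · rw [euler_unscaleHom, euler_unscaleHom, ← map_mul, denominator_mul_euler]

/-- The trace function in the variable `p`, divided by the pole. -/
noncomputable def traceSeries : PowerSeries QSeries :=
  PowerSeries.mk fun m =>
    HahnSeries.C (act.rootTrace h 1 (m - 1) 1 * act.zeta h ^ ((m : ℤ) - 1))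

/-- The trace function in the variable `q`. -/
noncomputable def traceQSeries : QSeries :=
  -- The coefficient of `p` in `p (f(ζp) - f(q))`, solved for `f(q)`; well-ordered support is
  -- thereby automatic.
  HahnSeries.C (act.rootTrace h 1 0 1) - coeff 1 (unscaleHom N (act.denominator h))

theorem coeff_C_eq (c : ℂ) (y : ℚ) : (HahnSeries.C c : QSeries).coeff y = if y = 0 then c else 0 := by
  rw [HahnSeries.C_apply, HahnSeries.coeff_single]
  split_ifs <;> rfl

theorem unscaleHom_denominator_eq : unscaleHom N (act.denominator h) =
    act.traceSeries h - X * C (act.traceQSeries h N) := by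
  have hN : (N : ℚ) ≠ 0 := by exact_mod_cast NeZero.ne N
  ext1 m
  rw [map_sub, mul_comm, coeff_C_mul, coeff_X, traceSeries, coeff_mk]
  by_cases hm : m = 1
  · subst hm
    rw [if_pos rfl, mul_one, traceQSeries]
    simp
  · rw [if_neg hm, mul_zero, sub_zero]
    ext y
    rw [coeff_C_eq]
    by_cases hy : ∃ j : ℕ, y * N + m = j
    · obtain ⟨j, hj⟩ := hy
      have hjm : j = m ↔ y = 0 := by
        constructor
        · rintro rfl
          have : y * N = 0 := by linarith
          exact (mul_eq_zero.1 this).resolve_right hN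
        · rintro rfl
          have : (m : ℚ) = j := by linarith
          exact_mod_cast this.symm
      rw [coeff_coeff_unscaleHom hj, denominator, coeff_mk, coeff_mk, if_neg hm, sub_zero]
      simp only [hjm]
    · push Not at hy
      rw [coeff_coeff_unscaleHom_eq_zero hy, if_neg]
      rintro rfl
      exact hy m (by ring)

theorem coeff_traceQSeries {y : ℚ} {s : ℤ} (hs : y * N = s) :
    (act.traceQSeries h N).coeff y = act.rootTrace h 1 s 1 := by
  have hN : (N : ℚ) ≠ 0 := by exact_mod_cast NeZero.ne N
  have hy0 : y = 0 ↔ s = 0 := by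
    constructor
    · rintro rfl
      have : (s : ℚ) = 0 := by linarith
      exact_mod_cast this
    · rintro rfl
      have : y * N = 0 := by rw [hs, Int.cast_zero]
      exact (mul_eq_zero.1 this).resolve_right hN
  rw [traceQSeries, HahnSeries.coeff_sub, coeff_C_eq]
  simp only [hy0]
  by_cases hs1 : 0 ≤ s + 1
  · obtain ⟨j, hj⟩ := Int.eq_ofNat_of_zero_le hs1
    have hj' : (s : ℚ) + 1 = j := by exact_mod_cast hj
    rw [coeff_coeff_unscaleHom (j := j) (by rw [hs, Nat.cast_one, hj']), denominator, coeff_mk,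
      coeff_mk, if_pos rfl, ← hj, add_sub_cancel_right]
    have hj1 : j = 1 ↔ s = 0 := by omega
    simp only [hj1, Nat.cast_one, sub_self, zpow_zero, mul_one]
    ring
  · rw [coeff_coeff_unscaleHom_eq_zero, if_neg (by omega), sub_zero, rootTrace,
      trace_rootRep_of_neg le_rfl (by omega) (by omega)]
    intro j hj
    rw [hs] at hj
    have : s + 1 = (j : ℤ) := by exact_mod_cast hj
    omega

theorem coeff_traceQSeries_eq_zero {y : ℚ} (hy : ∀ s : ℤ, y * N ≠ s) :
    (act.traceQSeries h N).coeff y = 0 := by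
  rw [traceQSeries, HahnSeries.coeff_sub, coeff_C_eq, if_neg, coeff_coeff_unscaleHom_eq_zero,
    sub_zero]
  · intro j hj
    refine hy (j - 1) ?_
    push_cast at hj ⊢
    linarith
  · rintro rfl
    exact hy 0 (by simp)

/-- The trace function in the variable `p`. -/
noncomputable def tracePSeries : LaurentSeries QSeries :=
  HahnSeries.single (-1) 1 * HahnSeries.ofPowerSeries ℤ QSeries (act.traceSeries h)

theorem coeff_tracePSeries (t : ℤ) : (act.tracePSeries h).coeff t =
    HahnSeries.C (act.rootTrace h 1 t 1 * act.zeta h ^ t) := by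
  rw [tracePSeries, HahnSeries.coeff_single_mul, one_mul, sub_neg_eq_add]
  by_cases ht : 0 ≤ t + 1
  · obtain ⟨j, hj⟩ := Int.eq_ofNat_of_zero_le ht
    obtain rfl : t = j - 1 := by omega
    rw [hj, HahnSeries.ofPowerSeries_apply_coeff, traceSeries, coeff_mk]
  · rw [rootTrace, trace_rootRep_of_neg le_rfl (by omega) (by omega), zero_mul, map_zero,
      HahnSeries.ofPowerSeries_apply, HahnSeries.embDomain_notin_image_support]
    rintro ⟨j, -, hj⟩
    have : (j : ℤ) = t + 1 := hj
    omega

theorem ofPowerSeries_unscaleHom_denominator :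
    HahnSeries.ofPowerSeries ℤ QSeries (unscaleHom N (act.denominator h)) =
      HahnSeries.single 1 1 * (act.tracePSeries h - HahnSeries.C (act.traceQSeries h N)) := by
  rw [unscaleHom_denominator_eq]
  exact ofPowerSeries_sub_X_mul_C _ _

end HomogeneousAction

end FrickeLie

namespace FrickeLie

open Module

/-! ### Hecke operators -/

theorem sum_range_exp {d : ℕ} (hd : 0 < d) (k : ℤ) :
    ∑ b ∈ Finset.range d, Complex.exp (2 * Real.pi * Complex.I * b * k / d) =
      if (d : ℤ) ∣ k then (d : ℂ) else 0 := by
  have hd0 : (d : ℂ) ≠ 0 := by exact_mod_cast hd.ne'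
  have hpi := Complex.two_pi_I_ne_zero
  set z := Complex.exp (2 * Real.pi * Complex.I * k / d) with hz
  have h1 : ∀ b : ℕ, Complex.exp (2 * Real.pi * Complex.I * b * k / d) = z ^ b := by
    intro b
    rw [hz, ← Complex.exp_nat_mul]
    congr 1
    ring
  have hzd : z ^ d = 1 := by
    rw [hz, ← Complex.exp_nat_mul, mul_div_cancel₀ _ hd0, Complex.exp_eq_one_iff]
    exact ⟨k, by ring⟩
  have hz1 : z = 1 ↔ (d : ℤ) ∣ k := by
    rw [hz, Complex.exp_eq_one_iff]
    constructor
    · rintro ⟨n, hn⟩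
      refine ⟨n, ?_⟩
      rw [div_eq_iff hd0] at hn
      have h2 : (2 * Real.pi * Complex.I) * ((k : ℂ) - d * n) = 0 := by
        linear_combination hn
      have h3 := sub_eq_zero.1 ((mul_eq_zero.1 h2).resolve_left hpi)
      exact_mod_cast h3
    · rintro ⟨n, rfl⟩
      refine ⟨n, ?_⟩
      push_cast
      field_simp
  rw [Finset.sum_congr rfl fun b _ => h1 b]
  split_ifs with hk
  · rw [hz1.2 hk]
    simp
  · have h3 := mul_geom_sum z d
    rw [hzd, sub_self] at h3
    exact (mul_eq_zero.1 h3).resolve_left (sub_ne_zero.2 (mt hz1.1 hk))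

/-! ### Root-of-unity averages and traces on root spaces -/

namespace HomogeneousAction.RootModules

variable {𝔤 : Type u} [LieRing 𝔤] [LieAlgebra ℂ 𝔤] {F : FrickeStructure.{u, v} 𝔤}
  {H : Type w} [Group H] {act : HomogeneousAction F H} {N : ℕ} [NeZero N]
  (M : RootModules.{u, v, w, x} act N) (h : H)

theorem trace_rep {r s n : ℤ} (hrs : (r, s) ≠ (0, 0)) {β : ZMod N} (hβ : β = (s : ZMod N))
    (hn : n = r * s) (a : ℕ) :
    LinearMap.trace ℂ (M.V r β n) (M.rep r β n (h ^ (a : ℤ))) = act.rootTrace h r s a := by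
  subst hβ hn
  rw [zpow_natCast, rootTrace]
  have φ := M.equiv r s hrs
  rw [← LinearMap.trace_conj' (act.rootRep r s (h ^ a)) φ.toLinearEquiv]
  congr 1
  ext1 y
  rw [LinearEquiv.conj_apply_apply]
  have h1 := LinearMap.congr_fun (φ.isIntertwining' (h ^ a)) (φ.toLinearEquiv.symm y)
  refine Eq.trans ?_ h1.symm
  exact congrArg _ (φ.toLinearEquiv.apply_symm_apply y).symm

theorem traceFn_one (t : ℤ) : M.traceFn h 1 0 1 t = act.rootTrace h 1 t 1 := by
  rw [traceFn, Finset.sum_eq_single (t : ZMod N)]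
  · rw [if_pos (by simp)]
    have h1 := M.trace_rep h (r := 1) (s := t) (n := t) (by simp) rfl (by ring) 1
    rw [Nat.cast_one] at h1
    rw [h1]
    simp
  · intro b _ hb
    rw [if_neg]
    simpa using hb
  · intro hb
    exact absurd (Finset.mem_univ _) hb

/-- If `d β ≡ t` modulo `N`, write `t = d β + N k`; the two phases combine to `exp(2πi b k / d)`,
and the sum over `b` selects `d ∣ k`. This means `t = d s` with `s ≡ β` modulo `N`, so the surviving
module is `𝔤_{d,s}`. Modules that are not root spaces drop out, which is why nothing need be
required of them. -/
theorem sum_traceFn {a d : ℕ} (hd : 0 < d) (t : ℤ) :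
    ∑ b ∈ Finset.range d, Complex.exp (2 * Real.pi * Complex.I * b * t / (d * N)) *
      M.traceFn h d (-(b : ℤ)) a t =
    if (d : ℤ) ∣ t then d * act.rootTrace h d (t / d) a else 0 := by
  have hN : (N : ℂ) ≠ 0 := by exact_mod_cast NeZero.ne N
  have hd0 : (d : ℂ) ≠ 0 := by exact_mod_cast hd.ne'
  simp only [traceFn, Finset.mul_sum]
  rw [Finset.sum_comm]
  have key : ∀ β : ZMod N, ∑ b ∈ Finset.range d,
      Complex.exp (2 * Real.pi * Complex.I * b * t / (d * N)) *
      (if (((d : ℤ) : ℤ) : ZMod N) * β = (t : ZMod N) then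
        Complex.exp (2 * Real.pi * Complex.I * (-(b : ℤ) : ℤ) * ((β.val : ℂ) / N)) *
        LinearMap.trace ℂ (M.V (d : ℤ) β t) (M.rep (d : ℤ) β t (h ^ (a : ℤ))) else 0) =
      if (d : ℤ) ∣ t ∧ β = ((t / d : ℤ) : ZMod N) then d * act.rootTrace h d (t / d) a else 0 := by
    intro β
    by_cases hβ : (((d : ℤ) : ℤ) : ZMod N) * β = (t : ZMod N)
    · simp only [if_pos hβ]
      have hval : ((β.val : ℤ) : ZMod N) = β := by
        rw [Int.cast_natCast, ZMod.natCast_zmod_val]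
      have h1 : ((d * β.val : ℤ) : ZMod N) = (t : ZMod N) := by
        rw [Int.cast_mul, hval, hβ]
      rw [ZMod.intCast_eq_intCast_iff_dvd_sub] at h1
      obtain ⟨k, hk⟩ := h1
      have hk' : (t : ℂ) = d * β.val + N * k := by
        have : t = d * β.val + N * k := by linarith
        exact_mod_cast this
      have h2 : ∀ b : ℕ, Complex.exp (2 * Real.pi * Complex.I * b * t / (d * N)) *
          (Complex.exp (2 * Real.pi * Complex.I * (-(b : ℤ) : ℤ) * ((β.val : ℂ) / N)) *
            LinearMap.trace ℂ (M.V (d : ℤ) β t) (M.rep (d : ℤ) β t (h ^ (a : ℤ)))) =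
          Complex.exp (2 * Real.pi * Complex.I * b * k / d) *
            LinearMap.trace ℂ (M.V (d : ℤ) β t) (M.rep (d : ℤ) β t (h ^ (a : ℤ))) := by
        intro b
        rw [← mul_assoc, ← Complex.exp_add]
        congr 2
        rw [hk']
        push_cast
        field_simp
        ring
      simp only [h2]
      rw [← Finset.sum_mul, sum_range_exp hd]
      have hiff : (d : ℤ) ∣ k ↔ (d : ℤ) ∣ t ∧ β = ((t / d : ℤ) : ZMod N) := by
        have hdz : (d : ℤ) ≠ 0 := by exact_mod_cast hd.ne'
        constructor
        · rintro ⟨l, rfl⟩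
          have ht : t = d * (β.val + N * l) := by linarith
          refine ⟨⟨_, ht⟩, ?_⟩
          rw [ht, Int.mul_ediv_cancel_left _ hdz]
          push_cast
          simp
        · rintro ⟨⟨s, rfl⟩, hs⟩
          rw [Int.mul_ediv_cancel_left _ hdz] at hs
          rw [← hval, ZMod.intCast_eq_intCast_iff_dvd_sub] at hs
          obtain ⟨l, hl⟩ := hs
          refine ⟨l, ?_⟩
          have hNz : (N : ℤ) ≠ 0 := by exact_mod_cast NeZero.ne N
          refine mul_left_cancel₀ hNz ?_
          linear_combination (d : ℤ) * hl - hk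
      simp only [hiff]
      split_ifs with hc
      · obtain ⟨⟨s, rfl⟩, hs⟩ := hc
        have hdz : (d : ℤ) ≠ 0 := by exact_mod_cast hd.ne'
        rw [Int.mul_ediv_cancel_left _ hdz] at hs ⊢
        rw [M.trace_rep h (by simp [hd.ne']) hs rfl]
      · rw [zero_mul]
    · simp only [if_neg hβ, mul_zero, Finset.sum_const_zero]
      rw [if_neg]
      rintro ⟨⟨s, rfl⟩, rfl⟩
      refine hβ ?_
      rw [Int.mul_ediv_cancel_left _ (by exact_mod_cast hd.ne'), ← Int.cast_mul]
  rw [Finset.sum_congr rfl fun β _ => key β]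
  split_ifs with hdt
  · simp [hdt]
  · simp [hdt]

theorem evalRoot_eq (c : ℤ → ℂ) {a d : ℕ} (b : ℕ) (ha : 0 < a) (hd : 0 < d) {t : ℤ} {y : ℚ}
    (ht : (a : ℚ) * t / (d * N) = y) :
    evalRoot N c a d b y = Complex.exp (2 * Real.pi * Complex.I * b * t / (d * N)) * c t := by
  have hN : (N : ℚ) ≠ 0 := by exact_mod_cast NeZero.ne N
  have ha0 : (a : ℚ) ≠ 0 := by exact_mod_cast ha.ne'
  have hd0 : (d : ℚ) ≠ 0 := by exact_mod_cast hd.ne'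
  rw [evalRoot, finsum_eq_single _ (⟨t, ht⟩ : {t : ℤ // (a : ℚ) * t / (d * N) = y})]
  rintro ⟨t', ht'⟩ hne
  refine absurd (Subtype.ext ?_) hne
  rw [← ht] at ht'
  field_simp at ht'
  exact_mod_cast ht'

theorem evalRoot_eq_zero (c : ℤ → ℂ) {a d : ℕ} (b : ℕ) {y : ℚ}
    (hy : ∀ t : ℤ, (a : ℚ) * t / (d * N) ≠ y) : evalRoot N c a d b y = 0 := by
  have : IsEmpty {t : ℤ // (a : ℚ) * t / (d * N) = y} := ⟨fun t => hy t t.2⟩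
  rw [evalRoot, finsum_of_isEmpty]

theorem sum_evalRoot {a d : ℕ} (ha : 0 < a) (hd : 0 < d) {s : ℤ} {y : ℚ}
    (hs : (a : ℚ) * s = y * N) :
    ∑ b ∈ Finset.range d, evalRoot N (M.traceFn h d (-(b : ℤ)) a) a d b y =
      d * act.rootTrace h d s a := by
  have hN : (N : ℚ) ≠ 0 := by exact_mod_cast NeZero.ne N
  have hd0 : (d : ℚ) ≠ 0 := by exact_mod_cast hd.ne'
  have hdz : (d : ℤ) ≠ 0 := by exact_mod_cast hd.ne'
  have ht : (a : ℚ) * (d * s : ℤ) / (d * N) = y := by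
    rw [div_eq_iff (mul_ne_zero hd0 hN)]
    push_cast
    linear_combination (d : ℚ) * hs
  rw [Finset.sum_congr rfl fun b _ => evalRoot_eq _ b ha hd ht, sum_traceFn M h hd,
    if_pos (dvd_mul_right _ _), Int.mul_ediv_cancel_left _ hdz]

theorem sum_evalRoot_eq_zero {a d : ℕ} (ha : 0 < a) (hd : 0 < d) {y : ℚ}
    (hy : ∀ s : ℤ, (a : ℚ) * s ≠ y * N) :
    ∑ b ∈ Finset.range d, evalRoot N (M.traceFn h d (-(b : ℤ)) a) a d b y = 0 := by
  have hN : (N : ℚ) ≠ 0 := by exact_mod_cast NeZero.ne N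
  have hd0 : (d : ℚ) ≠ 0 := by exact_mod_cast hd.ne'
  by_cases hex : ∃ t : ℤ, (a : ℚ) * t / (d * N) = y
  · obtain ⟨t, ht⟩ := hex
    rw [Finset.sum_congr rfl fun b _ => evalRoot_eq _ b ha hd ht, sum_traceFn M h hd, if_neg]
    rintro ⟨s, rfl⟩
    refine hy s ?_
    rw [← ht]
    push_cast
    field_simp
  · push Not at hex
    exact Finset.sum_eq_zero fun b _ => evalRoot_eq_zero _ b hex

theorem coeff_traceQSeries (y : ℚ) : (act.traceQSeries h N).coeff y =
    evalRoot N (M.traceFn h 1 0 1) 1 1 0 y := by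
  have h0 : ∑ b ∈ Finset.range 1, evalRoot N (M.traceFn h (1 : ℕ) (-(b : ℤ)) (1 : ℕ)) 1 1 b y =
      evalRoot N (M.traceFn h 1 0 1) 1 1 0 y := by simp
  rw [← h0]
  by_cases hex : ∃ s : ℤ, y * N = s
  · obtain ⟨s, hs⟩ := hex
    rw [act.coeff_traceQSeries h N hs, M.sum_evalRoot h one_pos one_pos (s := s) (by simp [hs])]
    simp
  · push Not at hex
    rw [act.coeff_traceQSeries_eq_zero h N hex, M.sum_evalRoot_eq_zero h one_pos one_pos]
    intro s hs
    exact hex s (by simpa using hs.symm)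

/-- For `m = a d` and `y = a s / N`, the index in the rescaled series is `y N + m = a (s + d)`. -/
theorem heckeSide_eq (m : ℕ) (y : ℚ) : heckeSide M h m y =
    (PowerSeries.coeff m (unscaleHom N (act.logDenominator h))).coeff y := by
  have hpos : ∀ ad ∈ m.divisorsAntidiagonal, 0 < ad.1 ∧ 0 < ad.2 ∧ ((ad.1 * ad.2 : ℕ) : ℤ) = m := by
    intro ad had
    rw [Nat.mem_divisorsAntidiagonal] at had
    have hp : 0 < ad.1 * ad.2 := by
      rw [had.1]
      exact Nat.pos_of_ne_zero had.2
    exact ⟨Nat.pos_of_mul_pos_right hp, Nat.pos_of_mul_pos_left hp, by rw [had.1]⟩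
  by_cases hex : ∃ j : ℕ, y * N + m = j
  · obtain ⟨j, hj⟩ := hex
    rw [coeff_coeff_unscaleHom hj, heckeSide, logDenominator, PowerSeries.coeff_mk,
      PowerSeries.coeff_mk]
    congr 1
    refine Finset.sum_congr rfl fun ad had => ?_
    obtain ⟨ha, hd, hm⟩ := hpos ad had
    have hmq : (m : ℚ) = ad.1 * ad.2 := by exact_mod_cast hm.symm
    rw [heckeTrace]
    split_ifs with hdvd
    · obtain ⟨e, rfl⟩ := hdvd
      rw [Nat.mul_div_cancel_left _ ha]
      refine M.sum_evalRoot h ha hd ?_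
      push_cast at hj ⊢
      linear_combination -hj + hmq
    · rw [mul_zero]
      refine M.sum_evalRoot_eq_zero h ha hd fun s hs => hdvd ?_
      have h1 : (j : ℤ) = ad.1 * (s + ad.2) := by
        have : (j : ℚ) = ad.1 * (s + ad.2) := by linear_combination -hj - hs + hmq
        exact_mod_cast this
      exact Int.natCast_dvd_natCast.1 ⟨_, h1⟩
  · push Not at hex
    rw [coeff_coeff_unscaleHom_eq_zero hex, heckeSide, Finset.sum_eq_zero, mul_zero]
    intro ad had
    obtain ⟨ha, hd, hm⟩ := hpos ad had
    have hmq : (m : ℚ) = ad.1 * ad.2 := by exact_mod_cast hm.symm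
    by_cases hs : ∃ s : ℤ, (ad.1 : ℚ) * s = y * N
    · obtain ⟨s, hs⟩ := hs
      -- Outside the range of the rescaled series `s < -d`, so `(d, s)` is not even the real root
      -- and its root space is zero.
      have hneg : s + ad.2 < 0 := by
        by_contra hge
        obtain ⟨k, hk⟩ := Int.eq_ofNat_of_zero_le (not_lt.1 hge)
        refine hex (ad.1 * k) ?_
        have hk' : (s : ℚ) + ad.2 = k := by exact_mod_cast hk
        push_cast
        rw [← hk']
        linear_combination -hs + hmq
      rw [M.sum_evalRoot h ha hd hs, rootTrace, trace_rootRep_of_neg (by omega) (by omega)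
        (by omega), mul_zero]
    · push Not at hs
      exact M.sum_evalRoot_eq_zero h ha hd hs

end HomogeneousAction.RootModules

end FrickeLie

/-! ### The twisted denominator formula in Hecke form -/

theorem mainTheorem2 {𝔤 : Type u} [LieRing 𝔤] [LieAlgebra ℂ 𝔤]
    (F : FrickeLie.FrickeStructure.{u, v} 𝔤) {H : Type w} [Group H]
    (act : FrickeLie.HomogeneousAction F H) (N : ℕ) [NeZero N] (hq : act.IsQCompatible N)
    (M : FrickeLie.HomogeneousAction.RootModules.{u, v, w, x} act N) (h : H) :
    -- all traces on root spaces are traces on finite-dimensional spaces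
    (∀ r s : ℤ, FiniteDimensional ℂ (F.rootSpace r s)) ∧
    -- `P` is `f_{1,0,1}((ζ_h p)^N)`, `Q` is `f_{1,0,1}(q)`, `L` is `p (P - Q)`
    ∃ (P : LaurentSeries FrickeLie.QSeries) (Q : FrickeLie.QSeries)
      (L : PowerSeries FrickeLie.QSeries),
      (∀ t : ℤ, P.coeff t = HahnSeries.C (M.traceFn h 1 0 1 t * act.zeta h ^ t)) ∧
      (∀ y : ℚ, Q.coeff y = FrickeLie.evalRoot N (M.traceFn h 1 0 1) 1 1 0 y) ∧
      HahnSeries.ofPowerSeries ℤ FrickeLie.QSeries L =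
        HahnSeries.single 1 1 * (P - HahnSeries.C Q) ∧
      PowerSeries.constantCoeff L = 1 ∧
      ∀ (m : ℕ) (y : ℚ),
        (PowerSeries.coeff m (PowerSeries.logOf L)).coeff y = FrickeLie.heckeSide M h m y := by
  refine ⟨fun r s => F.finiteDimensional_E (r, s), act.tracePSeries h, act.traceQSeries h N,
    FrickeLie.unscaleHom N (act.denominator h), fun t => ?_, fun y => M.coeff_traceQSeries h y,
    act.ofPowerSeries_unscaleHom_denominator h N, act.constantCoeff_unscaleHom_denominator h N,
    fun m y => ?_⟩
  · rw [act.coeff_tracePSeries, M.traceFn_one]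
  · rw [act.logOf_unscaleHom_denominator h N, M.heckeSide_eq]
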